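/- Let $N,l\ge 0$ be integers with $N+l\ge 3$, let $p>1$ and $\gamma\ge 0$ be real, and write $z=(x,y)=(x_1,\dots,x_N,y_1,\dots,y_l)\in\mathbb R^{N+l}$. Put $\nabla_\gamma u=(\nabla_x u,|x|^\gamma\nabla_y u)$. Let $\Omega\subset\mathbb R^{N+l}$ be a bounded open set, let $f:\mathbb R^{N+l}\times\mathbb R\to\mathbb R$ be continuous, and put $F(z,s)=\int_0^s f(z,\tau)\,d\tau$. Let $W^{1,p}_\lambda(\Omega)$ be the space of all $u\in L^p(\Omega)$ whose weak derivatives $\partial u/\partial x_i$ and $|x|^\gamma\,\partial u/\partial y_j$ lie in $L^p(\Omega)$ for all $i,j$, with norm $\big(\int_\Omega |\nabla_\gamma u|^p+|u|^p\,dz\big)^{1/p}$, and let $W^{1,p}_{\lambda,0}(\Omega)$ be the closure of $C_0^\infty(\Omega)$ in it. Let $u\in W^{1,p}_{\lambda,0}(\Omega)\cap C^1(\Omega)$ be a weak solution of the Dirichlet problem $-\mathrm{div}_\gamma(|\nabla_\gamma u|^{p-2}\nabla_\gamma u)=f(z,u)$ in $\Omega$, $u=0$ on $\partial\Omega$, that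 is, $$\int_\Omega|\nabla_\gamma u|^{p-2}\nabla_\gamma u\cdot\nabla_\gamma\varphi\,dz=\int_\Omega f(z,u)\varphi\,dz\qquad\text{for all }\varphi\in W^{1,p}_{\lambda,0}(\Omega),$$ where $f(\cdot,u)\varphi$ is integrable on $\Omega$ for all these $\varphi$. Let $D$ be an open set with $\overline D\subset\Omega$ and with boundary of class $C^1$, let $\nu=(\nu_x,\nu_y)$ be the outward unit normal on $\partial D$, let $\nu_\gamma=(\nu_x,|x|^\gamma\nu_y)$, and let $dS$ be the surface measure on $\partial D$. For a coordinate $w\in\{x_1,\dots,x_N,y_1,\dots,y_l\}$ let $\frac{\partial F}{\partial w}(z,u)$ denote the partial derivative of $F(\cdot,s)$ at $z$ in the explicit variable $w$, with $s$ fixed, taken at $s=u(z)$. (i) Let $1\le i\le N$, and suppose that $\frac{\partial F}{\partial x_i}(z,u(z))$ exists for every $z\in\Omega$ and is locally integrable in $\Omega$. Then the derivative $F_{x_i}(z,u)$ of $z\mapsto F(z,u(z))$ in the direction $x_i$ exists in $\Omega$ and is given by $$F_{x_i}(z,u)=\frac{\partial F}{\partial x_i}(z,u)+f(z,u)\frac{\partial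 u}{\partial x_i},$$ all the integrals below converge absolutely, and $$\frac1p\int_{\partial D}|\nabla_\gamma u|^p\nu_x^i\,dS-\int_{\partial D}|\nabla_\gamma u|^{p-2}\frac{\partial u}{\partial x_i}\langle\nabla_\gamma u,\nu_\gamma\rangle\,dS-\int_D|\nabla_\gamma u|^{p-2}\gamma|x|^{2(\gamma-1)}x_i|\nabla_y u|^2\,dz$$ $$=\int_{\partial D}F(z,u)\nu_x^i\,dS-\int_D\frac{\partial F}{\partial x_i}(z,u)\,dz.$$ (ii) Let $1\le j\le l$, and suppose that $\frac{\partial F}{\partial y_j}(z,u(z))$ exists for every $z\in\Omega$ and is locally integrable in $\Omega$. Then the derivative $F_{y_j}(z,u)$ of $z\mapsto F(z,u(z))$ in the direction $y_j$ exists in $\Omega$ and equals $\frac{\partial F}{\partial y_j}(z,u)+f(z,u)\frac{\partial u}{\partial y_j}$, all the integrals below converge absolutely, and $$\frac1p\int_{\partial D}|\nabla_\gamma u|^p\nu_y^j\,dS-\int_{\partial D}|\nabla_\gamma u|^{p-2}\frac{\partial u}{\partial y_j}\langle\nabla_\gamma u,\nu_\gamma\rangle\,dS=\int_{\partial D}F(z,u)\nu_y^j\,dS-\int_D\frac{\partial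 F}{\partial y_j}(z,u)\,dz.$$ Here the integrands that contain $|\nabla_\gamma u|^{p-2}$ are read as $0$ where $\nabla_\gamma u=0$. -/

import Mathlib

open MeasureTheory Set

open scoped ContDiff RealInnerProductSpace MeasureTheory

namespace Grushin

/-- The space `ℝ^{N+l}` of points `z = (x, y)` with its Euclidean norm: `x_i` is the coordinate
`Sum.inl i` and `y_j` is the coordinate `Sum.inr j`. -/
abbrev Space (N l : ℕ) : Type := EuclideanSpace ℝ (Fin N ⊕ Fin l)

variable {N l : ℕ}

/-- The component `x ∈ ℝ^N` of `z = (x, y)`. -/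
noncomputable def xPart (z : Space N l) : EuclideanSpace ℝ (Fin N) :=
  WithLp.toLp 2 (fun i => z (Sum.inl i))

/-- The component `v_y ∈ ℝ^l` of a vector `v = (v_x, v_y)`. -/
noncomputable def yPart (v : Space N l) : EuclideanSpace ℝ (Fin l) :=
  WithLp.toLp 2 (fun j => v (Sum.inr j))

/-- The coefficient of the Grushin field in direction `k`: `1` for `∂/∂x_i`, and `|x|^γ` for
`|x|^γ ∂/∂y_j`. -/
noncomputable def weight (γ : ℝ) (z : Space N l) : Fin N ⊕ Fin l → ℝ
  | Sum.inl _ => 1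
  | Sum.inr _ => ‖xPart z‖ ^ γ

/-- The `k`-th vector of the standard basis of `ℝ^{N+l}`. -/
noncomputable def basisVec (k : Fin N ⊕ Fin l) : Space N l := EuclideanSpace.single k 1

/-- The classical partial derivative of `u` at `z` in the `k`-th coordinate. -/
noncomputable def partialDeriv (k : Fin N ⊕ Fin l) (u : Space N l → ℝ) (z : Space N l) : ℝ :=
  lineDeriv ℝ u z (basisVec k)

/-- The classical gradient `∇u = (∇_x u, ∇_y u)`, as the vector of partial derivatives. -/
noncomputable def grad (u : Space N l → ℝ) (z : Space N l) : Space N l :=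
  WithLp.toLp 2 (fun k => partialDeriv k u z)

/-- `(v_x, v_y) ↦ (v_x, |x|^γ v_y)`, at the point `z = (x, y)`. It turns a normal `ν` into `ν_γ`. -/
noncomputable def scaleY (γ : ℝ) (z v : Space N l) : Space N l :=
  WithLp.toLp 2 (fun k => weight γ z k * v k)

/-- The classical Grushin gradient `∇_γ u = (∇_x u, |x|^γ ∇_y u)`. -/
noncomputable def grushinGrad (γ : ℝ) (u : Space N l → ℝ) (z : Space N l) : Space N l :=
  scaleY γ z (grad u z)

/-- `φ ∈ C_0^∞(Ω)`. -/
def IsTestFunction (Ω : Set (Space N l)) (φ : Space N l → ℝ) : Prop :=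
  ContDiff ℝ ∞ φ ∧ HasCompactSupport φ ∧ tsupport φ ⊆ Ω

/-- `u ∈ L^p(Ω)` and the field `V ∈ L^p(Ω)` is the weak Grushin gradient of `u` in `Ω`, that is,
`∂u/∂x_i = V_{x_i}` and `|x|^γ ∂u/∂y_j = V_{y_j}` in the sense of distributions on `Ω`. The formal
adjoint of `|x|^γ ∂/∂y_j` is its negative, since `|x|^γ` does not depend on `y`. -/
structure HasWeakGrushinGrad (Ω : Set (Space N l)) (γ p : ℝ) (u : Space N l → ℝ)
    (V : Space N l → Space N l) : Prop where
  memLp : MemLp u (ENNReal.ofReal p) (volume.restrict Ω)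
  memLp_grad : MemLp V (ENNReal.ofReal p) (volume.restrict Ω)
  weak : ∀ φ : Space N l → ℝ, IsTestFunction Ω φ → ∀ k : Fin N ⊕ Fin l,
    ∫ z in Ω, u z * (weight γ z k * partialDeriv k φ z) = -∫ z in Ω, V z k * φ z

/-- The norm `(∫_Ω |V|^p + |u|^p dz)^{1/p}` of a function `u` whose Grushin gradient is `V`. -/
noncomputable def sobolevNorm (Ω : Set (Space N l)) (p : ℝ) (u : Space N l → ℝ)
    (V : Space N l → Space N l) : ℝ :=
  (∫ z in Ω, (‖V z‖ ^ p + |u z| ^ p)) ^ (1 / p)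

/-- `u ∈ W^{1,p}_{λ,0}(Ω)`: `u ∈ W^{1,p}_λ(Ω)`, with weak Grushin gradient `V`, and `u` is in the
closure of `C_0^∞(Ω)` for the norm of `W^{1,p}_λ(Ω)`. -/
def MemSobolevZero (Ω : Set (Space N l)) (γ p : ℝ) (u : Space N l → ℝ) : Prop :=
  ∃ V : Space N l → Space N l, HasWeakGrushinGrad Ω γ p u V ∧
    ∀ ε : ℝ, 0 < ε → ∃ φ : Space N l → ℝ, IsTestFunction Ω φ ∧
      sobolevNorm Ω p (fun z => u z - φ z) (fun z => V z - grushinGrad γ φ z) < ε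

/-- `u` is a weak solution of `-Δ_γ^p u = f(z, u)` in `Ω`, `u = 0` on `∂Ω`: it belongs to
`W^{1,p}_{λ,0}(Ω)` and, with `U` its weak Grushin gradient (unique almost everywhere),
`∫_Ω |U|^{p-2} U · ∇_γ φ = ∫_Ω f(z, u) φ` for all `φ ∈ W^{1,p}_{λ,0}(Ω)`. -/
def IsWeakSolution (Ω : Set (Space N l)) (γ p : ℝ) (f : Space N l → ℝ → ℝ)
    (u : Space N l → ℝ) : Prop :=
  MemSobolevZero Ω γ p u ∧
    ∃ U : Space N l → Space N l, HasWeakGrushinGrad Ω γ p u U ∧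
      ∀ (φ : Space N l → ℝ) (W : Space N l → Space N l),
        MemSobolevZero Ω γ p φ → HasWeakGrushinGrad Ω γ p φ W →
          IntegrableOn (fun z => f z (u z) * φ z) Ω ∧
          ∫ z in Ω, ‖U z‖ ^ (p - 2) * ⟪U z, W z⟫ = ∫ z in Ω, f z (u z) * φ z

/-- `F(z, s) = ∫_0^s f(z, τ) dτ`. -/
noncomputable def primitive (f : Space N l → ℝ → ℝ) (z : Space N l) (s : ℝ) : ℝ :=
  ∫ τ in (0 : ℝ)..s, f z τ

/-- The derivative `∂F/∂z_k (z, s)` in the explicit variable, taken with `s` fixed, at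
`s = u(z)`. -/
noncomputable def explicitDeriv (f : Space N l → ℝ → ℝ) (u : Space N l → ℝ)
    (k : Fin N ⊕ Fin l) (z : Space N l) : ℝ :=
  partialDeriv k (fun w => primitive f w (u z)) z

/-- The explicit derivative `∂F/∂z_k (z, u(z))` exists at each `z ∈ Ω` and is locally integrable
in `Ω`. -/
def HasExplicitDeriv (Ω : Set (Space N l)) (f : Space N l → ℝ → ℝ) (u : Space N l → ℝ)
    (k : Fin N ⊕ Fin l) : Prop :=
  (∀ z ∈ Ω, LineDifferentiableAt ℝ (fun w => primitive f w (u z)) z (basisVec k)) ∧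
    LocallyIntegrableOn (explicitDeriv f u k) Ω

/-- The boundary of the open set `D` is of class `C^1` and `ν` is the outward unit normal on it: near
each boundary point, `D = {ρ < 0}` for a `C^1` function `ρ` with nonvanishing gradient, and
`ν = ∇ρ / |∇ρ|` on `∂D`. -/
def IsOutwardUnitNormal (D : Set (Space N l)) (ν : Space N l → Space N l) : Prop :=
  ∀ a ∈ frontier D, ∃ (U : Set (Space N l)) (ρ : Space N l → ℝ),
    IsOpen U ∧ a ∈ U ∧ ContDiffOn ℝ 1 ρ U ∧ (∀ z ∈ U, gradient ρ z ≠ 0) ∧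
    (∀ z ∈ U, z ∈ D ↔ ρ z < 0) ∧
    ∀ z ∈ U ∩ frontier D, ν z = ‖gradient ρ z‖⁻¹ • gradient ρ z

/-- The surface measure `dS` on `∂D`: the `(N+l-1)`-dimensional Hausdorff measure, normalized so
that it agrees with Lebesgue measure on hyperplanes. -/
noncomputable def surfaceMeasure (D : Set (Space N l)) : Measure (Space N l) :=
  (Measure.euclideanHausdorffMeasure (N + l - 1)).restrict (frontier D)

end Grushin

/-!
The identities come from differentiating the energy along translations, so that no second
derivatives of `u` are needed. Let `L(z, ξ) = |(ξ_x, |x|^γ ξ_y)|^p / p` be the energy density and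
`A` its gradient in `ξ` along `∇u`, so that the equation reads `∫ A · ∇φ = ∫ f(z, u) φ`. For a cutoff
`η ≥ 0` and a direction `d`, test it with `η` times the difference quotient of `u` in the
direction `d`. Since `L` is convex in `ξ`, the term `η A · (∇u(z + h d) - ∇u(z))` is at most
`η (L(z, ∇u(z + h d)) - L(z, ∇u(z)))`, and after a change of variables the translation falls on `η`
and on the explicit argument of `L`. Letting `h → 0` gives an inequality, and the opposite
direction `-d` gives the reverse one (`variational_identity`):
`∫ η f(z, u) ∂_d u - ∫ ∂_d u (∇η · A) = -∫ ∂_d η L - ∫ η (∂_d L)(z, ∇u)`.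

In a direction `y_j` the last term is zero. In a direction `x_i` the derivative
`(∂_{x_i} L)(z, ξ) = |·|^{p-2} γ |x|^{2(γ-1)} x_i |ξ_y|^2` is singular on `x = 0`, but the
increments of `L` are bounded by `C |z' - z| |x_i|^{α-1}` for some `α > 0`
(`exists_energyDensity_sub_le`), which is integrable; dominated convergence then covers all
`γ ≥ 0` and `p > 1`.

Next, `η` runs through mollifications of the characteristic function of `D`. Their gradients are
mollifications of `-ν dS` (`IsFlatBoundary.fderiv_smoothIndicator`), by the divergence theorem for
domains with `C^1` boundary (`IsFlatBoundary.setIntegral_fderiv`), and the limit is the flux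
identity `setIntegral_flux_identity`. The divergence theorem is proved for the normalized Hausdorff
measure: near a boundary point `D` lies below a graph whose height function has a small Lipschitz constant
`O(ε)`, so surface measure and its projection to the tangent plane agree up to a factor `1 + O(ε)`
(`IsFlatAt.surface_bounds`). The flux in the normal direction is computed by Fubini, the flux in a
tangential direction is `O(ε)` because `D` is mapped into itself by transverse translations, and
a partition of unity followed by `ε → 0` gives the theorem.

Finally `∫_D f(z, u) ∂_d u` is eliminated with the chain rule for `F(z, u(z))`
(`hasLineDerivAt_primitive`) and the divergence theorem for continuous functions with an integrable
directional derivative (`IsFlatBoundary.setIntegral_lineDeriv`). The solution is made global by a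
cutoff that is `1` near the closure of `D`; the weak gradient in the equation is the classical
one (`HasWeakGrushinGrad.ae_eq_grushinGrad`).
-/

namespace Grushin

open Filter Topology Metric Module

/-! ### Boundaries that are flat at small scales, and translation arguments -/

section GaussGreen

variable {E : Type*} [NormedAddCommGroup E] [InnerProductSpace ℝ E]

theorem LipschitzOnWith.euclideanHausdorffMeasure_image_le {X Y : Type*} [EMetricSpace X]
    [EMetricSpace Y] [MeasurableSpace X] [BorelSpace X] [MeasurableSpace Y] [BorelSpace Y]
    {K : NNReal} {f : X → Y} {s : Set X} (h : LipschitzOnWith K f s) (d : ℕ) :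
    μHE[d] (f '' s) ≤ (K : ENNReal) ^ d * μHE[d] s := by
  simp only [Measure.euclideanHausdorffMeasure_def, Measure.smul_apply, ENNReal.smul_def,
    smul_eq_mul]
  have := h.hausdorffMeasure_image_le (d := d) (by positivity)
  rw [ENNReal.rpow_natCast] at this
  calc _ ≤ _ := mul_le_mul_right this _
    _ = _ := by ring

/-- `D` is, in the ball of radius `3r` about `a`, the sublevel set of a function `ρ` that vanishes
at `a` and differs from the linear function `⟪e, ·⟫` by a map with Lipschitz constant `ε`. -/
structure IsFlatAt (D : Set E) (a e : E) (ε r : ℝ) (ρ : E → ℝ) : Prop where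
  zero : ρ a = 0
  approx : ∀ z ∈ ball a (3 * r), ∀ z' ∈ ball a (3 * r),
    |ρ z' - ρ z - ⟪e, z' - z⟫| ≤ ε * ‖z' - z‖
  mem_iff : ∀ z ∈ ball a (3 * r), z ∈ D ↔ ρ z < 0

namespace IsFlatAt

variable {D : Set E} {a e : E} {ε r : ℝ} {ρ : E → ℝ}

theorem lt_of_inner (h : IsFlatAt D a e ε r ρ) {z z' : E} (hz : z ∈ ball a (3 * r))
    (hz' : z' ∈ ball a (3 * r)) (hd : ε * ‖z' - z‖ < ⟪e, z' - z⟫) : ρ z < ρ z' := by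
  have := abs_le.1 (h.approx z hz z' hz')
  linarith

theorem continuousOn (h : IsFlatAt D a e ε r ρ) : ContinuousOn ρ (ball a (3 * r)) := by
  have : LipschitzOnWith (Real.toNNReal (‖e‖ + ε)) ρ (ball a (3 * r)) := by
    refine LipschitzOnWith.of_dist_le' fun z hz z' hz' => ?_
    have h1 := h.approx z' hz' z hz
    have h2 := abs_real_inner_le_norm e (z - z')
    rw [Real.dist_eq, dist_eq_norm]
    calc |ρ z - ρ z'| = |(ρ z - ρ z' - ⟪e, z - z'⟫) + ⟪e, z - z'⟫| := by ring_nf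
      _ ≤ _ := abs_add_le _ _
      _ ≤ (‖e‖ + ε) * ‖z - z'‖ := by linarith
  exact this.continuousOn

theorem eq_zero_of_mem_frontier (h : IsFlatAt D a e ε r ρ) (hD : IsOpen D) {z : E}
    (hz : z ∈ ball a (3 * r)) (hf : z ∈ frontier D) : ρ z = 0 := by
  rw [hD.frontier_eq] at hf
  refine le_antisymm ?_ (not_lt.1 fun hlt => hf.2 ((h.mem_iff z hz).2 hlt))
  by_contra! hpos
  have hc : ContinuousAt ρ z := h.continuousOn.continuousAt (isOpen_ball.mem_nhds hz)
  obtain ⟨y, hy, hyD⟩ := mem_closure_iff_nhds.1 hf.1 _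
    (inter_mem (hc.eventually (lt_mem_nhds hpos)) (isOpen_ball.mem_nhds hz))
  exact absurd ((h.mem_iff y hy.2).1 hyD) (not_lt.2 (le_of_lt hy.1))

theorem mem_frontier_of_eq_zero (h : IsFlatAt D a e ε r ρ) (hD : IsOpen D) (he : ‖e‖ = 1)
    (hε : ε < 1) {z : E} (hz : z ∈ ball a (3 * r)) (h0 : ρ z = 0) : z ∈ frontier D := by
  rw [hD.frontier_eq]
  refine ⟨?_, fun hzD => absurd ((h.mem_iff z hz).1 hzD) (by rw [h0]; exact lt_irrefl 0)⟩
  have hcont : Tendsto (fun t : ℝ => z - t • e) (𝓝[>] 0) (𝓝 z) := by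
    have : Continuous (fun t : ℝ => z - t • e) := by fun_prop
    simpa using (this.tendsto 0).mono_left nhdsWithin_le_nhds
  refine mem_closure_of_tendsto hcont ?_
  filter_upwards [hcont.eventually (isOpen_ball.mem_nhds hz), self_mem_nhdsWithin] with t ht ht0
  have ht0 : 0 < t := ht0
  rw [h.mem_iff _ ht, ← h0]
  refine h.lt_of_inner ht hz ?_
  rw [sub_sub_cancel, norm_smul, he, real_inner_smul_right, real_inner_self_eq_norm_sq, he,
    Real.norm_of_nonneg ht0.le]
  nlinarith

end IsFlatAt

variable [FiniteDimensional ℝ E] [MeasurableSpace E] [BorelSpace E]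

/-- Orthogonal splitting of a Euclidean space along a unit vector `e`: the isometry `J` identifies
`ℝ^m` with the hyperplane `e^⊥`, and `P` is the orthogonal projection onto it. -/
theorem exists_orthogonal_splitting {m : ℕ} (hm : finrank ℝ E = m + 1) {e : E} (he : ‖e‖ = 1) :
    ∃ (J : EuclideanSpace ℝ (Fin m) →ₗᵢ[ℝ] E) (P : E →L[ℝ] EuclideanSpace ℝ (Fin m)),
      (∀ w, ⟪e, J w⟫ = 0) ∧ (∀ z, J (P z) + ⟪e, z⟫ • e = z) ∧ (∀ w, P (J w) = w) ∧ P e = 0 ∧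
      MeasurePreserving (fun q : EuclideanSpace ℝ (Fin m) × ℝ => J q.1 + q.2 • e) := by
  have : Fact (finrank ℝ E = m + 1) := ⟨hm⟩
  have he0 : e ≠ 0 := by rintro rfl; simp at he
  have hee : ⟪e, e⟫ = (1 : ℝ) := by rw [real_inner_self_eq_norm_sq, he]; norm_num
  let b := OrthonormalBasis.fromOrthogonalSpanSingleton (𝕜 := ℝ) m he0
  let J : EuclideanSpace ℝ (Fin m) →ₗᵢ[ℝ] E :=
    (ℝ ∙ e)ᗮ.subtypeₗᵢ.comp b.repr.symm.toLinearIsometry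
  have hJ : ∀ w, ⟪e, J w⟫ = 0 := fun w =>
    Submodule.mem_orthogonal_singleton_iff_inner_right.1 (b.repr.symm w).2
  let T₀ : WithLp 2 (EuclideanSpace ℝ (Fin m) × ℝ) →ₗ[ℝ] E :=
    { toFun := fun q => J q.fst + q.snd • e
      map_add' := fun x y => by simp [add_smul]; abel
      map_smul' := fun c x => by simp [smul_smul] }
  let T : WithLp 2 (EuclideanSpace ℝ (Fin m) × ℝ) →ₗᵢ[ℝ] E :=
    { T₀ with
      norm_map' := fun q => by
        have h1 : ‖J q.fst + q.snd • e‖ ^ 2 = ‖q‖ ^ 2 := by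
          rw [WithLp.prod_norm_sq_eq_of_L2, norm_add_sq_real, norm_smul, he, J.norm_map,
            real_inner_smul_right, real_inner_comm, hJ]
          ring
        exact (sq_eq_sq₀ (norm_nonneg _) (norm_nonneg _)).1 h1 }
  have hfin : finrank ℝ (WithLp 2 (EuclideanSpace ℝ (Fin m) × ℝ)) = finrank ℝ E := by
    rw [(WithLp.linearEquiv 2 ℝ (EuclideanSpace ℝ (Fin m) × ℝ)).finrank_eq, hm]
    simp
  let L := T.toLinearIsometryEquiv hfin
  have hL : ∀ q, L q = J q.fst + q.snd • e := fun q => rfl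
  let P : E →L[ℝ] EuclideanSpace ℝ (Fin m) := ContinuousLinearMap.adjoint J.toContinuousLinearMap
  have hPJ : ∀ w, P (J w) = w := fun w => by
    have := J.adjoint_comp_self
    exact congrArg (fun A => A w) this
  have hPe : P e = 0 := by
    refine ext_inner_right ℝ fun w => ?_
    rw [ContinuousLinearMap.adjoint_inner_left, inner_zero_left]
    exact hJ w
  refine ⟨J, P, hJ, fun z => ?_, hPJ, hPe, ?_⟩
  · obtain ⟨q, rfl⟩ := L.surjective z
    rw [hL, map_add, map_smul, hPJ, hPe, inner_add_right, hJ, real_inner_smul_right, hee]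
    simp
  · exact L.measurePreserving.comp (WithLp.volume_preserving_toLp _ _)

/-- If `D` moves into itself under small translations by `-d` on the support of `φ ≥ 0`, then the
derivative of `φ` in the direction `d` has nonnegative integral over `D`. -/
theorem setIntegral_fderiv_nonneg_of_translation {D : Set E} (hD : MeasurableSet D)
    (hDv : volume D ≠ ⊤) {φ : E → ℝ}
    (hφ : ContDiff ℝ 1 φ) (hφc : HasCompactSupport φ) (hφ0 : ∀ z, 0 ≤ φ z) {d : E}
    (hd : ∀ᶠ t : ℝ in 𝓝[>] 0, ∀ z ∈ D, φ z ≠ 0 → z - t • d ∈ D) :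
    0 ≤ ∫ z in D, fderiv ℝ φ z d := by
  obtain ⟨C, hC⟩ := hφ.lipschitzWith_of_hasCompactSupport hφc (by norm_num)
  have hφi : Integrable φ := hφ.continuous.integrable_of_hasCompactSupport hφc
  have hlim := hC.integral_inv_smul_sub_mul_tendsto_integral_lineDeriv_mul (μ := volume)
    (g := D.indicator 1) ((integrable_indicator_iff hD).2 (integrableOn_const hDv)) d
  have hrw : ∫ x, lineDeriv ℝ φ x d * D.indicator 1 x = ∫ z in D, fderiv ℝ φ z d := by
    rw [← integral_indicator hD]
    refine integral_congr_ae (Eventually.of_forall fun x => ?_)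
    have : lineDeriv ℝ φ x d = fderiv ℝ φ x d :=
      ((hφ.differentiable one_ne_zero) x).lineDeriv_eq_fderiv
    by_cases hx : x ∈ D <;> simp [hx, this]
  rw [hrw] at hlim
  refine ge_of_tendsto hlim ?_
  filter_upwards [hd, self_mem_nhdsWithin] with t ht ht0
  have ht0 : 0 < t := ht0
  have hmul : ∀ f : E → ℝ, Integrable f → ∀ S : Set E, MeasurableSet S →
      Integrable (fun x => f x * S.indicator 1 x) := fun f hf S hS => by
    refine (hf.indicator hS).congr (Eventually.of_forall fun x => ?_)
    by_cases hx : x ∈ S <;> simp [hx]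
  have e1 : ∫ x, t⁻¹ • (φ (x + t • d) - φ x) * D.indicator 1 x =
      t⁻¹ * ((∫ x, φ (x + t • d) * D.indicator 1 x) - ∫ x, φ x * D.indicator 1 x) := by
    rw [← integral_sub (hmul _ (hφi.comp_add_right _) D hD) (hmul _ hφi D hD),
      ← integral_const_mul]
    congr 1; ext x; simp only [smul_eq_mul]; ring
  have e2 : ∫ x, φ (x + t • d) * D.indicator 1 x = ∫ x, φ x * D.indicator 1 (x - t • d) := by
    rw [← integral_add_right_eq_self (fun x => φ x * D.indicator 1 (x - t • d)) (t • d)]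
    simp
  rw [e1, e2]
  refine mul_nonneg (inv_nonneg.2 ht0.le) (sub_nonneg.2 ?_)
  refine integral_mono (hmul _ hφi D hD) ?_ fun x => ?_
  · have := hmul _ hφi ((fun x => x - t • d) ⁻¹' D) ((measurable_id.sub_const _) hD)
    exact this
  · by_cases hx : x ∈ D
    · by_cases hx0 : φ x = 0
      · simp [hx0]
      · simp [hx, ht x hx hx0]
    · simp only [hx, not_false_eq_true, indicator_of_notMem, mul_zero]
      exact mul_nonneg (hφ0 x) (indicator_nonneg (by simp) _)

/-- Directions transverse to a flat piece of the boundary have nonnegative flux. -/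
theorem IsFlatAt.setIntegral_fderiv_nonneg {D : Set E} {a e : E} {ε r : ℝ} {ρ : E → ℝ}
    (h : IsFlatAt D a e ε r ρ) (hr : 0 < r) (hD : MeasurableSet D) (hDv : volume D ≠ ⊤) {φ : E → ℝ}
    (hφ : ContDiff ℝ 1 φ) (hφc : HasCompactSupport φ) (hφ0 : ∀ z, 0 ≤ φ z)
    (hφs : tsupport φ ⊆ ball a r) {d : E} (hd : ε * ‖d‖ < ⟪e, d⟫) :
    0 ≤ ∫ z in D, fderiv ℝ φ z d := by
  refine setIntegral_fderiv_nonneg_of_translation hD hDv hφ hφc hφ0 ?_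
  have hcont : Tendsto (fun t : ℝ => ‖t • d‖) (𝓝[>] 0) (𝓝 0) := by
    have : Continuous (fun t : ℝ => ‖t • d‖) := by fun_prop
    simpa using (this.tendsto 0).mono_left nhdsWithin_le_nhds
  filter_upwards [hcont.eventually (gt_mem_nhds hr), self_mem_nhdsWithin] with t ht ht0 z hz hφz
  have ht0 : 0 < t := ht0
  have hza : z ∈ ball a r := hφs (subset_tsupport _ hφz)
  have hz3 : z ∈ ball a (3 * r) := ball_subset_ball (by linarith) hza
  have hz' : z - t • d ∈ ball a (3 * r) := by
    rw [mem_ball, dist_eq_norm] at hza ⊢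
    calc ‖z - t • d - a‖ = ‖(z - a) - t • d‖ := by congr 1; abel
      _ ≤ ‖z - a‖ + ‖t • d‖ := norm_sub_le _ _
      _ < 3 * r := by linarith
  rw [h.mem_iff _ hz']
  refine lt_trans (h.lt_of_inner hz' hz3 ?_) ((h.mem_iff _ hz3).1 hz)
  rw [sub_sub_cancel, norm_smul, real_inner_smul_right, Real.norm_of_nonneg ht0.le]
  nlinarith

end GaussGreen

/-! ### Flat pieces of boundary as graphs -/

section GaussGreen

variable {E : Type*} [NormedAddCommGroup E] [InnerProductSpace ℝ E]

/-- A flat piece of boundary is the graph of a height function `g` over the ball of the same radius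
in the hyperplane `e^⊥`, and `D` lies below it. -/
theorem IsFlatAt.exists_graph {W : Type*} [NormedAddCommGroup W] [InnerProductSpace ℝ W]
    {D : Set E} {a e : E} {ε r : ℝ} {ρ : E → ℝ}
    (h : IsFlatAt D a e ε r ρ) (hr : 0 < r) (he : ‖e‖ = 1) (hε : ε ≤ 1 / 2)
    (J : W →ₗᵢ[ℝ] E) (P : E →L[ℝ] W) (hJ : ∀ w, ⟪e, J w⟫ = 0)
    (hJP : ∀ z, J (P z) + ⟪e, z⟫ • e = z) :
    ∃ g : W → ℝ, ∀ w ∈ ball (P a) r, |g w - ⟪e, a⟫| < r ∧ ρ (J w + g w • e) = 0 ∧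
      ∀ t, |t - ⟪e, a⟫| ≤ r → J w + t • e ∈ ball a (3 * r) ∧ (J w + t • e ∈ D ↔ t < g w) ∧
        (ρ (J w + t • e) = 0 → t = g w) := by
  have hmem : ∀ w ∈ ball (P a) r, ∀ t, |t - ⟪e, a⟫| ≤ r →
      ‖J w + t • e - a‖ < 2 * r := by
    intro w hw t ht
    have : J w + t • e - a = J (w - P a) + (t - ⟪e, a⟫) • e := by
      conv_lhs => rw [← hJP a]
      rw [map_sub, sub_smul]; abel
    rw [this]
    calc _ ≤ ‖J (w - P a)‖ + ‖(t - ⟪e, a⟫) • e‖ := norm_add_le _ _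
      _ = ‖w - P a‖ + |t - ⟪e, a⟫| := by rw [J.norm_map, norm_smul, he, mul_one, Real.norm_eq_abs]
      _ < 2 * r := by rw [mem_ball, dist_eq_norm] at hw; linarith
  have hmem3 : ∀ w ∈ ball (P a) r, ∀ t, |t - ⟪e, a⟫| ≤ r → J w + t • e ∈ ball a (3 * r) := by
    intro w hw t ht
    rw [mem_ball, dist_eq_norm]
    linarith [hmem w hw t ht]
  have ha : a ∈ ball a (3 * r) := mem_ball_self (by linarith)
  have hee : ⟪e, e⟫ = (1 : ℝ) := by rw [real_inner_self_eq_norm_sq, he]; norm_num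
  have hin : ∀ w t, ⟪e, J w + t • e⟫ = t := fun w t => by
    rw [inner_add_right, hJ, real_inner_smul_right, hee]; ring
  have hmono : ∀ w ∈ ball (P a) r, ∀ s t, |s - ⟪e, a⟫| ≤ r → |t - ⟪e, a⟫| ≤ r → s < t →
      ρ (J w + s • e) < ρ (J w + t • e) := by
    intro w hw s t hs ht hst
    refine h.lt_of_inner (hmem3 w hw s hs) (hmem3 w hw t ht) ?_
    have : J w + t • e - (J w + s • e) = (t - s) • e := by rw [sub_smul]; abel
    rw [this, norm_smul, he, real_inner_smul_right, hee, Real.norm_of_nonneg (by linarith)]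
    nlinarith
  have hex : ∀ w ∈ ball (P a) r, ∃ t, |t - ⟪e, a⟫| < r ∧ ρ (J w + t • e) = 0 := by
    intro w hw
    have hup : |⟪e, a⟫ + r - ⟪e, a⟫| ≤ r := by rw [add_sub_cancel_left, abs_of_pos hr]
    have hlo : |⟪e, a⟫ - r - ⟪e, a⟫| ≤ r := by rw [sub_sub_cancel_left, abs_neg, abs_of_pos hr]
    have hcont : ContinuousOn (fun t : ℝ => ρ (J w + t • e))
        (Icc (⟪e, a⟫ - r) (⟪e, a⟫ + r)) := by
      refine h.continuousOn.comp (by fun_prop) fun t ht => hmem3 w hw t ?_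
      rw [abs_le]; constructor <;> linarith [ht.1, ht.2]
    have h1 : ρ (J w + (⟪e, a⟫ - r) • e) < 0 := by
      rw [← h.zero]
      refine h.lt_of_inner (hmem3 w hw _ hlo) ha ?_
      rw [norm_sub_rev, inner_sub_right, hin]
      nlinarith [hmem w hw _ hlo, norm_nonneg (J w + (⟪e, a⟫ - r) • e - a)]
    have h2 : 0 < ρ (J w + (⟪e, a⟫ + r) • e) := by
      rw [← h.zero]
      refine h.lt_of_inner ha (hmem3 w hw _ hup) ?_
      rw [inner_sub_right, hin]
      nlinarith [hmem w hw _ hup, norm_nonneg (J w + (⟪e, a⟫ + r) • e - a)]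
    obtain ⟨t, ht, ht0⟩ := intermediate_value_Ioo (by linarith) hcont ⟨h1, h2⟩
    exact ⟨t, by rw [abs_lt]; constructor <;> linarith [ht.1, ht.2], ht0⟩
  choose! g hg using hex
  refine ⟨g, fun w hw => ⟨(hg w hw).1, (hg w hw).2, fun t ht => ⟨hmem3 w hw t ht, ?_, ?_⟩⟩⟩
  · rw [h.mem_iff _ (hmem3 w hw t ht), ← (hg w hw).2]
    constructor
    · intro hlt
      by_contra! hle
      rcases hle.eq_or_lt with heq | hgt
      · rw [heq] at hlt; exact lt_irrefl _ hlt
      · exact lt_asymm hlt (hmono w hw _ _ (hg w hw).1.le ht hgt)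
    · exact hmono w hw _ _ ht (hg w hw).1.le
  · intro h0
    rcases lt_trichotomy t (g w) with hlt | heq | hgt
    · have := hmono w hw _ _ ht (hg w hw).1.le hlt
      rw [h0, (hg w hw).2] at this
      exact absurd this (lt_irrefl 0)
    · exact heq
    · have := hmono w hw _ _ (hg w hw).1.le ht hgt
      rw [h0, (hg w hw).2] at this
      exact absurd this (lt_irrefl 0)

variable [FiniteDimensional ℝ E] [MeasurableSpace E] [BorelSpace E]

/-- Fubini and the fundamental theorem of calculus on the vertical lines: the flux in the normal
direction is the integral over the graph. -/
theorem setIntegral_fderiv_eq_integral_graph {m : ℕ} {D : Set E} (hD : MeasurableSet D)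
    {a e : E} {r : ℝ} (he : ‖e‖ = 1)
    (J : EuclideanSpace ℝ (Fin m) →ₗᵢ[ℝ] E) (P : E →L[ℝ] EuclideanSpace ℝ (Fin m))
    (hJ : ∀ w, ⟪e, J w⟫ = 0) (hJP : ∀ z, J (P z) + ⟪e, z⟫ • e = z)
    (hmp : MeasurePreserving (fun q : EuclideanSpace ℝ (Fin m) × ℝ => J q.1 + q.2 • e))
    {g : EuclideanSpace ℝ (Fin m) → ℝ}
    (hg : ∀ w ∈ ball (P a) r, |g w - ⟪e, a⟫| < r)
    (hgD : ∀ w ∈ ball (P a) r, ∀ t, |t - ⟪e, a⟫| ≤ r → (J w + t • e ∈ D ↔ t < g w))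
    {φ : E → ℝ} (hφ : ContDiff ℝ 1 φ) (hφc : HasCompactSupport φ) (hφs : tsupport φ ⊆ ball a r) :
    ∫ z in D, fderiv ℝ φ z e = ∫ w in ball (P a) r, φ (J w + g w • e) := by
  have hee : ⟪e, e⟫ = (1 : ℝ) := by rw [real_inner_self_eq_norm_sq, he]; norm_num
  -- points of the cylinder outside the ball see neither `φ` nor its derivative
  have hdist : ∀ w t, J w + t • e ∈ ball a r → w ∈ ball (P a) r ∧ |t - ⟪e, a⟫| < r := by
    intro w t hz
    have h0 : J w + t • e - a = J (w - P a) + (t - ⟪e, a⟫) • e := by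
      conv_lhs => rw [← hJP a]
      rw [map_sub, sub_smul]; abel
    have h1 : ‖J w + t • e - a‖ ^ 2 = ‖w - P a‖ ^ 2 + |t - ⟪e, a⟫| ^ 2 := by
      rw [h0, norm_add_sq_real, norm_smul, he, J.norm_map, real_inner_smul_right,
        real_inner_comm e (J _), hJ, Real.norm_eq_abs]
      ring
    rw [mem_ball, dist_eq_norm] at hz
    rw [mem_ball, dist_eq_norm]
    have hn := norm_nonneg (J w + t • e - a)
    constructor
    · refine lt_of_le_of_lt (abs_le_of_sq_le_sq' ?_ hn).2 hz
      nlinarith [sq_nonneg |t - ⟪e, a⟫|]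
    · refine lt_of_le_of_lt (abs_le_of_sq_le_sq' ?_ hn).2 hz
      nlinarith [sq_nonneg ‖w - P a‖]
  have hφ0 : ∀ z, z ∉ ball a r → φ z = 0 := fun z hz =>
    image_eq_zero_of_notMem_tsupport fun h => hz (hφs h)
  have hdφ0 : ∀ z, z ∉ ball a r → fderiv ℝ φ z = 0 := fun z hz =>
    image_eq_zero_of_notMem_tsupport fun h => hz (hφs (tsupport_fderiv_subset ℝ h))
  have hcd : Continuous (fun z => fderiv ℝ φ z e) := (hφ.continuous_fderiv one_ne_zero).clm_apply
    continuous_const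
  have hint : Integrable (D.indicator fun z => fderiv ℝ φ z e) :=
    ((hcd.integrable_of_hasCompactSupport (hφc.fderiv_apply ℝ e))).indicator hD
  have hemb : AEStronglyMeasurable (D.indicator fun z => fderiv ℝ φ z e)
      (Measure.map (fun q : EuclideanSpace ℝ (Fin m) × ℝ => J q.1 + q.2 • e) volume) := by
    rw [hmp.map_eq]; exact hint.aestronglyMeasurable
  have hint' : Integrable (fun q : EuclideanSpace ℝ (Fin m) × ℝ =>
      (D.indicator fun z => fderiv ℝ φ z e) (J q.1 + q.2 • e)) (volume.prod volume) :=
    hmp.integrable_comp_of_integrable hint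
  rw [← integral_indicator hD, ← hmp.map_eq, integral_map hmp.measurable.aemeasurable hemb,
    Measure.volume_eq_prod, integral_prod _ hint', ← integral_indicator measurableSet_ball]
  refine integral_congr_ae (Eventually.of_forall fun w => ?_)
  by_cases hw : w ∈ ball (P a) r
  swap
  · rw [indicator_of_notMem hw]
    refine (integral_congr_ae (Eventually.of_forall fun t => ?_)).trans (integral_zero _ _)
    have hz : J w + t • e ∉ ball a r := fun hz => hw (hdist w t hz).1
    by_cases hzD : J w + t • e ∈ D <;> simp [hzD, hdφ0 _ hz]
  rw [indicator_of_mem hw]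
  have hgw := abs_lt.1 (hg w hw)
  have hder : ∀ t : ℝ, HasDerivAt (fun t => φ (J w + t • e)) (fderiv ℝ φ (J w + t • e) e) t := by
    intro t
    have h1 : HasDerivAt (fun t : ℝ => J w + t • e) e t := by
      simpa using ((hasDerivAt_id t).smul_const e).const_add (J w)
    exact ((hφ.differentiable one_ne_zero) _).hasFDerivAt.comp_hasDerivAt t h1
  have hFTC : ∫ t in (⟪e, a⟫ - r)..(g w), fderiv ℝ φ (J w + t • e) e = φ (J w + g w • e) := by
    rw [intervalIntegral.integral_eq_sub_of_hasDerivAt (fun t _ => hder t)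
      ((hcd.comp (by fun_prop)).intervalIntegrable _ _), hφ0 (J w + (⟪e, a⟫ - r) • e), sub_zero]
    intro hz
    have := (hdist w _ hz).2
    rw [sub_sub_cancel_left, abs_neg] at this
    exact absurd (le_abs_self r) (not_le.2 this)
  rw [← hFTC, intervalIntegral.integral_of_le (by linarith), integral_Ioc_eq_integral_Ioo,
    ← integral_indicator measurableSet_Ioo]
  refine integral_congr_ae (Eventually.of_forall fun t => ?_)
  by_cases hz : J w + t • e ∈ ball a r
  · have ht := (hdist w t hz).2
    have hiff := hgD w hw t ht.le
    have ht' := abs_lt.1 ht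
    by_cases hzD : J w + t • e ∈ D
    · have : t ∈ Ioo (⟪e, a⟫ - r) (g w) := ⟨by linarith, hiff.1 hzD⟩
      simp [hzD, this.1, this.2]
    · have : t ∉ Ioo (⟪e, a⟫ - r) (g w) := fun h => hzD (hiff.2 h.2)
      rw [indicator_of_notMem this]
      simp [hzD]
  · have h1 : (Ioo (⟪e, a⟫ - r) (g w)).indicator (fun t => fderiv ℝ φ (J w + t • e) e) t = 0 := by
      rw [indicator_apply_eq_zero]
      intro _
      simp [hdφ0 _ hz]
    rw [h1]
    by_cases hzD : J w + t • e ∈ D <;> simp [hzD, hdφ0 _ hz]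

end GaussGreen

/-! ### Surface measure of a flat piece -/

section GaussGreen

variable {E : Type*} [NormedAddCommGroup E] [InnerProductSpace ℝ E] [FiniteDimensional ℝ E]
  [MeasurableSpace E] [BorelSpace E]

/-- On a flat piece of the boundary the surface integral is trapped between the flux in the normal
direction and a multiple of it close to `1`: the projection to the hyperplane does not increase
Hausdorff measure, and the graph map increases it by at most the factor `(1 - ε)^{-m}`. -/
theorem IsFlatAt.surface_bounds {m : ℕ} (hm : finrank ℝ E = m + 1) {D : Set E} (hD : IsOpen D)
    {a e : E} {ε r : ℝ} {ρ : E → ℝ} (h : IsFlatAt D a e ε r ρ) (hr : 0 < r)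
    (he : ‖e‖ = 1) (hε : ε ≤ 1 / 2) :
    μHE[m] (frontier D ∩ ball a r) < ⊤ ∧
    ∀ φ : E → ℝ, ContDiff ℝ 1 φ → HasCompactSupport φ → (∀ z, 0 ≤ φ z) → tsupport φ ⊆ ball a r →
      ∫ z in D, fderiv ℝ φ z e ≤ ∫ z in frontier D, φ z ∂μHE[m] ∧
      ∫ z in frontier D, φ z ∂μHE[m] ≤ ((1 - ε)⁻¹) ^ m * ∫ z in D, fderiv ℝ φ z e := by
  obtain ⟨J, P, hJ, hJP, hPJ, hPe, hmp⟩ := exists_orthogonal_splitting hm he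
  obtain ⟨g, hg⟩ := h.exists_graph hr he hε J P hJ hJP
  have hee : ⟪e, e⟫ = (1 : ℝ) := by rw [real_inner_self_eq_norm_sq, he]; norm_num
  have hPn : ∀ z, ‖P z‖ ≤ ‖z‖ := by
    intro z
    have h1 : ‖z‖ ^ 2 = ‖P z‖ ^ 2 + ⟪e, z⟫ ^ 2 := by
      conv_lhs => rw [← hJP z]
      rw [norm_add_sq_real, norm_smul, he, J.norm_map, real_inner_smul_right,
        real_inner_comm e (J _), hJ, Real.norm_eq_abs, mul_one, sq_abs]
      ring
    exact (abs_le_of_sq_le_sq' (by nlinarith [sq_nonneg ⟪e, z⟫]) (norm_nonneg z)).2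
  set B : Set (EuclideanSpace ℝ (Fin m)) := ball (P a) r with hB
  set Γ : EuclideanSpace ℝ (Fin m) → E := fun w => J w + g w • e with hΓ
  have hPΓ : ∀ w, P (Γ w) = w := fun w => by simp [hΓ, hPJ, hPe]
  have hinΓ : ∀ w, ⟪e, Γ w⟫ = g w := fun w => by
    rw [hΓ, inner_add_right, hJ, real_inner_smul_right, hee]; ring
  have hΓ3 : ∀ w ∈ B, Γ w ∈ ball a (3 * r) := fun w hw => ((hg w hw).2.2 _ (hg w hw).1.le).1
  set M : Set E := (frontier D ∩ P ⁻¹' B) ∩ {z | |⟪e, z⟫ - ⟪e, a⟫| < r} with hM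
  have hMmeas : MeasurableSet M := by
    refine (isClosed_frontier.measurableSet.inter (isOpen_ball.preimage P.continuous).measurableSet
      ).inter (isOpen_lt (by fun_prop) continuous_const).measurableSet
  have hMΓ : ∀ z ∈ M, Γ (P z) = z := by
    rintro z ⟨⟨hzf, hzB⟩, hzt⟩
    have h1 := (hg (P z) hzB).2.2 _ (le_of_lt hzt)
    rw [hJP] at h1
    have := h1.2.2 (h.eq_zero_of_mem_frontier hD h1.1 hzf)
    rw [hΓ]
    simp only [← this, hJP]
  have hΓM : ∀ w ∈ B, Γ w ∈ M := fun w hw =>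
    ⟨⟨h.mem_frontier_of_eq_zero hD he (by linarith) (hΓ3 w hw) (hg w hw).2.1,
      by rw [mem_preimage, hPΓ]; exact hw⟩, by rw [mem_ofPred_eq, hinΓ]; exact (hg w hw).1⟩
  have hball : frontier D ∩ ball a r ⊆ M := by
    rintro z ⟨hzf, hza⟩
    rw [mem_ball, dist_eq_norm] at hza
    refine ⟨⟨hzf, ?_⟩, ?_⟩
    · rw [mem_preimage, hB, mem_ball, dist_eq_norm, ← map_sub]
      exact (hPn _).trans_lt hza
    · rw [mem_ofPred_eq, ← inner_sub_right]
      have := abs_real_inner_le_norm e (z - a)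
      rw [he, one_mul] at this
      exact this.trans_lt hza
  have hΓlip : LipschitzOnWith (Real.toNNReal (1 - ε)⁻¹) Γ B := by
    refine LipschitzOnWith.of_dist_le' fun w hw w' hw' => ?_
    rw [dist_eq_norm, dist_eq_norm, inv_mul_eq_div, le_div_iff₀ (by linarith)]
    have h1 := h.approx _ (hΓ3 w' hw') _ (hΓ3 w hw)
    rw [(hg w hw).2.1, (hg w' hw').2.1, sub_self, zero_sub, abs_neg, inner_sub_right, hinΓ,
      hinΓ] at h1
    have h2 : Γ w - Γ w' = J (w - w') + (g w - g w') • e := by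
      simp only [hΓ, map_sub, sub_smul]; abel
    have h3 : ‖Γ w - Γ w'‖ ≤ ‖w - w'‖ + |g w - g w'| := by
      calc _ = ‖J (w - w') + (g w - g w') • e‖ := by rw [← h2]
        _ ≤ ‖J (w - w')‖ + ‖(g w - g w') • e‖ := norm_add_le _ _
        _ = _ := by rw [J.norm_map, norm_smul, he, mul_one, Real.norm_eq_abs]
    linarith
  have hPlip : LipschitzWith 1 P := P.lipschitz.weaken
    (by rw [← NNReal.coe_le_coe]; exact P.opNorm_le_bound zero_le_one (by simpa using hPn))
  set K : ENNReal := ENNReal.ofReal ((1 - ε)⁻¹ ^ m) with hK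
  set ν := Measure.map P ((μHE[m]).restrict M) with hν
  have hνapply : ∀ A, MeasurableSet A → ν A = μHE[m] (Γ '' (A ∩ B)) := by
    intro A hA
    rw [hν, Measure.map_apply P.measurable hA, Measure.restrict_apply (P.measurable hA)]
    congr 1
    ext z
    constructor
    · rintro ⟨hzA, hzM⟩
      exact ⟨P z, ⟨hzA, hzM.1.2⟩, hMΓ z hzM⟩
    · rintro ⟨w, ⟨hwA, hwB⟩, rfl⟩
      exact ⟨by rw [mem_preimage, hPΓ]; exact hwA, hΓM w hwB⟩
  have hlow : volume.restrict B ≤ ν := by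
    refine Measure.le_iff.2 fun A hA => ?_
    rw [Measure.restrict_apply hA, hνapply A hA,
      ← EuclideanSpace.euclideanHausdorffMeasure_eq_volume]
    have := LipschitzOnWith.euclideanHausdorffMeasure_image_le
      (hPlip.lipschitzOnWith (s := Γ '' (A ∩ B))) m
    simpa [image_image, hPΓ] using this
  have hup : ν ≤ K • volume.restrict B := by
    refine Measure.le_iff.2 fun A hA => ?_
    rw [Measure.smul_apply, Measure.restrict_apply hA, hνapply A hA,
      ← EuclideanSpace.euclideanHausdorffMeasure_eq_volume, smul_eq_mul]
    have := LipschitzOnWith.euclideanHausdorffMeasure_image_le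
      (hΓlip.mono (inter_subset_right (s := A))) m
    rwa [← ENNReal.ofReal, ← ENNReal.ofReal_pow (by simp; linarith)] at this
  constructor
  · calc _ ≤ μHE[m] M := measure_mono hball
      _ = ν univ := by rw [hν, Measure.map_apply P.measurable MeasurableSet.univ]; simp
      _ ≤ (K • volume.restrict B) univ := hup univ
      _ < ⊤ := by
        simp only [Measure.smul_apply, Measure.restrict_apply_univ, smul_eq_mul]
        exact ENNReal.mul_lt_top ENNReal.ofReal_lt_top measure_ball_lt_top
  · intro φ hφ hφc hφ0 hφs
    have hflux := setIntegral_fderiv_eq_integral_graph hD.measurableSet he J P hJ hJP hmp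
      (fun w hw => (hg w hw).1) (fun w hw t ht => ((hg w hw).2.2 t ht).2.1) hφ hφc hφs
    rw [hflux]
    classical
    set ψ : EuclideanSpace ℝ (Fin m) → ENNReal :=
      B.indicator fun w => ENNReal.ofReal (φ (Γ w)) with hψ
    have hcont : ContinuousOn (fun w => φ (Γ w)) B :=
      hφ.continuous.comp_continuousOn hΓlip.continuousOn
    have hψm : Measurable ψ := by
      rw [hψ, ← piecewise_eq_indicator]
      exact (ENNReal.continuous_ofReal.comp_continuousOn hcont).measurable_piecewise
        continuousOn_const measurableSet_ball
    have hsurf : ∫⁻ z in frontier D, ENNReal.ofReal (φ z) ∂μHE[m] = ∫⁻ w, ψ w ∂ν := by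
      rw [hν, lintegral_map hψm P.measurable, ← lintegral_indicator isClosed_frontier.measurableSet,
        ← lintegral_indicator hMmeas]
      refine lintegral_congr fun z => ?_
      by_cases hzM : z ∈ M
      · rw [indicator_of_mem hzM.1.1, indicator_of_mem hzM, hψ,
          indicator_of_mem (show P z ∈ B from hzM.1.2),
          hMΓ z hzM]
      · rw [indicator_of_notMem hzM]
        by_cases hzf : z ∈ frontier D
        · rw [indicator_of_mem hzf, image_eq_zero_of_notMem_tsupport fun hz =>
            hzM (hball ⟨hzf, hφs hz⟩), ENNReal.ofReal_zero]
        · rw [indicator_of_notMem hzf]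
    have hbdd : IntegrableOn (fun w => φ (Γ w)) B := by
      obtain ⟨C, hC⟩ := hφ.continuous.bounded_above_of_compact_support hφc
      exact IntegrableOn.of_bound measure_ball_lt_top
        (hcont.aestronglyMeasurable measurableSet_ball) C (Eventually.of_forall fun w => hC _)
    have hvol : ∫⁻ w, ψ w ∂(volume.restrict B) = ENNReal.ofReal (∫ w in B, φ (Γ w)) := by
      rw [ofReal_integral_eq_lintegral_ofReal hbdd (Eventually.of_forall fun w => hφ0 _)]
      exact setLIntegral_congr_fun measurableSet_ball fun w hw => by
        simp only [hψ]; exact indicator_of_mem hw _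
    have hS : ∫ z in frontier D, φ z ∂μHE[m] = (∫⁻ w, ψ w ∂ν).toReal := by
      rw [integral_eq_lintegral_of_nonneg_ae (Eventually.of_forall hφ0)
        hφ.continuous.aestronglyMeasurable, hsurf]
    have h1 : ENNReal.ofReal (∫ w in B, φ (Γ w)) ≤ ∫⁻ w, ψ w ∂ν :=
      hvol ▸ lintegral_mono' hlow le_rfl
    have h2 : ∫⁻ w, ψ w ∂ν ≤ ENNReal.ofReal ((1 - ε)⁻¹ ^ m * ∫ w in B, φ (Γ w)) := by
      rw [ENNReal.ofReal_mul (pow_nonneg (inv_nonneg.2 (by linarith)) m), ← hvol,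
        ← smul_eq_mul, ← lintegral_smul_measure]
      exact lintegral_mono' hup le_rfl
    have hnn : 0 ≤ ∫ w in B, φ (Γ w) := integral_nonneg fun w => hφ0 _
    rw [hS]
    constructor
    · have := ENNReal.toReal_mono (ne_top_of_le_ne_top ENNReal.ofReal_ne_top h2) h1
      rwa [ENNReal.toReal_ofReal hnn] at this
    · have := ENNReal.toReal_mono ENNReal.ofReal_ne_top h2
      rwa [ENNReal.toReal_ofReal (mul_nonneg (pow_nonneg (inv_nonneg.2 (by linarith)) m) hnn)]
        at this

end GaussGreen

/-! ### The divergence theorem -/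

section GaussGreen

variable {E : Type*} [NormedAddCommGroup E] [InnerProductSpace ℝ E]

/-- The boundary of `D` is flat at small scales, with the continuous unit field `ν` as its outward
normal. This is the form in which the `C^1` regularity of the boundary is used. -/
structure IsFlatBoundary (D : Set E) (ν : E → E) : Prop where
  norm_eq_one : ∀ a ∈ frontier D, ‖ν a‖ = 1
  continuousOn : ContinuousOn ν (frontier D)
  flat : ∀ a ∈ frontier D, ∀ ε > 0, ∃ r > 0, ∃ ρ, IsFlatAt D a (ν a) ε r ρ

variable [FiniteDimensional ℝ E] [MeasurableSpace E] [BorelSpace E]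

theorem integrableOn_fderiv_apply {φ : E → ℝ} (hφ : ContDiff ℝ 1 φ) (hφc : HasCompactSupport φ)
    (D : Set E) (d : E) : IntegrableOn (fun z => fderiv ℝ φ z d) D :=
  (((hφ.continuous_fderiv one_ne_zero).clm_apply
    continuous_const).integrable_of_hasCompactSupport (hφc.fderiv_apply ℝ d)).integrableOn

theorem integral_fderiv_apply_eq_zero {φ : E → ℝ} (hφ : ContDiff ℝ 1 φ)
    (hφc : HasCompactSupport φ) (d : E) : ∫ z, fderiv ℝ φ z d = 0 := by
  have h := integral_mul_fderiv_eq_neg_fderiv_mul_of_integrable (μ := (volume : Measure E))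
    (f := fun _ => (1 : ℝ)) (g := φ) (v := d) (by simp)
    (by simpa [integrableOn_univ] using integrableOn_fderiv_apply hφ hφc univ d)
    (by simpa using hφ.continuous.integrable_of_hasCompactSupport hφc)
    (fun _ _ => differentiableAt_const _) (fun z _ => hφ.differentiable one_ne_zero z)
  simpa using h

/-- On a flat piece of the boundary the flux in the direction `d` is close to the surface integral
against the constant normal `e`. -/
theorem IsFlatAt.abs_flux_sub_le {m : ℕ} (hm : finrank ℝ E = m + 1) {D : Set E} (hD : IsOpen D)
    (hDv : volume D ≠ ⊤) {a e : E} {ε r : ℝ} {ρ : E → ℝ} (h : IsFlatAt D a e ε r ρ) (hr : 0 < r)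
    (he : ‖e‖ = 1) (hε0 : 0 < ε) (hε : ε < 1 / 2) {φ : E → ℝ} (hφ : ContDiff ℝ 1 φ)
    (hφc : HasCompactSupport φ) (hφ0 : ∀ z, 0 ≤ φ z) (hφs : tsupport φ ⊆ ball a r) (d : E) :
    |(∫ z in D, fderiv ℝ φ z d) - ⟪e, d⟫ * ∫ z in frontier D, φ z ∂μHE[m]| ≤
      ‖d‖ * (((1 - ε)⁻¹) ^ m - 1 + 2 * ε) * ∫ z in frontier D, φ z ∂μHE[m] := by
  obtain ⟨hlo, hup⟩ := (h.surface_bounds hm hD hr he hε.le).2 φ hφ hφc hφ0 hφs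
  set K := ((1 - ε)⁻¹) ^ m
  have hK : 1 ≤ K := one_le_pow₀ ((one_le_inv₀ (by linarith)).2 (by linarith))
  set S := ∫ z in frontier D, φ z ∂μHE[m]
  have hnn : ∀ v : E, ε * ‖v‖ < ⟪e, v⟫ → 0 ≤ ∫ z in D, fderiv ℝ φ z v := fun v hv =>
    h.setIntegral_fderiv_nonneg hr hD.measurableSet hDv hφ hφc hφ0 hφs hv
  have hadd : ∀ (s t : ℝ) (v w : E), ∫ z in D, fderiv ℝ φ z (s • v + t • w) =
      s * (∫ z in D, fderiv ℝ φ z v) + t * ∫ z in D, fderiv ℝ φ z w := by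
    intro s t v w
    rw [← integral_const_mul, ← integral_const_mul, ← integral_add
      ((integrableOn_fderiv_apply hφ hφc D v).const_mul s)
      ((integrableOn_fderiv_apply hφ hφc D w).const_mul t)]
    simp
  have hee : ⟪e, e⟫ = (1 : ℝ) := by rw [real_inner_self_eq_norm_sq, he]; norm_num
  set G := ∫ z in D, fderiv ℝ φ z e
  have hG : 0 ≤ G := hnn e (by rw [he, hee]; linarith)
  by_cases hd : d = 0
  · simp [hd]
  have hdpos : 0 < ‖d‖ := norm_pos_iff.2 hd
  set c : ℝ := ⟪e, d⟫ with hc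
  set τ : E := d - c • e with hτ
  have hcle : |c| ≤ ‖d‖ := by
    have := abs_real_inner_le_norm e d
    rwa [he, one_mul] at this
  have heτ : ⟪e, τ⟫ = 0 := by rw [hτ, inner_sub_right, real_inner_smul_right, hee, ← hc]; ring
  have hτle : ‖τ‖ ≤ ‖d‖ := by
    have h1 : ‖d‖ ^ 2 = ‖τ‖ ^ 2 + c ^ 2 := by
      have : d = τ + c • e := by rw [hτ]; abel
      conv_lhs => rw [this]
      rw [norm_add_sq_real, norm_smul, he, real_inner_smul_right, real_inner_comm, heτ,
        Real.norm_eq_abs, mul_one, sq_abs]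
      ring
    exact (abs_le_of_sq_le_sq' (by nlinarith [sq_nonneg c]) hdpos.le).2
  -- both `2ε‖d‖ e + τ` and `2ε‖d‖ e - τ` are transverse
  have htrans : ∀ s : ℝ, |s| = 1 → 0 ≤ 2 * ε * ‖d‖ * G + s * ∫ z in D, fderiv ℝ φ z τ := by
    intro s hs
    rw [← hadd]
    refine hnn _ ?_
    rw [inner_add_right, real_inner_smul_right, real_inner_smul_right, hee, heτ]
    have : ‖(2 * ε * ‖d‖) • e + s • τ‖ ≤ 2 * ε * ‖d‖ + ‖d‖ := by
      refine (norm_add_le _ _).trans ?_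
      rw [norm_smul, norm_smul, he, Real.norm_eq_abs, Real.norm_eq_abs, hs,
        abs_of_pos (by positivity)]
      linarith
    calc _ ≤ ε * (2 * ε * ‖d‖ + ‖d‖) := by gcongr
      _ < _ := by nlinarith [mul_pos hε0 hdpos]
  have h1 := htrans 1 (by simp)
  have h2 := htrans (-1) (by simp)
  have hsplit : ∫ z in D, fderiv ℝ φ z d = c * G + 1 * ∫ z in D, fderiv ℝ φ z τ := by
    rw [← hadd]; congr! 2; rw [hτ]; simp
  have hS : 0 ≤ S := hG.trans hlo
  have h3 : |c * G - c * S| ≤ ‖d‖ * ((K - 1) * G) := by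
    rw [← mul_sub, abs_mul]
    refine mul_le_mul hcle ?_ (abs_nonneg _) hdpos.le
    rw [abs_le]; constructor <;> linarith
  have h4 : |∫ z in D, fderiv ℝ φ z τ| ≤ ‖d‖ * (2 * ε * G) := by
    rw [abs_le]; constructor <;> linarith
  calc _ = |(c * G - c * S) + ∫ z in D, fderiv ℝ φ z τ| := by rw [hsplit]; ring_nf
    _ ≤ _ := abs_add_le _ _
    _ ≤ ‖d‖ * (K - 1 + 2 * ε) * G := by linarith
    _ ≤ _ := mul_le_mul_of_nonneg_left hlo (mul_nonneg hdpos.le (by linarith))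

/-- The boundary of a bounded set with flat boundary has finite surface measure. -/
theorem IsFlatBoundary.measure_frontier_lt_top {m : ℕ} (hm : finrank ℝ E = m + 1) {D : Set E}
    (hD : IsOpen D) (hDb : Bornology.IsBounded D) {ν : E → E} (hν : IsFlatBoundary D ν) :
    μHE[m] (frontier D) < ⊤ := by
  have hcpt : IsCompact (frontier D) :=
    hDb.isCompact_closure.of_isClosed_subset isClosed_frontier frontier_subset_closure
  refine hcpt.measure_lt_top_of_nhdsWithin fun a ha => ?_
  obtain ⟨r, hr, ρ, h⟩ := hν.flat a ha (1 / 2) (by norm_num)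
  refine ⟨_, inter_mem_nhdsWithin _ (ball_mem_nhds a hr), ?_⟩
  exact (h.surface_bounds hm hD hr (hν.norm_eq_one a ha) le_rfl).1

theorem IsFlatBoundary.integrableOn_frontier {m : ℕ} (hm : finrank ℝ E = m + 1) {D : Set E}
    (hD : IsOpen D) (hDb : Bornology.IsBounded D) {ν : E → E} (hν : IsFlatBoundary D ν)
    {f : E → ℝ} (hf : ContinuousOn f (frontier D)) : IntegrableOn f (frontier D) μHE[m] := by
  have hcpt : IsCompact (frontier D) :=
    hDb.isCompact_closure.of_isClosed_subset isClosed_frontier frontier_subset_closure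
  obtain ⟨C, hC⟩ := hcpt.exists_bound_of_continuousOn hf
  exact IntegrableOn.of_bound (hν.measure_frontier_lt_top hm hD hDb)
    (hf.aestronglyMeasurable isClosed_frontier.measurableSet) C
    ((ae_restrict_iff' isClosed_frontier.measurableSet).2 (Eventually.of_forall hC))

theorem IsFlatBoundary.integrableOn_mul_normal {m : ℕ} (hm : finrank ℝ E = m + 1) {D : Set E}
    (hD : IsOpen D) (hDb : Bornology.IsBounded D) {ν : E → E} (hν : IsFlatBoundary D ν)
    {f : E → ℝ} (hf : ContinuousOn f (frontier D)) (d : E) :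
    IntegrableOn (fun z => f z * ⟪ν z, d⟫) (frontier D) μHE[m] :=
  hν.integrableOn_frontier hm hD hDb (hf.mul (hν.continuousOn.inner continuousOn_const))

/-- The divergence theorem up to an error `δ`, for functions supported near a given point. -/
theorem IsFlatBoundary.exists_local_flux {m : ℕ} (hm : finrank ℝ E = m + 1) {D : Set E}
    (hD : IsOpen D) (hDb : Bornology.IsBounded D) {ν : E → E} (hν : IsFlatBoundary D ν) (d : E)
    {δ : ℝ} (hδ : 0 < δ) (a : E) : ∃ r > 0, ∀ φ : E → ℝ, ContDiff ℝ 1 φ → HasCompactSupport φ →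
      (∀ z, 0 ≤ φ z) → tsupport φ ⊆ ball a r →
      |(∫ z in D, fderiv ℝ φ z d) - ∫ z in frontier D, φ z * ⟪ν z, d⟫ ∂μHE[m]| ≤
        δ * ∫ z in frontier D, φ z ∂μHE[m] := by
  by_cases ha : a ∈ frontier D
  · -- `ε` makes the flatness error at most `δ/2`
    have hlim : Tendsto (fun ε : ℝ => ‖d‖ * (((1 - ε)⁻¹) ^ m - 1 + 2 * ε)) (𝓝[>] 0) (𝓝 0) := by
      have : ContinuousAt (fun ε : ℝ => ‖d‖ * (((1 - ε)⁻¹) ^ m - 1 + 2 * ε)) 0 := by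
        have : ContinuousAt (fun ε : ℝ => (1 - ε)⁻¹) 0 :=
          ContinuousAt.inv₀ (by fun_prop) (by norm_num)
        fun_prop
      simpa using this.tendsto.mono_left nhdsWithin_le_nhds
    obtain ⟨ε, hεδ, hε0, hε⟩ := ((hlim.eventually (gt_mem_nhds (half_pos hδ))).and
      (Ioo_mem_nhdsGT (show (0 : ℝ) < 1 / 2 by norm_num))).exists
    obtain ⟨r₁, hr₁, ρ, h⟩ := hν.flat a ha ε hε0
    have hc : ContinuousOn (fun z => ⟪ν z, d⟫) (frontier D) :=
      hν.continuousOn.inner continuousOn_const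
    obtain ⟨r₂, hr₂, hνr⟩ := Metric.continuousWithinAt_iff.1 (hc a ha) (δ / 2) (half_pos hδ)
    refine ⟨min r₁ r₂, lt_min hr₁ hr₂, fun φ hφ hφc hφ0 hφs => ?_⟩
    have hflat : IsFlatAt D a (ν a) ε (min r₁ r₂) ρ :=
      have hsub : ball a (3 * min r₁ r₂) ⊆ ball a (3 * r₁) :=
        ball_subset_ball (by linarith [min_le_left r₁ r₂])
      ⟨h.zero, fun z hz z' hz' => h.approx z (hsub hz) z' (hsub hz'),
        fun z hz => h.mem_iff z (hsub hz)⟩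
    have h1 := hflat.abs_flux_sub_le hm hD hDb.measure_lt_top.ne (lt_min hr₁ hr₂)
      (hν.norm_eq_one a ha) hε0 hε hφ hφc hφ0 hφs d
    have hi : IntegrableOn φ (frontier D) μHE[m] :=
      hν.integrableOn_frontier hm hD hDb hφ.continuous.continuousOn
    have hi' : IntegrableOn (fun z => φ z * ⟪ν z, d⟫) (frontier D) μHE[m] :=
      hν.integrableOn_mul_normal hm hD hDb hφ.continuous.continuousOn d
    have hS : 0 ≤ ∫ z in frontier D, φ z ∂μHE[m] := integral_nonneg hφ0
    have h2 : |⟪ν a, d⟫ * (∫ z in frontier D, φ z ∂μHE[m]) -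
        ∫ z in frontier D, φ z * ⟪ν z, d⟫ ∂μHE[m]| ≤ δ / 2 * ∫ z in frontier D, φ z ∂μHE[m] := by
      rw [← integral_const_mul, ← integral_const_mul, ← integral_sub (hi.const_mul _) hi',
        ← Real.norm_eq_abs]
      refine norm_integral_le_of_norm_le (hi.const_mul _) ?_
      refine (ae_restrict_iff' isClosed_frontier.measurableSet).2 (Eventually.of_forall ?_)
      intro z hz
      rw [mul_comm (φ z), ← sub_mul, norm_mul, Real.norm_of_nonneg (hφ0 z)]
      by_cases hφz : φ z = 0
      · simp [hφz]
      refine mul_le_mul_of_nonneg_right ?_ (hφ0 z)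
      have := hνr hz (lt_of_lt_of_le (hφs (subset_tsupport _ hφz)) (min_le_right _ _))
      rw [dist_comm, Real.dist_eq] at this
      exact this.le
    calc _ = |((∫ z in D, fderiv ℝ φ z d) - ⟪ν a, d⟫ * ∫ z in frontier D, φ z ∂μHE[m]) +
          (⟪ν a, d⟫ * (∫ z in frontier D, φ z ∂μHE[m]) -
            ∫ z in frontier D, φ z * ⟪ν z, d⟫ ∂μHE[m])| := by ring_nf
      _ ≤ _ := abs_add_le _ _
      _ ≤ δ / 2 * (∫ z in frontier D, φ z ∂μHE[m]) + δ / 2 * ∫ z in frontier D, φ z ∂μHE[m] :=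
        add_le_add (h1.trans (mul_le_mul_of_nonneg_right hεδ.le hS)) h2
      _ = _ := by ring
  · obtain ⟨r, hr, hsub⟩ := Metric.isOpen_iff.1 isClosed_frontier.isOpen_compl a ha
    refine ⟨r, hr, fun φ hφ hφc _ hφs => ?_⟩
    have hφ0 : ∀ z ∈ frontier D, φ z = 0 := fun z hz =>
      image_eq_zero_of_notMem_tsupport fun h => hsub (hφs h) hz
    have hS1 : ∫ z in frontier D, φ z ∂μHE[m] = 0 :=
      setIntegral_eq_zero_of_forall_eq_zero hφ0
    have hS2 : ∫ z in frontier D, φ z * ⟪ν z, d⟫ ∂μHE[m] = 0 :=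
      setIntegral_eq_zero_of_forall_eq_zero fun z hz => by rw [hφ0 z hz, zero_mul]
    have hdz : ∀ z ∉ ball a r, fderiv ℝ φ z = 0 := fun z hz =>
      image_eq_zero_of_notMem_tsupport fun h => hz (hφs (tsupport_fderiv_subset ℝ h))
    -- a ball that misses the boundary lies in `D` or misses `D`
    have hcase : ball a r ⊆ D ∨ Disjoint (ball a r) D := by
      refine ((convex_ball a r).isPreconnected.subset_or_subset hD isClosed_closure.isOpen_compl
        (disjoint_compl_right_iff_subset.2 subset_closure) fun z hz => ?_).imp_right fun h =>
          disjoint_left.2 fun z hz hzD => h hz (subset_closure hzD)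
      by_contra hcon
      rw [mem_union, not_or, notMem_compl_iff] at hcon
      exact hsub hz (hD.frontier_eq ▸ ⟨hcon.2, hcon.1⟩)
    have hG : ∫ z in D, fderiv ℝ φ z d = 0 := by
      rcases hcase with hin | hout
      · rw [setIntegral_eq_integral_of_forall_compl_eq_zero fun z hz => by
          rw [hdz z fun h => hz (hin h)]; rfl]
        exact integral_fderiv_apply_eq_zero hφ hφc d
      · refine setIntegral_eq_zero_of_forall_eq_zero fun z hz => ?_
        rw [hdz z fun h => disjoint_left.1 hout h hz]; rfl
    rw [hS1, hS2, hG]; simp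

/-- A finite smooth partition of unity on a compact set, subordinate to balls of given radii. -/
theorem exists_partition_of_compact {E : Type*} [NormedAddCommGroup E] [InnerProductSpace ℝ E]
    [FiniteDimensional ℝ E] {K : Set E} (hK : IsCompact K) (r : E → ℝ) (hr : ∀ a, 0 < r a) :
    ∃ (t : Finset E) (f : E → E → ℝ), (∀ a, ContDiff ℝ ∞ (f a)) ∧ (∀ a z, 0 ≤ f a z) ∧
      (∀ a ∈ t, tsupport (f a) ⊆ ball a (r a)) ∧ ∀ z ∈ K, ∑ a ∈ t, f a z = 1 := by
  classical
  obtain ⟨t, -, ht⟩ := hK.elim_nhds_subcover (fun a => ball a (r a))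
    fun a _ => ball_mem_nhds a (hr a)
  obtain ⟨f, hf⟩ := SmoothPartitionOfUnity.exists_isSubordinate (modelWithCornersSelf ℝ E)
    hK.isClosed (fun a : t => ball (a : E) (r a)) (fun _ => isOpen_ball)
    (by simpa [iUnion_subtype] using ht)
  refine ⟨t, fun a z => if h : a ∈ t then f ⟨a, h⟩ z else 0, fun a => ?_, fun a z => ?_,
    fun a ha => ?_, fun z hz => ?_⟩
  · by_cases h : a ∈ t
    · simpa [h] using (f ⟨a, h⟩).contMDiff.contDiff
    · simpa [h] using contDiff_const
  · by_cases h : a ∈ t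
    · simpa [h] using f.nonneg _ _
    · simp [h]
  · simpa [ha] using hf ⟨a, ha⟩
  · have h1 := f.sum_eq_one hz
    rw [finsum_eq_sum_of_fintype] at h1
    rw [← h1, ← Finset.sum_coe_sort t]
    refine Finset.sum_congr rfl fun a _ => ?_
    simp

theorem IsFlatBoundary.setIntegral_fderiv_of_nonneg {m : ℕ} (hm : finrank ℝ E = m + 1) {D : Set E}
    (hD : IsOpen D) (hDb : Bornology.IsBounded D) {ν : E → E} (hν : IsFlatBoundary D ν) (d : E)
    {φ : E → ℝ} (hφ : ContDiff ℝ 1 φ) (hφc : HasCompactSupport φ) (hφ0 : ∀ z, 0 ≤ φ z) :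
    ∫ z in D, fderiv ℝ φ z d = ∫ z in frontier D, φ z * ⟪ν z, d⟫ ∂μHE[m] := by
  set S := ∫ z in frontier D, φ z ∂μHE[m] with hSdef
  have hS : 0 ≤ S := integral_nonneg hφ0
  have key : ∀ δ > 0, |(∫ z in D, fderiv ℝ φ z d) -
      ∫ z in frontier D, φ z * ⟪ν z, d⟫ ∂μHE[m]| ≤ δ * S := by
    intro δ hδ
    choose r hr hloc using hν.exists_local_flux hm hD hDb d hδ
    obtain ⟨t, f, hf, hf0, hfs, hsum⟩ := exists_partition_of_compact hφc r hr
    have hfφ : ∀ a, ContDiff ℝ 1 (fun z => f a z * φ z) := fun a =>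
      ((hf a).of_le (by norm_cast)).mul hφ
    have hfc : ∀ a, HasCompactSupport (fun z => f a z * φ z) := fun a => hφc.mul_left
    have hdecomp : φ = fun z => ∑ a ∈ t, f a z * φ z := by
      ext z
      rw [← Finset.sum_mul]
      by_cases hz : z ∈ tsupport φ
      · rw [hsum z hz, one_mul]
      · rw [image_eq_zero_of_notMem_tsupport hz, mul_zero]
    have hG : ∫ z in D, fderiv ℝ φ z d =
        ∑ a ∈ t, ∫ z in D, fderiv ℝ (fun z => f a z * φ z) z d := by
      rw [← integral_finsetSum _ fun a _ => integrableOn_fderiv_apply (hfφ a) (hfc a) D d]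
      congr 1; ext z
      conv_lhs => rw [hdecomp]
      rw [fderiv_fun_sum fun a _ => (hfφ a).differentiable one_ne_zero z]
      simp
    have hV : ∫ z in frontier D, φ z * ⟪ν z, d⟫ ∂μHE[m] =
        ∑ a ∈ t, ∫ z in frontier D, f a z * φ z * ⟪ν z, d⟫ ∂μHE[m] := by
      rw [← integral_finsetSum _ fun a _ =>
        hν.integrableOn_mul_normal hm hD hDb (hfφ a).continuous.continuousOn d]
      congr 1; ext z
      conv_lhs => rw [hdecomp]
      rw [Finset.sum_mul]
    have hSsum : S = ∑ a ∈ t, ∫ z in frontier D, f a z * φ z ∂μHE[m] := by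
      rw [hSdef, ← integral_finsetSum _ fun a _ =>
        hν.integrableOn_frontier hm hD hDb (hfφ a).continuous.continuousOn]
      congr 1
    rw [hG, hV, hSsum, ← Finset.sum_sub_distrib, Finset.mul_sum]
    refine (Finset.abs_sum_le_sum_abs _ _).trans (Finset.sum_le_sum fun a ha => ?_)
    exact hloc a _ (hfφ a) (hfc a) (fun z => mul_nonneg (hf0 a z) (hφ0 z))
      ((tsupport_mul_subset_left).trans (hfs a ha))
  refine sub_eq_zero.1 (abs_eq_zero.1 (le_antisymm ?_ (abs_nonneg _)))
  refine le_of_forall_pos_le_add fun η hη => (key (η / (S + 1)) (by positivity)).trans ?_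
  rw [zero_add, div_mul_eq_mul_div, div_le_iff₀ (by linarith)]
  nlinarith

/-- **Divergence theorem** on a bounded open set with `C^1` boundary, for compactly supported `C^1`
functions, with the Euclidean Hausdorff measure as surface measure. -/
theorem IsFlatBoundary.setIntegral_fderiv {m : ℕ} (hm : finrank ℝ E = m + 1) {D : Set E}
    (hD : IsOpen D) (hDb : Bornology.IsBounded D) {ν : E → E} (hν : IsFlatBoundary D ν) (d : E)
    {φ : E → ℝ} (hφ : ContDiff ℝ 1 φ) (hφc : HasCompactSupport φ) :
    ∫ z in D, fderiv ℝ φ z d = ∫ z in frontier D, φ z * ⟪ν z, d⟫ ∂μHE[m] := by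
  obtain ⟨C, hC⟩ := hφ.continuous.bounded_above_of_compact_support hφc
  have hC0 : 0 ≤ C := (norm_nonneg _).trans (hC 0)
  obtain ⟨R, hR⟩ := hφc.isBounded.subset_closedBall (0 : E)
  let b : ContDiffBump (0 : E) := ⟨|R| + 1, |R| + 2, by positivity, by linarith⟩
  set χ : E → ℝ := fun z => C * b z with hχdef
  have hχ : ContDiff ℝ 1 χ := contDiff_const.mul b.contDiff
  have hχc : HasCompactSupport χ := b.hasCompactSupport.mul_left
  have hχ0 : ∀ z, 0 ≤ χ z := fun z => mul_nonneg hC0 b.nonneg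
  have hs0 : ∀ z, 0 ≤ φ z + χ z := by
    intro z
    by_cases hz : z ∈ tsupport φ
    · have h1 : b z = 1 := b.one_of_mem_closedBall (closedBall_subset_closedBall
        (by show R ≤ |R| + 1; linarith [le_abs_self R]) (hR hz))
      have h2 := (abs_le.1 (hC z)).1
      rw [hχdef]; simp only [h1]; linarith
    · rw [image_eq_zero_of_notMem_tsupport hz, zero_add]; exact hχ0 z
  have h1 := hν.setIntegral_fderiv_of_nonneg hm hD hDb d hχ hχc hχ0
  have h2 := hν.setIntegral_fderiv_of_nonneg hm hD hDb d (hφ.add hχ) (hφc.add hχc) hs0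
  have h3 : ∫ z in D, fderiv ℝ (fun x => φ x + χ x) z d =
      (∫ z in D, fderiv ℝ φ z d) + ∫ z in D, fderiv ℝ χ z d := by
    rw [← integral_add (integrableOn_fderiv_apply hφ hφc D d)
      (integrableOn_fderiv_apply hχ hχc D d)]
    congr 1; ext z
    rw [fderiv_fun_add (hφ.differentiable one_ne_zero z) (hχ.differentiable one_ne_zero z)]
    rfl
  have h4 : ∫ z in frontier D, (φ z + χ z) * ⟪ν z, d⟫ ∂μHE[m] =
      (∫ z in frontier D, φ z * ⟪ν z, d⟫ ∂μHE[m]) +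
        ∫ z in frontier D, χ z * ⟪ν z, d⟫ ∂μHE[m] := by
    rw [← integral_add
      (hν.integrableOn_mul_normal hm hD hDb hφ.continuous.continuousOn d)
      (hν.integrableOn_mul_normal hm hD hDb hχ.continuous.continuousOn d)]
    congr 1; ext z; ring
  linarith

end GaussGreen

/-! ### `C^1` boundaries are flat -/

section Normal

variable {N l : ℕ}

theorem fderiv_eq_inner_gradient {ρ : Space N l → ℝ} (a v : Space N l) :
    fderiv ℝ ρ a v = ⟪gradient ρ a, v⟫ := by
  rw [gradient, InnerProductSpace.toDual_symm_apply]

/-- A `C^1` boundary is flat at small scales: a `C^1` defining function is strictly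
differentiable. -/
theorem IsOutwardUnitNormal.isFlatBoundary {D : Set (Space N l)} {ν : Space N l → Space N l}
    (hD : IsOpen D) (hν : IsOutwardUnitNormal D ν) : IsFlatBoundary D ν := by
  have hloc : ∀ a ∈ frontier D, ‖ν a‖ = 1 ∧ ContinuousWithinAt ν (frontier D) a ∧
      ∀ ε > 0, ∃ r > 0, ∃ ρ, IsFlatAt D a (ν a) ε r ρ := by
    intro a ha
    obtain ⟨U, ρ, hU, haU, hρ, hne, hmem, hνρ⟩ := hν a ha
    have hκ : 0 < ‖gradient ρ a‖ := norm_pos_iff.2 (hne a haU)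
    have hνa : ν a = ‖gradient ρ a‖⁻¹ • gradient ρ a := hνρ a ⟨haU, ha⟩
    have hρa : ContDiffAt ℝ 1 ρ a := hρ.contDiffAt (hU.mem_nhds haU)
    refine ⟨?_, ?_, fun ε hε => ?_⟩
    · rw [hνa, norm_smul, norm_inv, norm_norm, inv_mul_cancel₀ hκ.ne']
    · have hg : ContinuousAt (gradient ρ) a :=
        (InnerProductSpace.toDual ℝ (Space N l)).symm.continuous.continuousAt.comp
          (hρa.continuousAt_fderiv one_ne_zero)
      have hg' : ContinuousAt (fun z => ‖gradient ρ z‖⁻¹ • gradient ρ z) a :=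
        (hg.norm.inv₀ hκ.ne').smul hg
      refine hg'.continuousWithinAt.congr_of_eventuallyEq ?_ hνa
      filter_upwards [self_mem_nhdsWithin, mem_nhdsWithin_of_mem_nhds (hU.mem_nhds haU)]
        with z hz hzU using hνρ z ⟨hzU, hz⟩
    · have hstrict := (hρa.hasStrictFDerivAt one_ne_zero).isLittleO.def (mul_pos hκ hε)
      rw [nhds_prod_eq] at hstrict
      obtain ⟨s, hs, hst⟩ := Filter.eventually_prod_self_iff'.1 hstrict
      obtain ⟨R, hR, hRs⟩ := Metric.mem_nhds_iff.1 (inter_mem hs (hU.mem_nhds haU))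
      have h0 : ρ a = 0 := by
        have h1 : ¬ ρ a < 0 := fun h => by
          have := (hmem a haU).2 h
          rw [hD.frontier_eq] at ha
          exact ha.2 this
        refine le_antisymm ?_ (not_lt.1 h1)
        by_contra! hpos
        obtain ⟨y, hy, hyD⟩ := mem_closure_iff_nhds.1 (frontier_subset_closure ha) _
          (inter_mem (hρa.continuousAt.eventually (lt_mem_nhds hpos)) (hU.mem_nhds haU))
        exact absurd ((hmem y hy.2).1 hyD) (not_lt.2 (le_of_lt hy.1))
      refine ⟨R / 3, by positivity, fun z => ‖gradient ρ a‖⁻¹ * ρ z, ⟨by rw [h0, mul_zero], ?_, ?_⟩⟩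
      · rw [mul_div_cancel₀ R three_ne_zero]
        intro z hz z' hz'
        have h1 := hst z' (hRs hz').1 z (hRs hz).1
        rw [fderiv_eq_inner_gradient, Real.norm_eq_abs] at h1
        rw [hνa, real_inner_smul_left, ← mul_sub, ← mul_sub, abs_mul, abs_inv, abs_norm,
          inv_mul_le_iff₀ hκ]
        linarith
      · rw [mul_div_cancel₀ R three_ne_zero]
        intro z hz
        rw [hmem z (hRs hz).2, inv_mul_lt_iff₀ hκ, mul_zero]
  exact ⟨fun a ha => (hloc a ha).1, fun a ha => (hloc a ha).2.1, fun a ha => (hloc a ha).2.2⟩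

end Normal

/-! ### Mollifiers -/

section Mollifier

variable {E : Type*} [NormedAddCommGroup E] [InnerProductSpace ℝ E] [FiniteDimensional ℝ E]
  [MeasurableSpace E] [BorelSpace E]

/-- A smooth bump at the origin, supported in the ball of radius `1 / (n + 1)`. -/
noncomputable def bump (E : Type*) [NormedAddCommGroup E] (n : ℕ) : ContDiffBump (0 : E) :=
  ⟨1 / (n + 1) / 2, 1 / (n + 1), by positivity, half_lt_self (by positivity)⟩

/-- The smooth convolution kernel of mass one supported in the ball of radius `1 / (n + 1)`. -/
noncomputable def kernel (n : ℕ) : E → ℝ := (bump E n).normed volume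

/-- The regularization of `g` at scale `1 / (n + 1)`. -/
noncomputable def mollify (n : ℕ) (g : E → ℝ) : E → ℝ :=
  convolution (kernel n) g (ContinuousLinearMap.lsmul ℝ ℝ) volume

theorem contDiff_kernel (n : ℕ) {k : ℕ∞} : ContDiff ℝ k (kernel n : E → ℝ) :=
  (bump E n).contDiff_normed

theorem hasCompactSupport_kernel (n : ℕ) : HasCompactSupport (kernel n : E → ℝ) :=
  (bump E n).hasCompactSupport_normed

theorem kernel_nonneg (n : ℕ) (z : E) : 0 ≤ kernel n z := (bump E n).nonneg_normed z

theorem kernel_sub_comm (n : ℕ) (z w : E) : kernel n (z - w) = kernel n (w - z) := by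
  rw [← neg_sub, kernel, (bump E n).normed_neg]

theorem tendsto_bump_rOut {E : Type*} [NormedAddCommGroup E] :
    Tendsto (fun n => (bump E n).rOut) atTop (𝓝 0) :=
  tendsto_one_div_add_atTop_nhds_zero_nat

theorem mollify_eq_integral (n : ℕ) (g : E → ℝ) (z : E) :
    mollify n g z = ∫ w, kernel n (z - w) * g w := by
  rw [mollify, convolution_eq_swap]; rfl

theorem mollify_eq_convolution (n : ℕ) (g : E → ℝ) :
    mollify n g = convolution g (kernel n) (ContinuousLinearMap.mul ℝ ℝ) volume := by
  ext z
  rw [mollify_eq_integral, convolution_def]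
  simp [mul_comm]

theorem contDiff_mollify (n : ℕ) {g : E → ℝ} (hg : LocallyIntegrable g) :
    ContDiff ℝ ∞ (mollify n g) := by
  rw [mollify_eq_convolution]
  exact (hasCompactSupport_kernel n).contDiff_convolution_right _ hg (contDiff_kernel n)

theorem fderiv_mollify (n : ℕ) {g : E → ℝ} (hg : LocallyIntegrable g) (z v : E) :
    fderiv ℝ (mollify n g) z v = ∫ w, fderiv ℝ (kernel n) (z - w) v * g w := by
  rw [mollify_eq_convolution, ((hasCompactSupport_kernel n).hasFDerivAt_convolution_right _ hg
    (contDiff_kernel n) z).fderiv, convolution_precompR_apply _ hg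
    ((hasCompactSupport_kernel n).fderiv ℝ)
    ((contDiff_kernel n (k := 1)).continuous_fderiv one_ne_zero), convolution_def]
  simp [mul_comm]

theorem fderiv_mollify_of_contDiff (n : ℕ) {g : E → ℝ} (hg : ContDiff ℝ 1 g)
    (hgc : HasCompactSupport g) (z v : E) :
    fderiv ℝ (mollify n g) z v = mollify n (fun w => fderiv ℝ g w v) z := by
  rw [mollify, (hgc.hasFDerivAt_convolution_right _
    (contDiff_kernel n (k := 1)).continuous.locallyIntegrable hg z).fderiv,
    convolution_precompR_apply _ (contDiff_kernel n (k := 1)).continuous.locallyIntegrable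
    (hgc.fderiv ℝ) (hg.continuous_fderiv one_ne_zero)]
  rfl

theorem abs_mollify_le (n : ℕ) {g : E → ℝ} {C : ℝ}
    (hC : ∀ z, |g z| ≤ C) (z : E) : |mollify n g z| ≤ C := by
  have hC0 : 0 ≤ C := (abs_nonneg _).trans (hC 0)
  rw [mollify, convolution_def, ← Real.norm_eq_abs]
  calc _ ≤ ∫ t, kernel n t * C := by
        refine norm_integral_le_of_norm_le ((bump E n).integrable_normed.mul_const C)
          (Eventually.of_forall fun t => ?_)
        simp only [ContinuousLinearMap.lsmul_apply, smul_eq_mul, norm_mul,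
          Real.norm_of_nonneg (kernel_nonneg n t)]
        exact mul_le_mul_of_nonneg_left (hC _) (kernel_nonneg n t)
    _ = C := by rw [integral_mul_const, kernel, (bump E n).integral_normed, one_mul]

theorem mollify_nonneg (n : ℕ) {g : E → ℝ} (hg : ∀ z, 0 ≤ g z) (z : E) : 0 ≤ mollify n g z := by
  rw [mollify_eq_integral]
  exact integral_nonneg fun w => mul_nonneg (kernel_nonneg _ _) (hg w)

theorem tsupport_mollify_subset (n : ℕ) (g : E → ℝ) :
    tsupport (mollify n g) ⊆ cthickening (1 / (n + 1)) (tsupport g) := by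
  refine closure_minimal ?_ isClosed_cthickening
  refine (support_convolution_subset _).trans ?_
  rintro _ ⟨w, hw, t, ht, rfl⟩
  rw [kernel, (bump E n).support_normed_eq] at hw
  refine mem_cthickening_of_dist_le _ t _ _ (subset_tsupport _ ht) ?_
  rw [dist_eq_norm, add_sub_cancel_right]
  exact (mem_ball_zero_iff.1 hw).le

theorem tendsto_mollify {g : E → ℝ} (hg : Continuous g) (z : E) :
    Tendsto (fun n => mollify n g z) atTop (𝓝 (g z)) :=
  ContDiffBump.convolution_tendsto_right_of_continuous tendsto_bump_rOut hg z

theorem mollify_eq_of_ball (n : ℕ) {g : E → ℝ} {z : E} {r : ℝ} (hn : 1 / ((n : ℝ) + 1) ≤ r)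
    (hg : ∀ w ∈ ball z r, g w = g z) : mollify n g z = g z :=
  (bump E n).normed_convolution_eq_right fun w hw => hg w (ball_subset_ball hn hw)

/-- An identity between a continuous field and a continuous source, tested with smooth functions,
extends to `C^1` test functions. -/
theorem integral_fderiv_eq_of_smooth {a : E → E} (ha : Continuous a) {b : E → ℝ}
    (hb : Continuous b) {O : Set E} (hO : IsOpen O)
    (H : ∀ φ : E → ℝ, ContDiff ℝ ∞ φ → HasCompactSupport φ → tsupport φ ⊆ O →
      ∫ z, fderiv ℝ φ z (a z) = ∫ z, b z * φ z)
    {φ : E → ℝ} (hφ : ContDiff ℝ 1 φ) (hφc : HasCompactSupport φ) (hφO : tsupport φ ⊆ O) :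
    ∫ z, fderiv ℝ φ z (a z) = ∫ z, b z * φ z := by
  obtain ⟨δ, hδ, hδO⟩ := IsCompact.exists_cthickening_subset_open hφc hO hφO
  have hKc : IsCompact (cthickening δ (tsupport φ)) := IsCompact.cthickening hφc
  set K := cthickening δ (tsupport φ) with hK
  have hsmall : ∀ᶠ n : ℕ in atTop, 1 / ((n : ℝ) + 1) ≤ δ :=
    (tendsto_one_div_add_atTop_nhds_zero_nat.eventually (gt_mem_nhds hδ)).mono fun _ h => h.le
  have hsupp : ∀ᶠ n : ℕ in atTop, tsupport (mollify n φ) ⊆ K := hsmall.mono fun n hn =>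
    (tsupport_mollify_subset n φ).trans (cthickening_mono hn _)
  have hφi : LocallyIntegrable φ := hφ.continuous.locallyIntegrable
  obtain ⟨Ca, hCa⟩ := hKc.exists_bound_of_continuousOn ha.continuousOn
  obtain ⟨Cb, hCb⟩ := hKc.exists_bound_of_continuousOn hb.continuousOn
  obtain ⟨C0, hC0⟩ := hφ.continuous.bounded_above_of_compact_support hφc
  obtain ⟨C1, hC1⟩ := (hφ.continuous_fderiv one_ne_zero).bounded_above_of_compact_support
    (hφc.fderiv ℝ)
  have hcont : ∀ n, ContDiff ℝ ∞ (mollify n φ) := fun n => contDiff_mollify n hφi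
  have hind : ∀ c : ℝ, Integrable (K.indicator fun _ => c) := fun c =>
    (integrable_indicator_iff hKc.measurableSet).2 (integrableOn_const hKc.measure_lt_top.ne)
  have hC1' : 0 ≤ C1 := (norm_nonneg _).trans (hC1 0)
  have hC0' : 0 ≤ C0 := (norm_nonneg _).trans (hC0 0)
  have lim1 : Tendsto (fun n => ∫ z, fderiv ℝ (mollify n φ) z (a z)) atTop
      (𝓝 (∫ z, fderiv ℝ φ z (a z))) := by
    refine tendsto_integral_filter_of_dominated_convergence (K.indicator fun _ => C1 * Ca)
      (Eventually.of_forall fun n => ?_) ?_ (hind _) (Eventually.of_forall fun z => ?_)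
    · exact ((((hcont n).continuous_fderiv (by simp)).clm_apply ha)).aestronglyMeasurable
    · filter_upwards [hsupp] with n hn
      refine Eventually.of_forall fun z => ?_
      by_cases hz : z ∈ K
      · rw [indicator_of_mem hz, fderiv_mollify_of_contDiff n hφ hφc, Real.norm_eq_abs]
        refine abs_mollify_le n (fun w => ?_) z
        refine ((fderiv ℝ φ w).le_opNorm (a z)).trans ?_
        exact mul_le_mul (hC1 w) (hCa z hz) (norm_nonneg _) hC1'
      · rw [indicator_of_notMem hz, image_eq_zero_of_notMem_tsupport fun h =>
          hz (hn (tsupport_fderiv_subset ℝ h))]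
        simp
    · simp only [fderiv_mollify_of_contDiff _ hφ hφc]
      exact tendsto_mollify ((hφ.continuous_fderiv one_ne_zero).clm_apply continuous_const) z
  have lim2 : Tendsto (fun n => ∫ z, b z * mollify n φ z) atTop (𝓝 (∫ z, b z * φ z)) := by
    refine tendsto_integral_filter_of_dominated_convergence (K.indicator fun _ => Cb * C0)
      (Eventually.of_forall fun n => ?_) ?_ (hind _) (Eventually.of_forall fun z => ?_)
    · exact (hb.mul (hcont n).continuous).aestronglyMeasurable
    · filter_upwards [hsupp] with n hn
      refine Eventually.of_forall fun z => ?_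
      by_cases hz : z ∈ K
      · rw [indicator_of_mem hz, norm_mul]
        exact mul_le_mul (hCb z hz) (abs_mollify_le n hC0 z)
          (norm_nonneg _) ((norm_nonneg _).trans (hCb z hz))
      · rw [indicator_of_notMem hz, image_eq_zero_of_notMem_tsupport fun h => hz (hn h)]
        simp
    · exact (tendsto_mollify hφ.continuous z).const_mul _
  refine tendsto_nhds_unique (lim1.congr' ?_) lim2
  filter_upwards [hsupp] with n hn
  exact H _ (hcont n) (hKc.of_isClosed_subset (isClosed_tsupport _) hn) (hn.trans hδO)

end Mollifier

/-! ### Mollified characteristic functions -/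

section MollifiedIndicator

variable {E : Type*} [NormedAddCommGroup E] [InnerProductSpace ℝ E] [FiniteDimensional ℝ E]
  [MeasurableSpace E] [BorelSpace E]

/-- Smooth approximation of the characteristic function of `D`. -/
noncomputable def smoothIndicator (n : ℕ) (D : Set E) : E → ℝ := mollify n (D.indicator 1)

theorem locallyIntegrable_indicator_one {D : Set E} (hD : MeasurableSet D) :
    LocallyIntegrable (D.indicator (1 : E → ℝ)) :=
  (locallyIntegrable_const (1 : ℝ)).indicator hD

theorem contDiff_smoothIndicator (n : ℕ) {D : Set E} (hD : MeasurableSet D) :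
    ContDiff ℝ ∞ (smoothIndicator n D) :=
  contDiff_mollify n (locallyIntegrable_indicator_one hD)

theorem smoothIndicator_nonneg (n : ℕ) (D : Set E) (z : E) : 0 ≤ smoothIndicator n D z :=
  mollify_nonneg n (fun w => indicator_nonneg (by simp) w) z

theorem abs_smoothIndicator_le (n : ℕ) (D : Set E) (z : E) : |smoothIndicator n D z| ≤ 1 :=
  abs_mollify_le n (fun w => by by_cases hw : w ∈ D <;> simp [hw]) z

theorem tsupport_smoothIndicator_subset (n : ℕ) (D : Set E) :
    tsupport (smoothIndicator n D) ⊆ cthickening (1 / (n + 1)) (closure D) :=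
  (tsupport_mollify_subset n _).trans (cthickening_subset_of_subset _
    (closure_mono (by simp [Set.support_indicator])))

theorem tendsto_smoothIndicator {D : Set E} (hD : IsOpen D) {z : E} (hz : z ∉ frontier D) :
    Tendsto (fun n => smoothIndicator n D z) atTop (𝓝 (D.indicator 1 z)) := by
  have hloc : ∃ r > 0, ∀ w ∈ ball z r, D.indicator (1 : E → ℝ) w = D.indicator 1 z := by
    by_cases hzD : z ∈ D
    · obtain ⟨r, hr, h⟩ := Metric.isOpen_iff.1 hD z hzD
      exact ⟨r, hr, fun w hw => by simp [hzD, h hw]⟩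
    · have hzc : z ∈ (closure D)ᶜ := fun h => hz (hD.frontier_eq ▸ ⟨h, hzD⟩)
      obtain ⟨r, hr, h⟩ := Metric.isOpen_iff.1 isClosed_closure.isOpen_compl z hzc
      exact ⟨r, hr, fun w hw => by
        have hwD : w ∉ D := fun h' => h hw (subset_closure h')
        simp [hzD, hwD]⟩
  obtain ⟨r, hr, h⟩ := hloc
  refine tendsto_const_nhds.congr' ?_
  filter_upwards [tendsto_one_div_add_atTop_nhds_zero_nat.eventually (gt_mem_nhds hr)] with n hn
  exact (mollify_eq_of_ball n hn.le h).symm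

theorem IsFlatBoundary.volume_frontier {m : ℕ} (hm : finrank ℝ E = m + 1) {D : Set E}
    (hD : IsOpen D) (hDb : Bornology.IsBounded D) {ν : E → E} (hν : IsFlatBoundary D ν) :
    volume (frontier D) = 0 := by
  rw [← InnerProductSpace.euclideanHausdorffMeasure_eq_volume, hm]
  exact (Measure.euclideanHausdorffMeasure_zero_or_top (Nat.lt_succ_self m) _).resolve_right
    (hν.measure_frontier_lt_top hm hD hDb).ne

/-- The mollified characteristic functions converge off `∂D`, which is a null set. -/
theorem IsFlatBoundary.tendsto_integral_mul_smoothIndicator {m : ℕ} (hm : finrank ℝ E = m + 1)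
    {D : Set E} (hD : IsOpen D) (hDb : Bornology.IsBounded D) {ν : E → E}
    (hν : IsFlatBoundary D ν) {g : E → ℝ} {δ : ℝ} (hδ : 0 < δ)
    (hg : IntegrableOn g (cthickening δ (closure D))) :
    Tendsto (fun n => ∫ z, g z * smoothIndicator n D z) atTop (𝓝 (∫ z in D, g z)) := by
  set K := cthickening δ (closure D)
  have hK : MeasurableSet K := isClosed_cthickening.measurableSet
  have hDK : D ⊆ K := subset_closure.trans (self_subset_cthickening _)
  have hsupp : ∀ᶠ n : ℕ in atTop, tsupport (smoothIndicator n D) ⊆ K :=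
    (tendsto_one_div_add_atTop_nhds_zero_nat.eventually (gt_mem_nhds hδ)).mono fun n hn =>
      (tsupport_smoothIndicator_subset n D).trans (cthickening_mono (le_of_lt hn) _)
  have hlim : Tendsto (fun n => ∫ z in K, g z * smoothIndicator n D z) atTop
      (𝓝 (∫ z in K, g z * D.indicator 1 z)) := by
    refine tendsto_integral_of_dominated_convergence (fun z => ‖g z‖) (fun n => ?_) hg.norm
      (fun n => Eventually.of_forall fun z => ?_) ?_
    · exact hg.aestronglyMeasurable.mul
        (contDiff_smoothIndicator n hD.measurableSet).continuous.aestronglyMeasurable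
    · rw [norm_mul]
      exact mul_le_of_le_one_right (norm_nonneg _) (abs_smoothIndicator_le n D z)
    · refine ae_restrict_of_ae ?_
      filter_upwards [compl_mem_ae_iff.2 (hν.volume_frontier hm hD hDb)] with z hz
      exact (tendsto_smoothIndicator hD hz).const_mul _
  have hlim' : ∫ z in K, g z * D.indicator 1 z = ∫ z in D, g z := by
    rw [← integral_indicator hK, ← integral_indicator hD.measurableSet]
    congr 1; ext z
    by_cases hz : z ∈ D
    · simp [hz, hDK hz]
    · by_cases hzK : z ∈ K <;> simp [hz, hzK]
  rw [hlim'] at hlim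
  refine hlim.congr' ?_
  filter_upwards [hsupp] with n hn
  refine setIntegral_eq_integral_of_forall_compl_eq_zero fun z hz => ?_
  rw [image_eq_zero_of_notMem_tsupport fun h => hz (hn h), mul_zero]

/-- The gradient of the mollified characteristic function is minus the mollified surface measure
with density `ν`. -/
theorem IsFlatBoundary.fderiv_smoothIndicator {m : ℕ} (hm : finrank ℝ E = m + 1) {D : Set E}
    (hD : IsOpen D) (hDb : Bornology.IsBounded D) {ν : E → E} (hν : IsFlatBoundary D ν) (n : ℕ)
    (z v : E) : fderiv ℝ (smoothIndicator n D) z v =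
      -∫ w in frontier D, kernel n (z - w) * ⟪ν w, v⟫ ∂μHE[m] := by
  have hk : ContDiff ℝ 1 (kernel n : E → ℝ) := contDiff_kernel n
  have hφ : ContDiff ℝ 1 (fun w => kernel n (z - w)) := hk.comp (contDiff_const.sub contDiff_id)
  have hφc : HasCompactSupport (fun w => kernel n (z - w)) :=
    (hasCompactSupport_kernel n).comp_homeomorph (Homeomorph.subLeft z)
  rw [smoothIndicator, fderiv_mollify n (locallyIntegrable_indicator_one hD.measurableSet),
    ← hν.setIntegral_fderiv hm hD hDb v hφ hφc, ← integral_neg,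
    ← integral_indicator hD.measurableSet]
  congr 1; ext w
  have hder : fderiv ℝ (fun w => kernel n (z - w)) w v = -fderiv ℝ (kernel n) (z - w) v := by
    have h1 : HasFDerivAt (fun w : E => z - w) (-ContinuousLinearMap.id ℝ E) w :=
      (hasFDerivAt_id w).const_sub z
    have h2 := (hk.differentiable one_ne_zero (z - w)).hasFDerivAt.comp w h1
    rw [show (fun w => kernel n (z - w)) = kernel n ∘ fun w => z - w from rfl, h2.fderiv]
    simp
  by_cases hw : w ∈ D <;> simp [hw, hder]

/-- Integrals of a continuous field against the gradient of the mollified characteristic function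
tend to minus the flux through the boundary. -/
theorem IsFlatBoundary.tendsto_integral_fderiv_smoothIndicator {m : ℕ}
    (hm : finrank ℝ E = m + 1) {D : Set E} (hD : IsOpen D) (hDb : Bornology.IsBounded D)
    {ν : E → E} (hν : IsFlatBoundary D ν) {a : E → E} (ha : Continuous a) :
    Tendsto (fun n => ∫ z, fderiv ℝ (smoothIndicator n D) z (a z)) atTop
      (𝓝 (-∫ w in frontier D, ⟪ν w, a w⟫ ∂μHE[m])) := by
  set S : Measure E := (μHE[m]).restrict (frontier D) with hS
  have : IsFiniteMeasure S := ⟨by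
    rw [hS, Measure.restrict_apply_univ]; exact hν.measure_frontier_lt_top hm hD hDb⟩
  have hfm : MeasurableSet (frontier D) := isClosed_frontier.measurableSet
  -- the normal extended by zero is measurable on the whole space
  classical
  set η : E → E := (frontier D).indicator ν with hη
  have hηm : Measurable η := by
    rw [hη, ← piecewise_eq_indicator]
    exact hν.continuousOn.measurable_piecewise continuousOn_const hfm
  have hη1 : ∀ w, ‖η w‖ ≤ 1 := fun w => by
    by_cases hw : w ∈ frontier D
    · rw [hη, indicator_of_mem hw, hν.norm_eq_one w hw]
    · rw [hη, indicator_of_notMem hw, norm_zero]; exact zero_le_one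
  have hην : ∀ w ∈ frontier D, η w = ν w := fun w hw => indicator_of_mem hw _
  set K := cthickening 1 (frontier D) with hKdef
  have hcpt : IsCompact (frontier D) :=
    hDb.isCompact_closure.of_isClosed_subset isClosed_frontier frontier_subset_closure
  have hK : IsCompact K := hcpt.cthickening
  obtain ⟨C, hC⟩ := hK.exists_bound_of_continuousOn ha.continuousOn
  have hker0 : ∀ n, ∀ w ∈ frontier D, ∀ z ∉ K, kernel n (z - w) = 0 := by
    intro n w hw z hz
    by_contra hne
    have h1 : z - w ∈ ball (0 : E) (bump E n).rOut := by
      rw [← (bump E n).support_normed_eq (μ := volume)]; exact hne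
    have h2 : (bump E n).rOut ≤ 1 := by
      show 1 / ((n : ℝ) + 1) ≤ 1
      rw [div_le_one (by positivity)]; linarith [n.cast_nonneg (α := ℝ)]
    refine hz (mem_cthickening_of_dist_le z w _ _ hw ?_)
    rw [dist_eq_norm]; exact ((mem_ball_zero_iff.1 h1).le).trans h2
  have hbound : ∀ n w z, ‖kernel n (z - w) * ⟪η w, a z⟫‖ ≤
      kernel n (z - w) * |C| := by
    intro n w z
    rw [norm_mul, Real.norm_of_nonneg (kernel_nonneg _ _)]
    by_cases hw : w ∈ frontier D
    · by_cases hz : z ∈ K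
      · refine mul_le_mul_of_nonneg_left ?_ (kernel_nonneg _ _)
        calc _ ≤ ‖η w‖ * ‖a z‖ := norm_inner_le_norm _ _
          _ ≤ 1 * C := mul_le_mul (hη1 w) (hC z hz) (norm_nonneg _) zero_le_one
          _ ≤ |C| := by rw [one_mul]; exact le_abs_self C
      · rw [hker0 n w hw z hz]; simp
    · rw [hη, indicator_of_notMem hw, inner_zero_left, norm_zero, mul_zero]
      exact mul_nonneg (kernel_nonneg _ _) (abs_nonneg _)
  have hswap : ∀ n, ∫ z, fderiv ℝ (smoothIndicator n D) z (a z) =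
      -∫ w, (∫ z, kernel n (z - w) * ⟪η w, a z⟫) ∂S := by
    intro n
    have h1 : ∀ z, fderiv ℝ (smoothIndicator n D) z (a z) =
        -∫ w, kernel n (z - w) * ⟪η w, a z⟫ ∂S := fun z => by
      rw [hν.fderiv_smoothIndicator hm hD hDb]
      congr 1
      exact setIntegral_congr_fun hfm fun w hw => by simp only [hην w hw]
    simp only [h1]
    rw [integral_neg, integral_integral_swap]
    have hkc : Continuous (kernel n : E → ℝ) := (contDiff_kernel n (k := 1)).continuous
    obtain ⟨M, hM⟩ := hkc.bounded_above_of_compact_support (hasCompactSupport_kernel n)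
    have hint : Integrable (fun q : E × E => K.indicator (fun _ => M * |C|) q.1 * 1)
        ((volume : Measure E).prod S) :=
      ((integrable_indicator_iff hK.measurableSet).2
        (integrableOn_const hK.measure_lt_top.ne)).mul_prod (integrable_const (1 : ℝ))
    have hmeas : Measurable (fun q : E × E => kernel n (q.1 - q.2) * ⟪η q.2, a q.1⟫) :=
      (hkc.measurable.comp (measurable_fst.sub measurable_snd)).mul
        ((hηm.comp measurable_snd).inner (ha.measurable.comp measurable_fst))
    refine hint.mono' hmeas.aestronglyMeasurable ?_
    refine Eventually.of_forall fun q => ?_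
    simp only [Function.uncurry, mul_one]
    by_cases hz : q.1 ∈ K
    · rw [indicator_of_mem hz]
      refine (hbound n q.2 q.1).trans (mul_le_mul_of_nonneg_right ?_ (abs_nonneg _))
      exact (le_abs_self _).trans (hM _)
    · rw [indicator_of_notMem hz]
      by_cases hw : q.2 ∈ frontier D
      · rw [hker0 n _ hw _ hz]; simp
      · rw [hη, indicator_of_notMem hw]; simp
  simp only [hswap]
  refine Tendsto.neg ?_
  have hcongr : ∫ w, ⟪ν w, a w⟫ ∂S = ∫ w, ⟪η w, a w⟫ ∂S :=
    setIntegral_congr_fun hfm fun w hw => by simp only [hην w hw]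
  rw [hcongr]
  have hmol : ∀ n w, ∫ z, kernel n (z - w) * ⟪η w, a z⟫ = mollify n (fun z => ⟪η w, a z⟫) w := by
    intro n w
    rw [mollify_eq_integral]
    simp only [kernel_sub_comm n w]
  refine tendsto_integral_of_dominated_convergence (fun _ => |C|) (fun n => ?_)
    (integrable_const _) (fun n => Eventually.of_forall fun w => ?_)
    (Eventually.of_forall fun w => ?_)
  · have hkc : Continuous (kernel n : E → ℝ) := (contDiff_kernel n (k := 1)).continuous
    have hmeas : Measurable (fun q : E × E => kernel n (q.2 - q.1) * ⟪η q.1, a q.2⟫) :=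
      (hkc.measurable.comp (measurable_snd.sub measurable_fst)).mul
        ((hηm.comp measurable_fst).inner (ha.measurable.comp measurable_snd))
    exact hmeas.stronglyMeasurable.integral_prod_right'.aestronglyMeasurable
  · calc _ ≤ ∫ z, kernel n (z - w) * |C| := by
          refine norm_integral_le_of_norm_le ?_ (Eventually.of_forall fun z => hbound n w z)
          exact (((bump E n).integrable_normed (μ := volume)).comp_sub_right w).mul_const _
      _ = |C| := by
          rw [integral_mul_const, integral_sub_right_eq_self (kernel n) w, kernel,
            (bump E n).integral_normed, one_mul]
  · simp only [hmol]
    exact tendsto_mollify (continuous_const.inner ha) w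

end MollifiedIndicator

/-- Smooth cutoff between a compact set and an open neighbourhood of it. -/
theorem exists_smooth_cutoff {E : Type*} [NormedAddCommGroup E] [NormedSpace ℝ E]
    [FiniteDimensional ℝ E] {K O : Set E} (hK : IsCompact K) (hO : IsOpen O) (hKO : K ⊆ O) :
    ∃ χ : E → ℝ, ContDiff ℝ ∞ χ ∧ HasCompactSupport χ ∧ tsupport χ ⊆ O ∧
      ∃ V, IsOpen V ∧ K ⊆ V ∧ ∀ z ∈ V, χ z = 1 := by
  obtain ⟨T, hT, hKT, hTO⟩ := exists_compact_between hK hO hKO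
  obtain ⟨f, hf1, hf0, -⟩ := exists_contMDiffMap_one_nhds_of_subset_interior (n := ⊤)
    (modelWithCornersSelf ℝ E) hK.isClosed hKT
  have hsupp : tsupport (f : E → ℝ) ⊆ T :=
    closure_minimal (fun z hz => by_contra fun h => hz (hf0 z h)) hT.isClosed
  obtain ⟨V, hV, hKV, hV1⟩ := eventually_nhdsSet_iff_exists.1 hf1
  exact ⟨f, f.contMDiff.contDiff, hT.of_isClosed_subset (isClosed_tsupport _) hsupp,
    hsupp.trans hTO, V, hV, hKV, hV1⟩

/-! ### The Grushin gradient -/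

section Basics

variable {N l : ℕ}

theorem continuous_xPart : Continuous (xPart : Space N l → EuclideanSpace ℝ (Fin N)) := by
  unfold xPart; fun_prop

theorem continuous_yPart : Continuous (yPart : Space N l → EuclideanSpace ℝ (Fin l)) := by
  unfold yPart; fun_prop

theorem continuous_weight {γ : ℝ} (hγ : 0 ≤ γ) (k : Fin N ⊕ Fin l) :
    Continuous (fun z : Space N l => weight γ z k) := by
  cases k with
  | inl i => exact continuous_const
  | inr j => exact (continuous_xPart.norm).rpow_const fun _ => Or.inr hγ

theorem xPart_add_smul_inr (z : Space N l) (t : ℝ) (j : Fin l) :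
    xPart (z + t • basisVec (Sum.inr j)) = xPart z := by
  ext i; simp [xPart, basisVec]

/-- The coefficient of the Grushin field in direction `k` is constant in direction `k`. -/
theorem weight_add_smul_basisVec (γ : ℝ) (z : Space N l) (t : ℝ) (k : Fin N ⊕ Fin l) :
    weight γ (z + t • basisVec k) k = weight γ z k := by
  cases k with
  | inl i => rfl
  | inr j => simp only [weight, xPart_add_smul_inr]

theorem weight_add_smul_inr (γ : ℝ) (z : Space N l) (t : ℝ) (j : Fin l) :
    weight γ (z + t • basisVec (Sum.inr j)) = weight γ z := by
  ext k
  cases k with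
  | inl i => rfl
  | inr j => simp only [weight, xPart_add_smul_inr]

theorem scaleY_apply (γ : ℝ) (z v : Space N l) (k : Fin N ⊕ Fin l) :
    scaleY γ z v k = weight γ z k * v k := rfl

theorem scaleY_sub (γ : ℝ) (z v w : Space N l) :
    scaleY γ z (v - w) = scaleY γ z v - scaleY γ z w := by
  ext k; simp [scaleY_apply, mul_sub]

theorem inner_scaleY_comm (γ : ℝ) (z v w : Space N l) :
    ⟪scaleY γ z v, w⟫ = ⟪v, scaleY γ z w⟫ := by
  simp only [PiLp.inner_apply, scaleY_apply]
  refine Finset.sum_congr rfl fun k _ => ?_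
  simp; ring

theorem continuous_scaleY {X : Type*} [TopologicalSpace X] {γ : ℝ} (hγ : 0 ≤ γ)
    {Z V : X → Space N l} (hZ : Continuous Z) (hV : Continuous V) :
    Continuous (fun x => scaleY γ (Z x) (V x)) := by
  unfold scaleY
  refine (PiLp.continuous_toLp 2 _).comp (continuous_pi fun k => ?_)
  exact ((continuous_weight hγ k).comp hZ).mul (by fun_prop)

theorem inner_basisVec (v : Space N l) (k : Fin N ⊕ Fin l) : ⟪v, basisVec k⟫ = v k := by
  rw [basisVec, EuclideanSpace.inner_single_right]; simp

theorem norm_basisVec (k : Fin N ⊕ Fin l) : ‖(basisVec k : Space N l)‖ = 1 := by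
  simp [basisVec]

theorem partialDeriv_eq_fderiv {u : Space N l → ℝ} {z : Space N l} (hu : DifferentiableAt ℝ u z)
    (k : Fin N ⊕ Fin l) : partialDeriv k u z = fderiv ℝ u z (basisVec k) :=
  hu.lineDeriv_eq_fderiv

theorem inner_grad {u : Space N l → ℝ} {z : Space N l} (hu : DifferentiableAt ℝ u z)
    (w : Space N l) : ⟪grad u z, w⟫ = fderiv ℝ u z w := by
  have hw : w = ∑ k, w k • (basisVec k : Space N l) := by
    ext j
    cases j <;> simp [basisVec, Pi.single_apply]
  conv_rhs => rw [hw]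
  simp only [map_sum, map_smul, PiLp.inner_apply, grad, partialDeriv_eq_fderiv hu]
  simp

theorem continuous_grad {u : Space N l → ℝ} (hu : ContDiff ℝ 1 u) : Continuous (grad u) := by
  unfold grad
  refine (PiLp.continuous_toLp 2 _).comp (continuous_pi fun k => ?_)
  simp only [partialDeriv_eq_fderiv (hu.differentiable one_ne_zero _)]
  exact (hu.continuous_fderiv one_ne_zero).clm_apply continuous_const

theorem continuous_grushinGrad {γ : ℝ} (hγ : 0 ≤ γ) {u : Space N l → ℝ} (hu : ContDiff ℝ 1 u) :
    Continuous (grushinGrad γ u) :=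
  continuous_scaleY hγ continuous_id (continuous_grad hu)

theorem norm_sq_scaleY (γ : ℝ) (z v : Space N l) :
    ‖scaleY γ z v‖ ^ 2 = ‖xPart v‖ ^ 2 + ‖yPart v‖ ^ 2 * (‖xPart z‖ ^ γ) ^ 2 := by
  rw [EuclideanSpace.norm_sq_eq, EuclideanSpace.norm_sq_eq, EuclideanSpace.norm_sq_eq,
    Fintype.sum_sum_type, Finset.sum_mul]
  congr 1
  · simp [scaleY_apply, weight, xPart]
  · refine Finset.sum_congr rfl fun j _ => ?_
    simp only [scaleY_apply, weight, yPart, Real.norm_eq_abs, sq_abs]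
    ring

theorem partialDeriv_congr {u v : Space N l → ℝ} {z : Space N l} (h : u =ᶠ[𝓝 z] v)
    (k : Fin N ⊕ Fin l) : partialDeriv k u z = partialDeriv k v z :=
  h.lineDeriv_eq

theorem grad_congr {u v : Space N l → ℝ} {z : Space N l} (h : u =ᶠ[𝓝 z] v) :
    grad u z = grad v z := by
  unfold grad; simp only [partialDeriv_congr h]

theorem grushinGrad_congr {u v : Space N l → ℝ} {z : Space N l} (h : u =ᶠ[𝓝 z] v) (γ : ℝ) :
    grushinGrad γ u z = grushinGrad γ v z := by
  unfold grushinGrad; rw [grad_congr h]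

end Basics

/-! ### Convexity of powers of the norm -/

section Convexity

variable {V : Type*} [NormedAddCommGroup V] [InnerProductSpace ℝ V]

theorem continuous_norm_rpow_smul {p : ℝ} (hp : 1 < p) :
    Continuous (fun x : V => ‖x‖ ^ (p - 2) • x) := by
  refine continuous_iff_continuousAt.2 fun x => ?_
  by_cases hx : x = 0
  · subst hx
    rw [ContinuousAt, smul_zero, tendsto_zero_iff_norm_tendsto_zero]
    have h1 : ∀ y : V, ‖‖y‖ ^ (p - 2) • y‖ = ‖y‖ ^ (p - 1) := fun y => by
      rw [norm_smul, Real.norm_of_nonneg (Real.rpow_nonneg (norm_nonneg _) _)]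
      by_cases hy : y = 0
      · rw [hy, norm_zero, mul_zero, Real.zero_rpow (by linarith)]
      · have h := Real.rpow_add_one (norm_ne_zero_iff.2 hy) (p - 2)
        rw [← h]; congr 1; ring
    simp only [h1]
    have h2 : Continuous (fun y : V => ‖y‖ ^ (p - 1)) :=
      continuous_norm.rpow_const fun _ => Or.inr (by linarith)
    simpa [Real.zero_rpow (show p - 1 ≠ 0 by linarith)] using h2.tendsto 0
  · exact (continuous_norm.continuousAt.rpow_const
      (Or.inl (norm_ne_zero_iff.2 hx))).smul continuousAt_id

/-- Convexity of `x ↦ ‖x‖ ^ p / p`, in the form of the supporting hyperplane at `G`. -/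
theorem norm_rpow_mul_inner_sub_le {p : ℝ} (hp : 1 < p) (G H : V) :
    ‖G‖ ^ (p - 2) * ⟪G, H - G⟫ ≤ 1 / p * ‖H‖ ^ p - 1 / p * ‖G‖ ^ p := by
  have hp0 : 0 < p := by linarith
  by_cases hG : G = 0
  · rw [hG, inner_zero_left, mul_zero, norm_zero, Real.zero_rpow hp0.ne']
    have := Real.rpow_nonneg (norm_nonneg H) p
    have : 0 ≤ 1 / p * ‖H‖ ^ p := by positivity
    linarith
  have hG0 : 0 < ‖G‖ := norm_pos_iff.2 hG
  have h1 : ‖G‖ ^ (p - 2) * ‖G‖ = ‖G‖ ^ (p - 1) := by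
    rw [← Real.rpow_add_one hG0.ne']; congr 1; ring
  have h2 : ‖G‖ ^ (p - 1) * ‖G‖ = ‖G‖ ^ p := by
    rw [← Real.rpow_add_one hG0.ne']; congr 1; ring
  have hc : (p / (p - 1)).HolderConjugate p := (Real.HolderConjugate.conjExponent hp).symm
  have hy := Real.young_inequality_of_nonneg (a := ‖G‖ ^ (p - 1)) (b := ‖H‖)
    (Real.rpow_nonneg hG0.le _) (norm_nonneg _) hc
  have h3 : (‖G‖ ^ (p - 1)) ^ (p / (p - 1)) = ‖G‖ ^ p := by
    rw [← Real.rpow_mul hG0.le]; congr 1; field_simp [show p - 1 ≠ 0 by linarith]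
  rw [h3] at hy
  have hin : ⟪G, H⟫ ≤ ‖G‖ * ‖H‖ := real_inner_le_norm G H
  have hpow : 0 ≤ ‖G‖ ^ (p - 2) := Real.rpow_nonneg hG0.le _
  have h4 : ‖G‖ ^ (p - 2) * ⟪G, H⟫ ≤ ‖G‖ ^ (p - 1) * ‖H‖ := by
    rw [← h1, mul_assoc]; exact mul_le_mul_of_nonneg_left hin hpow
  have h5 : ‖G‖ ^ (p - 2) * ⟪G, G⟫ = ‖G‖ ^ p := by
    rw [real_inner_self_eq_norm_mul_norm, ← mul_assoc, h1, h2]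
  have h6 : ‖G‖ ^ p / (p / (p - 1)) = ‖G‖ ^ p - 1 / p * ‖G‖ ^ p := by
    field_simp
  rw [inner_sub_right, mul_sub, h5]
  have h7 : ‖H‖ ^ p / p = 1 / p * ‖H‖ ^ p := by ring
  linarith

end Convexity

/-! ### The variational identity for `C^1` solutions -/

section Variation

variable {N l : ℕ} {γ p : ℝ}

/-- The energy density `|(ξ_x, |x|^γ ξ_y)|^p / p` of the operator, at the point `z = (x, y)`. -/
noncomputable def energyDensity (γ p : ℝ) (z ξ : Space N l) : ℝ := 1 / p * ‖scaleY γ z ξ‖ ^ p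

/-- The field whose divergence is the operator: `⟪fluxField γ p v, ∇φ⟫` is
`|∇_γ v|^{p-2} ∇_γ v · ∇_γ φ`. -/
noncomputable def fluxField (γ p : ℝ) (v : Space N l → ℝ) (z : Space N l) : Space N l :=
  ‖grushinGrad γ v z‖ ^ (p - 2) • scaleY γ z (grushinGrad γ v z)

theorem continuous_energyDensity {X : Type*} [TopologicalSpace X] (hγ : 0 ≤ γ) (hp : 1 < p)
    {Z V : X → Space N l} (hZ : Continuous Z) (hV : Continuous V) :
    Continuous (fun x => energyDensity γ p (Z x) (V x)) :=
  continuous_const.mul ((continuous_scaleY hγ hZ hV).norm.rpow_const fun _ => Or.inr (by linarith))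

theorem continuous_fluxField (hγ : 0 ≤ γ) (hp : 1 < p) {v : Space N l → ℝ}
    (hv : ContDiff ℝ 1 v) : Continuous (fluxField γ p v) := by
  have h : fluxField γ p v = fun z =>
      scaleY γ z (‖grushinGrad γ v z‖ ^ (p - 2) • grushinGrad γ v z) := by
    ext z k; simp only [fluxField, scaleY_apply, PiLp.smul_apply, smul_eq_mul]; ring
  rw [h]
  exact continuous_scaleY hγ continuous_id
    ((continuous_norm_rpow_smul hp).comp (continuous_grushinGrad hγ hv))

theorem inner_fluxField (γ p : ℝ) (v : Space N l → ℝ) (z ξ : Space N l) :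
    ⟪ξ, fluxField γ p v z⟫ =
      ‖grushinGrad γ v z‖ ^ (p - 2) * ⟪grushinGrad γ v z, scaleY γ z ξ⟫ := by
  rw [fluxField, real_inner_smul_right, ← inner_scaleY_comm, real_inner_comm]

/-- Difference of the energy density along two gradients at the same point, bounded below by the
flux. -/
theorem inner_fluxField_sub_le (hp : 1 < p) (γ : ℝ) (v : Space N l → ℝ) (z ξ : Space N l) :
    ⟪ξ - grad v z, fluxField γ p v z⟫ ≤
      energyDensity γ p z ξ - energyDensity γ p z (grad v z) := by
  rw [inner_fluxField, scaleY_sub]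
  exact norm_rpow_mul_inner_sub_le hp (grushinGrad γ v z) (scaleY γ z ξ)

/-- The difference quotients of the energy along a translation of the gradient. Moving the
translation onto the test function leaves the explicit dependence of the energy density on the
point, whose contribution is the hypothesis `hΛ`. -/
theorem tendsto_energy_quotient (hγ : 0 ≤ γ) (hp : 1 < p) {v η : Space N l → ℝ}
    (hv : ContDiff ℝ 1 v) (hη : ContDiff ℝ 1 η) (hηc : HasCompactSupport η) (d : Space N l) {c : ℝ}
    (hΛ : Tendsto (fun h : ℝ => ∫ z, η (z - h • d) *
      (h⁻¹ * (energyDensity γ p (z - h • d) (grad v z) - energyDensity γ p z (grad v z))))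
      (𝓝[>] 0) (𝓝 (-c))) :
    Tendsto (fun h : ℝ => ∫ z, η z *
      (h⁻¹ * (energyDensity γ p z (grad v (z + h • d)) - energyDensity γ p z (grad v z))))
      (𝓝[>] 0) (𝓝 (-(∫ z, fderiv ℝ η z d * energyDensity γ p z (grad v z)) - c)) := by
  have hg := continuous_grad hv
  have hL : Continuous (fun z => energyDensity γ p z (grad v z)) :=
    continuous_energyDensity hγ hp continuous_id hg
  obtain ⟨C, hC⟩ := hη.lipschitzWith_of_hasCompactSupport hηc (by norm_num)
  have h1 := hC.integral_inv_smul_sub_mul_tendsto_integral_lineDeriv_mul' (μ := volume) hηc hL (-d)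
  have h2 : ∫ z, lineDeriv ℝ η z (-d) * energyDensity γ p z (grad v z) =
      -∫ z, fderiv ℝ η z d * energyDensity γ p z (grad v z) := by
    rw [← integral_neg]
    congr 1; ext z
    rw [(hη.differentiable one_ne_zero z).lineDeriv_eq_fderiv, map_neg]; ring
  rw [h2] at h1
  have h3 := h1.add hΛ
  rw [← sub_eq_add_neg] at h3
  refine h3.congr fun h => ?_
  have hshift : Continuous (fun z : Space N l => z - h • d) := by fun_prop
  have hshift' : Continuous (fun z : Space N l => z + h • d) := by fun_prop
  have hηs : HasCompactSupport (fun z => η (z - h • d)) :=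
    hηc.comp_homeomorph (Homeomorph.subRight (h • d))
  have hLs : Continuous (fun z => energyDensity γ p (z - h • d) (grad v z)) :=
    continuous_energyDensity hγ hp hshift hg
  have hLg : Continuous (fun z => energyDensity γ p z (grad v (z + h • d))) :=
    continuous_energyDensity hγ hp continuous_id (hg.comp hshift')
  have hcs : Continuous (fun z => η (z - h • d)) := hη.continuous.comp hshift
  have i1 : Integrable (fun z => η (z - h • d) * energyDensity γ p z (grad v z)) :=
    (hcs.mul hL).integrable_of_hasCompactSupport hηs.mul_right
  have i2 : Integrable (fun z => η z * energyDensity γ p z (grad v z)) :=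
    (hη.continuous.mul hL).integrable_of_hasCompactSupport hηc.mul_right
  have i3 : Integrable (fun z => η (z - h • d) * energyDensity γ p (z - h • d) (grad v z)) :=
    (hcs.mul hLs).integrable_of_hasCompactSupport hηs.mul_right
  have i4 : Integrable (fun z => η z * energyDensity γ p z (grad v (z + h • d))) :=
    (hη.continuous.mul hLg).integrable_of_hasCompactSupport hηc.mul_right
  have e4 : ∫ z, η z * energyDensity γ p z (grad v (z + h • d)) =
      ∫ z, η (z - h • d) * energyDensity γ p (z - h • d) (grad v z) := by
    rw [← integral_add_right_eq_self
      (fun z => η (z - h • d) * energyDensity γ p (z - h • d) (grad v z)) (h • d)]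
    simp
  have l1 : ∫ z, h⁻¹ • (η (z + h • -d) - η z) * energyDensity γ p z (grad v z) =
      h⁻¹ * ((∫ z, η (z - h • d) * energyDensity γ p z (grad v z)) -
        ∫ z, η z * energyDensity γ p z (grad v z)) := by
    rw [← integral_sub i1 i2, ← integral_const_mul]
    congr 1; ext z; rw [smul_neg, ← sub_eq_add_neg, smul_eq_mul]; ring
  have l2 : ∫ z, η (z - h • d) * (h⁻¹ * (energyDensity γ p (z - h • d) (grad v z) -
        energyDensity γ p z (grad v z))) =
      h⁻¹ * ((∫ z, η (z - h • d) * energyDensity γ p (z - h • d) (grad v z)) -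
        ∫ z, η (z - h • d) * energyDensity γ p z (grad v z)) := by
    rw [← integral_sub i3 i1, ← integral_const_mul]
    congr 1; ext z; ring
  have l3 : ∫ z, η z * (h⁻¹ * (energyDensity γ p z (grad v (z + h • d)) -
        energyDensity γ p z (grad v z))) =
      h⁻¹ * ((∫ z, η z * energyDensity γ p z (grad v (z + h • d))) -
        ∫ z, η z * energyDensity γ p z (grad v z)) := by
    rw [← integral_sub i4 i2, ← integral_const_mul]
    congr 1; ext z; ring
  rw [l1, l2, l3, e4]; ring

/-- Half of the variational identity. Testing the equation with `η` times the difference quotient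
of `v` in the direction `d` and comparing energies by convexity gives one inequality, with no
second derivative of `v`. -/
theorem variational_inequality (hγ : 0 ≤ γ) (hp : 1 < p) {O : Set (Space N l)}
    {v b η : Space N l → ℝ} (hv : ContDiff ℝ 1 v) (hvc : HasCompactSupport v) (hb : Continuous b)
    (hpde : ∀ φ : Space N l → ℝ, ContDiff ℝ 1 φ → HasCompactSupport φ → tsupport φ ⊆ O →
      ∫ z, fderiv ℝ φ z (fluxField γ p v z) = ∫ z, b z * φ z)
    (hη : ContDiff ℝ 1 η) (hηc : HasCompactSupport η) (hη0 : ∀ z, 0 ≤ η z) (hηO : tsupport η ⊆ O)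
    (d : Space N l) {c : ℝ}
    (hΛ : Tendsto (fun h : ℝ => ∫ z, η (z - h • d) *
      (h⁻¹ * (energyDensity γ p (z - h • d) (grad v z) - energyDensity γ p z (grad v z))))
      (𝓝[>] 0) (𝓝 (-c))) :
    (∫ z, fderiv ℝ v z d * (b z * η z)) -
        ∫ z, fderiv ℝ v z d * fderiv ℝ η z (fluxField γ p v z) ≤
      -(∫ z, fderiv ℝ η z d * energyDensity γ p z (grad v z)) - c := by
  have hA := continuous_fluxField hγ hp hv
  have hg := continuous_grad hv
  have hdv : Differentiable ℝ v := hv.differentiable one_ne_zero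
  have hdη : Differentiable ℝ η := hη.differentiable one_ne_zero
  obtain ⟨C, hC⟩ := hv.lipschitzWith_of_hasCompactSupport hvc (by norm_num)
  have hbη : Continuous (fun z => b z * η z) := hb.mul hη.continuous
  have hηA : Continuous (fun z => fderiv ℝ η z (fluxField γ p v z)) :=
    (hη.continuous_fderiv one_ne_zero).clm_apply hA
  have hηAc : HasCompactSupport (fun z => fderiv ℝ η z (fluxField γ p v z)) := by
    refine (hηc.fderiv ℝ).mono' ((Function.support_subset_iff'.2 fun z hz => ?_).trans
      (subset_tsupport _))
    rw [Function.notMem_support.1 hz]; rfl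
  have ibη : Integrable (fun z => b z * η z) :=
    hbη.integrable_of_hasCompactSupport hηc.mul_left
  have iηA := hηA.integrable_of_hasCompactSupport (μ := volume) hηAc
  have t1 := hC.integral_inv_smul_sub_mul_tendsto_integral_lineDeriv_mul (μ := volume) ibη d
  have t2 := hC.integral_inv_smul_sub_mul_tendsto_integral_lineDeriv_mul (μ := volume) iηA d
  have t3 := tendsto_energy_quotient hγ hp hv hη hηc d hΛ
  simp only [(hdv _).lineDeriv_eq_fderiv] at t1 t2
  refine le_of_tendsto_of_tendsto (t1.sub t2) t3 ?_
  filter_upwards [self_mem_nhdsWithin] with h hh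
  have hh : 0 < h := hh
  have hshift : Continuous (fun z : Space N l => z + h • d) := by fun_prop
  -- the test function
  set Q : Space N l → ℝ := fun z => h⁻¹ * (v (z + h • d) - v z) with hQ
  have hQd : ContDiff ℝ 1 Q :=
    contDiff_const.mul ((hv.comp (contDiff_id.add contDiff_const)).sub hv)
  have hQf : ∀ z w, fderiv ℝ Q z w = h⁻¹ * ⟪grad v (z + h • d) - grad v z, w⟫ := by
    intro z w
    have h1 : HasFDerivAt (fun z => v (z + h • d)) (fderiv ℝ v (z + h • d)) z :=
      (hasFDerivAt_comp_add_right _).2 (hdv (z + h • d)).hasFDerivAt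
    have h2 := (h1.sub (hdv z).hasFDerivAt).const_mul h⁻¹
    rw [show fderiv ℝ Q z = _ from h2.fderiv, inner_sub_left, inner_grad (hdv _),
      inner_grad (hdv _)]
    rfl
  have hφ := hpde (fun z => η z * Q z) (hη.mul hQd) hηc.mul_right
    ((tsupport_mul_subset_left).trans hηO)
  have hleib : ∀ z w, fderiv ℝ (fun z => η z * Q z) z w =
      η z * fderiv ℝ Q z w + Q z * fderiv ℝ η z w := by
    intro z w
    rw [fderiv_fun_mul (hdη z) (hQd.differentiable one_ne_zero z)]
    simp
  have hgd : Continuous (fun z => ⟪grad v (z + h • d) - grad v z, fluxField γ p v z⟫) :=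
    ((hg.comp hshift).sub hg).inner hA
  have i1 : Integrable (fun z => η z * (h⁻¹ *
      ⟪grad v (z + h • d) - grad v z, fluxField γ p v z⟫)) :=
    (hη.continuous.mul (continuous_const.mul hgd)).integrable_of_hasCompactSupport hηc.mul_right
  have i2 : Integrable (fun z => Q z * fderiv ℝ η z (fluxField γ p v z)) :=
    (hQd.continuous.mul hηA).integrable_of_hasCompactSupport hηAc.mul_left
  have i3 : Integrable (fun z => η z * (h⁻¹ * (energyDensity γ p z (grad v (z + h • d)) -
      energyDensity γ p z (grad v z)))) := by
    refine Continuous.integrable_of_hasCompactSupport ?_ hηc.mul_right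
    exact hη.continuous.mul (continuous_const.mul
      ((continuous_energyDensity hγ hp continuous_id (hg.comp hshift)).sub
        (continuous_energyDensity hγ hp continuous_id hg)))
  simp only [hleib, hQf] at hφ
  rw [integral_add i1 i2] at hφ
  have e1 : ∫ z, h⁻¹ • (v (z + h • d) - v z) * (b z * η z) = ∫ z, b z * (η z * Q z) := by
    congr 1; ext z; simp only [smul_eq_mul, hQ]; ring
  have e2 : ∫ z, h⁻¹ • (v (z + h • d) - v z) * fderiv ℝ η z (fluxField γ p v z) =
      ∫ z, Q z * fderiv ℝ η z (fluxField γ p v z) := rfl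
  have hle : ∫ z, η z * (h⁻¹ * ⟪grad v (z + h • d) - grad v z, fluxField γ p v z⟫) ≤
      ∫ z, η z * (h⁻¹ * (energyDensity γ p z (grad v (z + h • d)) -
        energyDensity γ p z (grad v z))) :=
    integral_mono i1 i3 fun z => mul_le_mul_of_nonneg_left (mul_le_mul_of_nonneg_left
      (inner_fluxField_sub_le hp γ v z _) (inv_nonneg.2 hh.le)) (hη0 z)
  rw [e1, e2]
  linarith

/-- The variational identity in the direction `d`: the two opposite directions give opposite
inequalities. -/
theorem variational_identity (hγ : 0 ≤ γ) (hp : 1 < p) {O : Set (Space N l)}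
    {v b η : Space N l → ℝ} (hv : ContDiff ℝ 1 v) (hvc : HasCompactSupport v) (hb : Continuous b)
    (hpde : ∀ φ : Space N l → ℝ, ContDiff ℝ 1 φ → HasCompactSupport φ → tsupport φ ⊆ O →
      ∫ z, fderiv ℝ φ z (fluxField γ p v z) = ∫ z, b z * φ z)
    (hη : ContDiff ℝ 1 η) (hηc : HasCompactSupport η) (hη0 : ∀ z, 0 ≤ η z) (hηO : tsupport η ⊆ O)
    (d : Space N l) {c : ℝ}
    (hΛ : ∀ s : ℝ, |s| = 1 → Tendsto (fun h : ℝ => ∫ z, η (z - h • s • d) *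
      (h⁻¹ * (energyDensity γ p (z - h • s • d) (grad v z) - energyDensity γ p z (grad v z))))
      (𝓝[>] 0) (𝓝 (-(s * c)))) :
    (∫ z, fderiv ℝ v z d * (b z * η z)) -
        ∫ z, fderiv ℝ v z d * fderiv ℝ η z (fluxField γ p v z) =
      -(∫ z, fderiv ℝ η z d * energyDensity γ p z (grad v z)) - c := by
  have h1 := variational_inequality hγ hp hv hvc hb hpde hη hηc hη0 hηO _ (hΛ 1 (by simp))
  have h2 := variational_inequality hγ hp hv hvc hb hpde hη hηc hη0 hηO _ (hΛ (-1) (by simp))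
  simp only [one_smul, neg_smul, map_neg, neg_mul, one_mul, integral_neg] at h1 h2
  linarith

/-- In a direction `y_j` the energy density has no explicit dependence on the point. -/
theorem energyDensity_sub_smul_inr (γ p : ℝ) (z ξ : Space N l) (t : ℝ) (j : Fin l) :
    energyDensity γ p (z - t • basisVec (Sum.inr j)) ξ = energyDensity γ p z ξ := by
  have : scaleY γ (z - t • basisVec (Sum.inr j)) ξ = scaleY γ z ξ := by
    unfold scaleY; rw [sub_eq_add_neg, ← neg_smul, weight_add_smul_inr]
  rw [energyDensity, this, energyDensity]

end Variation

/-! ### The energy density as a function of `|x|` -/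

section Profile

/-- Increments of a power `α ∈ (0, 1]`, with the singular factor taken at the one point `r`. -/
theorem abs_rpow_sub_rpow_le {α r r' : ℝ} (hα0 : 0 < α) (hα1 : α ≤ 1) (hr : 0 < r) (hr' : 0 ≤ r') :
    |r ^ α - r' ^ α| ≤ |r - r'| * r ^ (α - 1) := by
  have h1 : ∀ s : ℝ, 0 < s → s ^ α = s * s ^ (α - 1) := fun s hs => by
    rw [mul_comm, ← Real.rpow_add_one hs.ne']; congr 1; ring
  rcases le_total r' r with h | h
  · rw [abs_of_nonneg (sub_nonneg.2 (Real.rpow_le_rpow hr' h hα0.le)),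
      abs_of_nonneg (sub_nonneg.2 h), h1 r hr, sub_mul]
    refine sub_le_sub_left ?_ _
    rcases hr'.eq_or_lt with h0 | h0
    · rw [← h0, zero_mul]; exact Real.rpow_nonneg le_rfl _
    · rw [h1 r' h0]
      exact mul_le_mul_of_nonneg_left (Real.rpow_le_rpow_of_nonpos h0 h (by linarith)) hr'
  · have h0 : 0 < r' := hr.trans_le h
    rw [abs_sub_comm, abs_of_nonneg (sub_nonneg.2 (Real.rpow_le_rpow hr.le h hα0.le)),
      abs_sub_comm, abs_of_nonneg (sub_nonneg.2 h), h1 r hr, h1 r' h0, sub_mul]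
    refine sub_le_sub_right ?_ _
    exact mul_le_mul_of_nonneg_left (Real.rpow_le_rpow_of_nonpos hr h (by linarith)) hr'

/-- The energy density as a function of `r = |x|`, with `A = |ξ_x|^2` and `B = |ξ_y|^2`. -/
noncomputable def profile (γ p A B r : ℝ) : ℝ := 1 / p * (A + B * (r ^ γ) ^ 2) ^ (p / 2)

variable {γ p : ℝ}

theorem profile_hasDerivAt (hp : 1 < p) {A B r : ℝ} (hA : 0 ≤ A) (hB : 0 < B) (hr : 0 < r) :
    HasDerivAt (profile γ p A B)
      ((A + B * (r ^ γ) ^ 2) ^ (p / 2 - 1) * (γ * B * r ^ (2 * γ - 1))) r := by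
  have h1 : HasDerivAt (fun s : ℝ => s ^ γ) (γ * r ^ (γ - 1)) r :=
    Real.hasDerivAt_rpow_const (Or.inl hr.ne')
  have h2 : HasDerivAt (fun s : ℝ => A + B * (s ^ γ) ^ 2)
      (B * (2 * r ^ γ * (γ * r ^ (γ - 1)))) r := by
    simpa using ((h1.pow 2).const_mul B).const_add A
  have hpos : 0 < A + B * (r ^ γ) ^ 2 := by positivity
  have h3 := (h2.rpow_const (p := p / 2) (Or.inl hpos.ne')).const_mul (1 / p)
  refine h3.congr_deriv ?_
  have h4 : r ^ (2 * γ - 1) = r ^ γ * r ^ (γ - 1) := by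
    rw [← Real.rpow_add hr]; congr 1; ring
  rw [h4]
  field_simp

theorem profile_continuous (hγ : 0 ≤ γ) (hp : 1 < p) (A B : ℝ) :
    Continuous (profile γ p A B) := by
  refine continuous_const.mul (Continuous.rpow_const ?_ fun _ => Or.inr (by linarith))
  exact continuous_const.add (continuous_const.mul
    ((continuous_id.rpow_const fun _ => Or.inr hγ).pow 2))

/-- The derivative of the profile is at most a multiple of `r ^ (α - 1)`, uniformly in bounded `A`
and `B`. For `p ≤ 2` the power `p / 2 - 1` is not positive and the worst case is `A = 0`, with
`α = min (γ p) 1`; for `p ≥ 2` that power is bounded and `α = min (2 γ) 1`. -/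
theorem exists_profile_deriv_le (hγ : 0 < γ) (hp : 1 < p) {M R : ℝ} (hM : 0 ≤ M) (hR : 0 ≤ R) :
    ∃ C ≥ (0 : ℝ), ∃ α : ℝ, 0 < α ∧ α ≤ 1 ∧ ∀ A B r, 0 ≤ A → A ≤ M →
      0 < B → B ≤ M → 0 < r → r ≤ R →
      (A + B * (r ^ γ) ^ 2) ^ (p / 2 - 1) * (γ * B * r ^ (2 * γ - 1)) ≤ C * r ^ (α - 1) := by
  have hp0 : 0 < p := by linarith
  rcases le_total p 2 with h2 | h2
  · refine ⟨γ * M ^ (p / 2) * R ^ (γ * p - min (γ * p) (1 : ℝ)), by positivity, min (γ * p) (1 : ℝ),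
      by positivity, min_le_right _ _, fun A B r hA hAM hB hBM hr hrR => ?_⟩
    have hBr : 0 < B * (r ^ γ) ^ 2 := by positivity
    have hr2 : (r ^ γ) ^ 2 = r ^ (2 * γ) := by
      rw [← Real.rpow_natCast, ← Real.rpow_mul hr.le]; congr 1; push_cast; ring
    calc _ ≤ (B * (r ^ γ) ^ 2) ^ (p / 2 - 1) * (γ * B * r ^ (2 * γ - 1)) := by
          refine mul_le_mul_of_nonneg_right ?_ (by positivity)
          exact Real.rpow_le_rpow_of_nonpos hBr (by linarith) (by linarith)
      _ = γ * B ^ (p / 2) *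
          (r ^ (γ * p - min (γ * p) (1 : ℝ)) * r ^ (min (γ * p) (1 : ℝ) - 1)) := by
          rw [hr2, Real.mul_rpow hB.le (by positivity), ← Real.rpow_mul hr.le,
            ← Real.rpow_add hr]
          have e1 : B ^ (p / 2) = B ^ (p / 2 - 1) * B := by
            rw [← Real.rpow_add_one hB.ne']; congr 1; ring
          have e2 : r ^ (γ * p - min (γ * p) (1 : ℝ) + (min (γ * p) (1 : ℝ) - 1)) =
              r ^ (2 * γ * (p / 2 - 1)) * r ^ (2 * γ - 1) := by
            rw [← Real.rpow_add hr]; congr 1; ring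
          rw [e1, e2]; ring
      _ ≤ γ * M ^ (p / 2) *
          (R ^ (γ * p - min (γ * p) (1 : ℝ)) * r ^ (min (γ * p) (1 : ℝ) - 1)) := by
          have := min_le_left (γ * p) (1 : ℝ)
          gcongr
      _ = _ := by ring
  · refine ⟨(M + M * (R ^ γ) ^ 2) ^ (p / 2 - 1) * (γ * M * R ^ (2 * γ - min (2 * γ) (1 : ℝ))),
      by positivity, min (2 * γ) (1 : ℝ), by positivity, min_le_right _ _,
      fun A B r hA hAM hB hBM hr hrR => ?_⟩
    have e2 : r ^ (2 * γ - 1) =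
        r ^ (2 * γ - min (2 * γ) (1 : ℝ)) * r ^ (min (2 * γ) (1 : ℝ) - 1) := by
      rw [← Real.rpow_add hr]; congr 1; ring
    have := min_le_left (2 * γ) (1 : ℝ)
    calc _ = (A + B * (r ^ γ) ^ 2) ^ (p / 2 - 1) *
          (γ * B * r ^ (2 * γ - min (2 * γ) (1 : ℝ))) * r ^ (min (2 * γ) (1 : ℝ) - 1) := by
          rw [e2]; ring
      _ ≤ _ := by
          refine mul_le_mul_of_nonneg_right ?_ (by positivity)
          refine mul_le_mul ?_ ?_ (by positivity) (by positivity)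
          · refine Real.rpow_le_rpow (by positivity) ?_ (by linarith)
            gcongr
          · gcongr

/-- The profile has increments controlled by the integrable singularity `r ^ (α - 1)`. -/
theorem exists_profile_increment_le (hγ : 0 ≤ γ) (hp : 1 < p) {M R : ℝ} (hM : 0 ≤ M)
    (hR : 0 ≤ R) :
    ∃ C ≥ (0 : ℝ), ∃ α : ℝ, 0 < α ∧ α ≤ 1 ∧ ∀ A B r r', 0 ≤ A → A ≤ M →
      0 ≤ B → B ≤ M → 0 < r → r ≤ R → 0 ≤ r' → r' ≤ R →
      |profile γ p A B r - profile γ p A B r'| ≤ C * (|r - r'| * r ^ (α - 1)) := by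
  rcases hγ.eq_or_lt with h0 | hγ
  · refine ⟨0, le_rfl, 1, one_pos, le_rfl, fun A B r r' _ _ _ _ _ _ _ _ => ?_⟩
    simp [profile, ← h0]
  obtain ⟨C, hC, α, hα0, hα1, hder⟩ := exists_profile_deriv_le hγ hp hM hR
  refine ⟨C / α, by positivity, α, hα0, hα1, fun A B r r' hA hAM hB hBM hr hrR hr' hrR' => ?_⟩
  rcases hB.eq_or_lt with hB0 | hB0
  · simp only [profile, ← hB0, zero_mul, sub_self, abs_zero]; positivity
  have hpr := profile_continuous hγ.le hp A B
  -- the profile and `C / α * s ^ α` minus the profile are both monotone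
  have hpow : Continuous (fun s : ℝ => s ^ α) := Real.continuous_rpow_const hα0.le
  have hint : interior (Icc 0 R) = Ioo 0 R := interior_Icc
  have hd1 : ∀ s ∈ Ioo 0 R, HasDerivAt (profile γ p A B) _ s := fun s hs =>
    profile_hasDerivAt hp hA hB0 hs.1
  have hmono1 : MonotoneOn (profile γ p A B) (Icc 0 R) := by
    refine monotoneOn_of_deriv_nonneg (convex_Icc 0 R) hpr.continuousOn ?_ ?_
    · rw [hint]; exact fun s hs => (hd1 s hs).differentiableAt.differentiableWithinAt
    · rw [hint]; intro s hs
      rw [(hd1 s hs).deriv]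
      have := hs.1
      positivity
  have hd2 : ∀ s ∈ Ioo 0 R, HasDerivAt (fun s => C / α * s ^ α - profile γ p A B s)
      (C / α * (α * s ^ (α - 1)) - (A + B * (s ^ γ) ^ 2) ^ (p / 2 - 1) *
        (γ * B * s ^ (2 * γ - 1))) s := fun s hs =>
    ((Real.hasDerivAt_rpow_const (Or.inl hs.1.ne')).const_mul _).sub (hd1 s hs)
  have hmono2 : MonotoneOn (fun s => C / α * s ^ α - profile γ p A B s) (Icc 0 R) := by
    refine monotoneOn_of_deriv_nonneg (convex_Icc 0 R)
      ((continuous_const.mul hpow).sub hpr).continuousOn ?_ ?_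
    · rw [hint]; exact fun s hs => (hd2 s hs).differentiableAt.differentiableWithinAt
    · rw [hint]; intro s hs
      rw [(hd2 s hs).deriv, ← mul_assoc, div_mul_cancel₀ _ hα0.ne', sub_nonneg]
      exact hder A B s hA hAM hB0 hBM hs.1 hs.2.le
  have hkey : |profile γ p A B r - profile γ p A B r'| ≤ C / α * |r ^ α - r' ^ α| := by
    have hCα : 0 ≤ C / α := by positivity
    rcases le_total r r' with h | h
    · have h1 := hmono1 ⟨hr.le, hrR⟩ ⟨hr', hrR'⟩ h
      have h2 := hmono2 ⟨hr.le, hrR⟩ ⟨hr', hrR'⟩ h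
      simp only at h2
      rw [abs_sub_comm, abs_of_nonneg (by linarith), abs_sub_comm,
        abs_of_nonneg (sub_nonneg.2 (Real.rpow_le_rpow hr.le h hα0.le))]
      linarith
    · have h1 := hmono1 ⟨hr', hrR'⟩ ⟨hr.le, hrR⟩ h
      have h2 := hmono2 ⟨hr', hrR'⟩ ⟨hr.le, hrR⟩ h
      simp only at h2
      rw [abs_of_nonneg (by linarith),
        abs_of_nonneg (sub_nonneg.2 (Real.rpow_le_rpow hr' h hα0.le))]
      linarith
  exact hkey.trans (mul_le_mul_of_nonneg_left (abs_rpow_sub_rpow_le hα0 hα1 hr hr')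
    (by positivity))

end Profile

/-! ### Integrability of powers of a coordinate -/

section Integrability

theorem integrableOn_abs_rpow {β R : ℝ} (hβ : -1 < β) (hR : 0 ≤ R) :
    IntegrableOn (fun t : ℝ => |t| ^ β) (Icc (-R) R) := by
  have h1 : IntegrableOn (fun t : ℝ => |t| ^ β) (Ioc 0 R) := by
    have := (intervalIntegrable_iff_integrableOn_Ioc_of_le hR).1
      (intervalIntegral.intervalIntegrable_rpow' (a := 0) (b := R) hβ)
    exact this.congr_fun (fun t ht => by simp only [abs_of_pos ht.1]) measurableSet_Ioc
  have h2 : IntegrableOn (fun t : ℝ => |t| ^ β) (Ico (-R) 0) := by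
    have h3 := (Measure.measurePreserving_neg (volume : Measure ℝ)).integrableOn_comp_preimage
      (Homeomorph.neg ℝ).measurableEmbedding (f := fun t : ℝ => |t| ^ β) (s := Ioc 0 R)
    have h4 := h3.2 h1
    simpa [Function.comp_def] using h4
  have h3 : IntegrableOn (fun t : ℝ => |t| ^ β) {0} := by simp
  have h5 : Icc (-R) R = (Ico (-R) 0 ∪ {0}) ∪ Ioc 0 R := by
    ext t
    simp only [mem_Icc, mem_union, mem_Ico, mem_singleton_iff, mem_Ioc]
    constructor
    · rintro ⟨ha, hb⟩
      rcases lt_trichotomy t 0 with h | h | h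
      · exact Or.inl (Or.inl ⟨ha, h⟩)
      · exact Or.inl (Or.inr h)
      · exact Or.inr ⟨h, hb⟩
    · rintro ((⟨ha, hb⟩ | h) | ⟨ha, hb⟩) <;> constructor <;> linarith
  rw [h5]
  exact (h2.union h3).union h1

variable {ι : Type*} [Fintype ι]

/-- A power of one coordinate with exponent greater than `-1` is integrable on bounded sets. -/
theorem integrableOn_abs_coord_rpow {β : ℝ} (hβ : -1 < β) (k : ι) {R : ℝ} (hR : 0 ≤ R) :
    IntegrableOn (fun z : EuclideanSpace ℝ ι => |z k| ^ β) (closedBall 0 R) := by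
  classical
  let g : ι → ℝ → ℝ := fun j => (Icc (-R) R).indicator
    (if j = k then fun t => |t| ^ β else fun _ => 1)
  have hg : ∀ j, Integrable (g j) := fun j => by
    refine (integrable_indicator_iff measurableSet_Icc).2 ?_
    by_cases hj : j = k
    · simpa [hj] using integrableOn_abs_rpow hβ hR
    · simp [hj]
  have h1 : Integrable (fun x : ι → ℝ => ∏ j, g j (x j)) := Integrable.fintype_prod hg
  have h2 := (PiLp.volume_preserving_ofLp ι).integrable_comp_of_integrable h1
  refine h2.integrableOn.congr_fun (fun z hz => ?_) measurableSet_closedBall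
  have hz' : ∀ j, z j ∈ Icc (-R) R := fun j => by
    have h := (PiLp.norm_apply_le z j).trans (mem_closedBall_zero_iff.1 hz)
    exact abs_le.1 h
  simp only [Function.comp, g]
  rw [Finset.prod_eq_single k]
  · simp [indicator_of_mem (hz' k)]
  · intro j _ hj
    simp [indicator_of_mem (hz' j), hj]
  · simp

theorem ae_coord_ne_zero (k : ι) : ∀ᵐ z : EuclideanSpace ℝ ι, z k ≠ 0 := by
  classical
  let S : Submodule ℝ (EuclideanSpace ℝ ι) :=
    LinearMap.ker (EuclideanSpace.proj k : EuclideanSpace ℝ ι →L[ℝ] ℝ).toLinearMap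
  have hS : S ≠ ⊤ := by
    intro h
    have h1 : EuclideanSpace.single k (1 : ℝ) ∈ S := h ▸ Submodule.mem_top
    have h2 : (EuclideanSpace.single k (1 : ℝ) : EuclideanSpace ℝ ι) k = 0 := h1
    simp at h2
  have h := Measure.addHaar_submodule (volume : Measure (EuclideanSpace ℝ ι)) S hS
  filter_upwards [compl_mem_ae_iff.2 h] with z hz h0 using hz h0

end Integrability

/-! ### Dependence of the energy density on the point -/

section ExplicitDependence

variable {N l : ℕ} {γ p : ℝ}

/-- The derivative in `x_i` of the energy density with `ξ` fixed. Its value where `x = 0`, a null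
set, is immaterial. -/
noncomputable def energyDeriv (γ p : ℝ) (i : Fin N) (z ξ : Space N l) : ℝ :=
  ‖scaleY γ z ξ‖ ^ (p - 2) * γ * ‖xPart z‖ ^ (2 * (γ - 1)) * z (Sum.inl i) * ‖yPart ξ‖ ^ 2

theorem energyDensity_eq_profile (γ p : ℝ) (z ξ : Space N l) :
    energyDensity γ p z ξ = profile γ p (‖xPart ξ‖ ^ 2) (‖yPart ξ‖ ^ 2) ‖xPart z‖ := by
  rw [energyDensity, profile, ← norm_sq_scaleY, ← Real.rpow_natCast,
    ← Real.rpow_mul (norm_nonneg _)]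
  congr 2; push_cast; ring

theorem abs_apply_le_norm_xPart (z : Space N l) (i : Fin N) : |z (Sum.inl i)| ≤ ‖xPart z‖ :=
  PiLp.norm_apply_le (xPart z) i

theorem norm_xPart_le (z : Space N l) : ‖xPart z‖ ≤ ‖z‖ := by
  refine abs_le_of_sq_le_sq' ?_ (norm_nonneg _) |>.2
  rw [EuclideanSpace.norm_sq_eq, EuclideanSpace.norm_sq_eq, Fintype.sum_sum_type]
  exact le_add_of_nonneg_right (Finset.sum_nonneg fun _ _ => sq_nonneg _)

theorem norm_yPart_le (z : Space N l) : ‖yPart z‖ ≤ ‖z‖ := by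
  refine abs_le_of_sq_le_sq' ?_ (norm_nonneg _) |>.2
  rw [EuclideanSpace.norm_sq_eq, EuclideanSpace.norm_sq_eq, Fintype.sum_sum_type]
  exact le_add_of_nonneg_left (Finset.sum_nonneg fun _ _ => sq_nonneg _)

theorem hasDerivAt_norm_xPart {z : Space N l} {i : Fin N} (hz : 0 < ‖xPart z‖) :
    HasDerivAt (fun t : ℝ => ‖xPart (z + t • basisVec (Sum.inl i))‖)
      (z (Sum.inl i) / ‖xPart z‖) 0 := by
  have h1 : ∀ t : ℝ, xPart (z + t • basisVec (Sum.inl i)) =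
      xPart z + t • EuclideanSpace.single i (1 : ℝ) := fun t => by
    ext j; simp [xPart, basisVec]
  have h2 : HasDerivAt (fun t : ℝ => xPart z + t • EuclideanSpace.single i (1 : ℝ))
      (EuclideanSpace.single i (1 : ℝ)) 0 := by
    simpa using ((hasDerivAt_id (0 : ℝ)).smul_const
      (EuclideanSpace.single i (1 : ℝ))).const_add (xPart z)
  have h3 := h2.norm_sq.sqrt (by simpa using hz.ne')
  simp only [Real.sqrt_sq (norm_nonneg _), zero_smul, add_zero] at h3
  simp only [h1]
  refine h3.congr_deriv ?_
  rw [EuclideanSpace.inner_single_right]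
  simp [xPart]
  field_simp

theorem hasDerivAt_energyDensity (hp : 1 < p) {z : Space N l} (ξ : Space N l) {i : Fin N}
    (hz : z (Sum.inl i) ≠ 0) :
    HasDerivAt (fun t : ℝ => energyDensity γ p (z + t • basisVec (Sum.inl i)) ξ)
      (energyDeriv γ p i z ξ) 0 := by
  have hr : 0 < ‖xPart z‖ := (abs_pos.2 hz).trans_le (abs_apply_le_norm_xPart z i)
  simp only [energyDensity_eq_profile]
  rcases (sq_nonneg ‖yPart ξ‖).eq_or_lt with hB | hB
  · rw [energyDeriv]
    simp only [← hB, profile, zero_mul, mul_zero]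
    exact hasDerivAt_const _ _
  have h1 := profile_hasDerivAt (γ := γ) hp (sq_nonneg ‖xPart ξ‖) hB hr
  have h2 := hasDerivAt_norm_xPart (i := i) hr
  have h3 := HasDerivAt.comp (0 : ℝ) (h₂ := profile γ p (‖xPart ξ‖ ^ 2) (‖yPart ξ‖ ^ 2))
    (by simpa using h1) h2
  refine h3.congr_deriv ?_
  have e1 : ‖scaleY γ z ξ‖ ^ (p - 2) = (‖scaleY γ z ξ‖ ^ 2) ^ (p / 2 - 1) := by
    rw [← Real.rpow_natCast, ← Real.rpow_mul (norm_nonneg _)]; congr 1; push_cast; ring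
  have e2 : ‖xPart z‖ ^ (2 * γ - 1) = ‖xPart z‖ ^ (2 * (γ - 1)) * ‖xPart z‖ := by
    rw [← Real.rpow_add_one hr.ne']; congr 1; ring
  rw [energyDeriv, e1, norm_sq_scaleY, e2]
  field_simp

theorem tendsto_energyDensity_quotient (hp : 1 < p) {z : Space N l} (ξ : Space N l) {i : Fin N}
    (hz : z (Sum.inl i) ≠ 0) (s : ℝ) :
    Tendsto (fun h : ℝ => h⁻¹ * (energyDensity γ p (z - h • s • basisVec (Sum.inl i)) ξ -
      energyDensity γ p z ξ)) (𝓝[>] 0) (𝓝 (-(s * energyDeriv γ p i z ξ))) := by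
  have h1 := hasDerivAt_energyDensity (γ := γ) hp ξ hz
  have h2 : HasDerivAt (fun h : ℝ => h * -s) (-s) 0 := by
    simpa using (hasDerivAt_id (0 : ℝ)).mul_const (-s)
  have h3 := HasDerivAt.comp (0 : ℝ)
    (h₂ := fun t : ℝ => energyDensity γ p (z + t • basisVec (Sum.inl i)) ξ) (by simpa using h1) h2
  have h4 := (hasDerivAt_iff_tendsto_slope_zero.1 h3).mono_left
    (nhdsWithin_mono _ (fun x hx => ne_of_gt hx : Ioi (0 : ℝ) ⊆ {0}ᶜ))
  convert h4 using 2 with h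
  · simp [mul_smul, sub_eq_add_neg]
  · ring

/-- The difference quotients of the energy density in direction `x_i` have an integrable
majorant. -/
theorem exists_energyDensity_sub_le (hγ : 0 ≤ γ) (hp : 1 < p) {R K : ℝ} (hR : 0 ≤ R) (i : Fin N) :
    ∃ C ≥ (0 : ℝ), ∃ β : ℝ, -1 < β ∧ ∀ z z' ξ : Space N l, ‖z‖ ≤ R → ‖z'‖ ≤ R → ‖ξ‖ ≤ K →
      z (Sum.inl i) ≠ 0 → |energyDensity γ p z' ξ - energyDensity γ p z ξ| ≤
        C * (‖z' - z‖ * |z (Sum.inl i)| ^ β) := by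
  obtain ⟨C, hC, α, hα0, hα1, h⟩ := exists_profile_increment_le hγ hp (sq_nonneg K) hR
  refine ⟨C, hC, α - 1, by linarith, fun z z' ξ hz hz' hξ hz0 => ?_⟩
  have hzi := abs_pos.2 hz0
  have hri := abs_apply_le_norm_xPart z i
  have hx : ‖xPart ξ‖ ^ 2 ≤ K ^ 2 :=
    pow_le_pow_left₀ (norm_nonneg _) ((norm_xPart_le ξ).trans hξ) 2
  have hy : ‖yPart ξ‖ ^ 2 ≤ K ^ 2 :=
    pow_le_pow_left₀ (norm_nonneg _) ((norm_yPart_le ξ).trans hξ) 2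
  rw [energyDensity_eq_profile, energyDensity_eq_profile, abs_sub_comm]
  refine (h _ _ _ _ (sq_nonneg _) hx (sq_nonneg _) hy (hzi.trans_le hri)
    ((norm_xPart_le z).trans hz) (norm_nonneg _) ((norm_xPart_le z').trans hz')).trans ?_
  refine mul_le_mul_of_nonneg_left (mul_le_mul ?_ ?_ (by positivity) (norm_nonneg _)) hC
  · rw [abs_sub_comm]
    refine (abs_norm_sub_norm_le _ _).trans ?_
    exact norm_xPart_le (z' - z)
  · exact Real.rpow_le_rpow_of_nonpos hzi hri (by linarith)

/-- The Lipschitz bound on the difference quotients passes to the derivative. -/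
theorem abs_energyDeriv_le (hp : 1 < p) {R C β : ℝ} {z ξ : Space N l} {i : Fin N} (hz : ‖z‖ ≤ R)
    (hz0 : z (Sum.inl i) ≠ 0)
    (h : ∀ z' : Space N l, ‖z'‖ ≤ R + 1 → |energyDensity γ p z' ξ - energyDensity γ p z ξ| ≤
        C * (‖z' - z‖ * |z (Sum.inl i)| ^ β)) :
    |energyDeriv γ p i z ξ| ≤ C * |z (Sum.inl i)| ^ β := by
  have h1 := (tendsto_energyDensity_quotient (γ := γ) hp ξ hz0 1).abs
  rw [one_mul, abs_neg] at h1
  refine le_of_tendsto h1 ?_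
  filter_upwards [Ioo_mem_nhdsGT (zero_lt_one' ℝ)] with t ht
  have hd : ‖t • (1 : ℝ) • (basisVec (Sum.inl i) : Space N l)‖ = t := by
    rw [one_smul, norm_smul, norm_basisVec, mul_one, Real.norm_of_nonneg ht.1.le]
  have h2 := h (z - t • (1 : ℝ) • basisVec (Sum.inl i)) (by
    refine (norm_sub_le _ _).trans ?_
    rw [hd]; linarith [ht.2])
  rw [show z - t • (1 : ℝ) • basisVec (Sum.inl i) - z = -(t • (1 : ℝ) • basisVec (Sum.inl i)) by
    abel, norm_neg, hd] at h2
  rw [abs_mul, abs_of_pos (inv_pos.2 ht.1), inv_mul_le_iff₀ ht.1]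
  linarith

theorem measurable_energyDeriv (hγ : 0 ≤ γ) {G : Space N l → Space N l} (hG : Continuous G)
    (i : Fin N) : Measurable (fun z => energyDeriv γ p i z (G z)) := by
  have h1 : Measurable (fun z => ‖scaleY γ z (G z)‖) :=
    (continuous_scaleY hγ continuous_id hG).norm.measurable
  have h2 : Measurable (fun z : Space N l => ‖xPart z‖) := continuous_xPart.norm.measurable
  have h3 : Measurable (fun z : Space N l => z (Sum.inl i)) := by fun_prop
  have h4 : Measurable (fun z => ‖yPart (G z)‖) := (continuous_yPart.comp hG).norm.measurable
  unfold energyDeriv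
  exact ((((h1.pow_const _).mul_const _).mul (h2.pow_const _)).mul h3).mul (h4.pow_const _)

/-- Along a bounded continuous field the `x_i`-derivative of the energy density is integrable on
balls, whatever the values of `γ ≥ 0` and `p > 1`. -/
theorem integrableOn_energyDeriv (hγ : 0 ≤ γ) (hp : 1 < p) {G : Space N l → Space N l}
    (hG : Continuous G) {K : ℝ} (hK : ∀ z, ‖G z‖ ≤ K) {R : ℝ} (hR : 0 ≤ R) (i : Fin N) :
    IntegrableOn (fun z => energyDeriv γ p i z (G z)) (closedBall 0 R) := by
  obtain ⟨C, hC, β, hβ, h⟩ := exists_energyDensity_sub_le (l := l) (K := K) hγ hp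
    (show 0 ≤ R + 1 by linarith) i
  refine ((integrableOn_abs_coord_rpow hβ (Sum.inl i : Fin N ⊕ Fin l) hR).const_mul C).mono'
    (measurable_energyDeriv hγ hG i).aestronglyMeasurable ?_
  filter_upwards [ae_restrict_mem measurableSet_closedBall,
    ae_restrict_of_ae (ae_coord_ne_zero (Sum.inl i : Fin N ⊕ Fin l))] with z hz hz0
  have hz : ‖z‖ ≤ R := mem_closedBall_zero_iff.1 hz
  exact abs_energyDeriv_le hp hz hz0 fun z' hz' => h z z' _ (by linarith) hz' (hK z) hz0

/-- Differentiation of the energy in direction `x_i`, under the integral sign. -/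
theorem tendsto_integral_energyDensity_quotient_inl (hγ : 0 ≤ γ) (hp : 1 < p)
    {G : Space N l → Space N l} (hG : Continuous G) {K : ℝ} (hK : ∀ z, ‖G z‖ ≤ K)
    {η : Space N l → ℝ} (hη : Continuous η) (hηc : HasCompactSupport η) (i : Fin N) {s : ℝ}
    (hs : |s| = 1) :
    Tendsto (fun h : ℝ => ∫ z, η (z - h • s • basisVec (Sum.inl i)) *
      (h⁻¹ * (energyDensity γ p (z - h • s • basisVec (Sum.inl i)) (G z) -
        energyDensity γ p z (G z))))
      (𝓝[>] 0) (𝓝 (-(s * ∫ z, η z * energyDeriv γ p i z (G z)))) := by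
  obtain ⟨M, hM⟩ := hηc.exists_bound_of_continuous hη
  obtain ⟨R, hR0, hR⟩ : ∃ R : ℝ, 0 ≤ R ∧ ∀ z, R < ‖z‖ → η z = 0 := by
    obtain ⟨R, hR⟩ := hηc.isCompact.isBounded.subset_closedBall 0
    refine ⟨max R 0, le_max_right _ _, fun z hz => image_eq_zero_of_notMem_tsupport fun h => ?_⟩
    exact (hz.trans_le' (le_max_left _ _)).not_ge (mem_closedBall_zero_iff.1 (hR h))
  have hM0 : 0 ≤ M := (norm_nonneg _).trans (hM 0)
  obtain ⟨C, hC, β, hβ, h⟩ := exists_energyDensity_sub_le (l := l) (K := K) hγ hp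
    (show 0 ≤ R + 2 by linarith) i
  have hd : ∀ t : ℝ, 0 < t → ‖t • s • (basisVec (Sum.inl i) : Space N l)‖ = t := fun t ht => by
    rw [norm_smul, norm_smul, norm_basisVec, Real.norm_eq_abs, Real.norm_eq_abs, hs,
      abs_of_pos ht, one_mul, mul_one]
  have hlim : -(s * ∫ z, η z * energyDeriv γ p i z (G z)) =
      ∫ z, η z * -(s * energyDeriv γ p i z (G z)) := by
    rw [← integral_const_mul, ← integral_neg]; congr 1; ext z; ring
  rw [hlim]
  refine tendsto_integral_filter_of_dominated_convergence
    ((closedBall (0 : Space N l) (R + 1)).indicator fun z => M * (C * |z (Sum.inl i)| ^ β))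
    ?_ ?_ ?_ ?_
  · refine Eventually.of_forall fun t => Continuous.aestronglyMeasurable ?_
    have hsh : Continuous (fun z : Space N l => z - t • s • basisVec (Sum.inl i)) := by fun_prop
    exact (hη.comp hsh).mul (continuous_const.mul ((continuous_energyDensity hγ hp hsh hG).sub
      (continuous_energyDensity hγ hp continuous_id hG)))
  · filter_upwards [Ioo_mem_nhdsGT (zero_lt_one' ℝ)] with t ht
    filter_upwards [ae_coord_ne_zero (Sum.inl i : Fin N ⊕ Fin l)] with z hz0
    by_cases hz : z ∈ closedBall (0 : Space N l) (R + 1)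
    · rw [indicator_of_mem hz, norm_mul]
      have hz : ‖z‖ ≤ R + 1 := mem_closedBall_zero_iff.1 hz
      refine mul_le_mul (hM _) ?_ (norm_nonneg _) hM0
      have h2 := h z (z - t • s • basisVec (Sum.inl i)) (G z) (by linarith) (by
        refine (norm_sub_le _ _).trans ?_
        rw [hd t ht.1]; linarith [ht.2]) (hK z) hz0
      rw [show z - t • s • basisVec (Sum.inl i) - z = -(t • s • basisVec (Sum.inl i)) by
        abel, norm_neg, hd t ht.1] at h2
      rw [Real.norm_eq_abs, abs_mul, abs_of_pos (inv_pos.2 ht.1), inv_mul_le_iff₀ ht.1]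
      linarith
    · rw [indicator_of_notMem hz]
      have hz : R + 1 < ‖z‖ := not_le.1 fun h => hz (mem_closedBall_zero_iff.2 h)
      rw [hR, zero_mul, norm_zero]
      have := norm_sub_norm_le z (t • s • basisVec (Sum.inl i))
      rw [hd t ht.1] at this
      linarith [ht.2]
  · refine (integrable_indicator_iff measurableSet_closedBall).2 ?_
    exact ((integrableOn_abs_coord_rpow hβ (Sum.inl i : Fin N ⊕ Fin l)
      (by linarith)).const_mul C).const_mul M
  · filter_upwards [ae_coord_ne_zero (Sum.inl i : Fin N ⊕ Fin l)] with z hz0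
    refine Tendsto.mul ?_ (tendsto_energyDensity_quotient hp (G z) hz0 s)
    have hc : Continuous (fun t : ℝ => η (z - t • s • basisVec (Sum.inl i))) :=
      hη.comp (by fun_prop)
    have := hc.tendsto 0
    simp only [zero_smul, sub_zero] at this
    exact this.mono_left nhdsWithin_le_nhds

end ExplicitDependence

/-! ### Divergence theorem for directional derivatives -/

section Divergence

variable {E : Type*} [NormedAddCommGroup E] [InnerProductSpace ℝ E] [FiniteDimensional ℝ E]
  [MeasurableSpace E] [BorelSpace E]

theorem eventually_tsupport_smoothIndicator_subset {δ : ℝ} (hδ : 0 < δ) (D : Set E) :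
    ∀ᶠ n : ℕ in atTop, tsupport (smoothIndicator n D) ⊆ cthickening δ (closure D) :=
  (tendsto_one_div_add_atTop_nhds_zero_nat.eventually (gt_mem_nhds hδ)).mono fun n hn =>
    (tsupport_smoothIndicator_subset n D).trans (cthickening_mono hn.le _)

theorem hasCompactSupport_smoothIndicator (n : ℕ) {D : Set E} (hDb : Bornology.IsBounded D) :
    HasCompactSupport (smoothIndicator n D) :=
  (hDb.isCompact_closure.cthickening).of_isClosed_subset (isClosed_tsupport _)
    (tsupport_smoothIndicator_subset n D)

/-- Divergence theorem for a continuous function that is only differentiable in the direction `d`,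
with a derivative that is integrable near `closure D`. -/
theorem IsFlatBoundary.setIntegral_lineDeriv {m : ℕ} (hm : finrank ℝ E = m + 1) {D : Set E}
    (hD : IsOpen D) (hDb : Bornology.IsBounded D) {ν : E → E} (hν : IsFlatBoundary D ν)
    {Φ g : E → ℝ} (hΦ : Continuous Φ) {d : E} {δ : ℝ} (hδ : 0 < δ)
    (hg : ∀ z ∈ cthickening δ (closure D), HasLineDerivAt ℝ Φ (g z) z d)
    (hgi : IntegrableOn g (cthickening δ (closure D))) :
    ∫ z in D, g z = ∫ z in frontier D, Φ z * ⟪ν z, d⟫ ∂μHE[m] := by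
  have h1 := hν.tendsto_integral_mul_smoothIndicator hm hD hDb hδ hgi
  have h2 := (hν.tendsto_integral_fderiv_smoothIndicator hm hD hDb (a := fun z => Φ z • d)
    (hΦ.smul (continuous_const (y := d)))).neg
  simp only [neg_neg, real_inner_smul_right] at h2
  refine tendsto_nhds_unique h1 (h2.congr' ?_)
  filter_upwards [eventually_tsupport_smoothIndicator_subset hδ D] with n hn
  have hη : ContDiff ℝ ∞ (smoothIndicator n D) := contDiff_smoothIndicator n hD.measurableSet
  have hηc := hasCompactSupport_smoothIndicator n hDb
  have i1 : Integrable (fun z => g z * smoothIndicator n D z) := by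
    have hη' := hη.continuous
    have hs : IntegrableOn (fun z => g z * smoothIndicator n D z) (cthickening δ (closure D)) :=
      hgi.mul_bdd (c := 1) hη'.aestronglyMeasurable
        (Eventually.of_forall fun z => abs_smoothIndicator_le n D z)
    refine (integrableOn_iff_integrable_of_support_subset fun z hz => ?_).1 hs
    exact hn (subset_tsupport _ (right_ne_zero_of_mul hz))
  have i2 : Integrable (fun z => Φ z * fderiv ℝ (smoothIndicator n D) z d) :=
    (hΦ.mul ((hη.continuous_fderiv (by simp)).clm_apply
      continuous_const)).integrable_of_hasCompactSupport (hηc.fderiv_apply ℝ d).mul_left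
  have i3 : Integrable (fun z => Φ z * smoothIndicator n D z) :=
    (hΦ.mul hη.continuous).integrable_of_hasCompactSupport hηc.mul_left
  have h3 := integral_bilinear_hasLineDerivAt_right_eq_neg_left_of_integrable (μ := volume)
    (B := ContinuousLinearMap.mul ℝ ℝ) (f := Φ) (f' := g) (g := smoothIndicator n D)
    (g' := fun z => fderiv ℝ (smoothIndicator n D) z d) (v := d) i1 i2 i3
    (fun z hz => hg z (hn hz))
    (fun z _ => ((hη.differentiable (by simp)) z).hasFDerivAt.hasLineDerivAt d)
  simp only [ContinuousLinearMap.mul_apply'] at h3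
  simp only [map_smul, smul_eq_mul]
  rw [h3, neg_neg]

end Divergence

/-! ### The flux identity -/

section Identity

variable {N l : ℕ} {γ p : ℝ}

/-- The flux identity on `D`: the variational identity with `η` tending to the indicator of `D`.
The function `Λ` is the derivative of the energy density in the explicit variable. -/
theorem setIntegral_flux_identity {m : ℕ} (hm : finrank ℝ (Space N l) = m + 1)
    (hγ : 0 ≤ γ) (hp : 1 < p) {D : Set (Space N l)} (hD : IsOpen D)
    (hDb : Bornology.IsBounded D) {ν : Space N l → Space N l} (hν : IsFlatBoundary D ν)
    {δ : ℝ} (hδ : 0 < δ) {v b : Space N l → ℝ} (hv : ContDiff ℝ 1 v) (hvc : HasCompactSupport v)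
    (hb : Continuous b)
    (hpde : ∀ φ : Space N l → ℝ, ContDiff ℝ 1 φ → HasCompactSupport φ →
      tsupport φ ⊆ cthickening δ (closure D) →
      ∫ z, fderiv ℝ φ z (fluxField γ p v z) = ∫ z, b z * φ z)
    (k : Fin N ⊕ Fin l) {Λ : Space N l → ℝ} (hΛi : IntegrableOn Λ (cthickening δ (closure D)))
    (hΛ : ∀ η : Space N l → ℝ, Continuous η → HasCompactSupport η → ∀ s : ℝ, |s| = 1 →
      Tendsto (fun h : ℝ => ∫ z, η (z - h • s • basisVec k) *
        (h⁻¹ * (energyDensity γ p (z - h • s • basisVec k) (grad v z) -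
          energyDensity γ p z (grad v z)))) (𝓝[>] 0) (𝓝 (-(s * ∫ z, η z * Λ z)))) :
    (∫ z in D, b z * partialDeriv k v z) +
        ∫ z in frontier D, ‖grushinGrad γ v z‖ ^ (p - 2) * partialDeriv k v z *
          ⟪grushinGrad γ v z, scaleY γ z (ν z)⟫ ∂μHE[m] =
      1 / p * (∫ z in frontier D, ‖grushinGrad γ v z‖ ^ p * ν z k ∂μHE[m]) -
        ∫ z in D, Λ z := by
  set d : Space N l := basisVec k
  have hvd : Continuous (fun z => fderiv ℝ v z d) :=
    (hv.continuous_fderiv one_ne_zero).clm_apply continuous_const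
  have hL : Continuous (fun z => energyDensity γ p z (grad v z)) :=
    continuous_energyDensity hγ hp continuous_id (continuous_grad hv)
  have hpd : ∀ z, partialDeriv k v z = fderiv ℝ v z d := fun z =>
    partialDeriv_eq_fderiv (hv.differentiable one_ne_zero z) k
  have hK : IsCompact (cthickening δ (closure D)) := hDb.isCompact_closure.cthickening
  have t1 := hν.tendsto_integral_mul_smoothIndicator hm hD hDb hδ
    (g := fun z => b z * fderiv ℝ v z d) ((hb.mul hvd).continuousOn.integrableOn_compact hK)
  have t2 := hν.tendsto_integral_fderiv_smoothIndicator hm hD hDb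
    (a := fun z => fderiv ℝ v z d • fluxField γ p v z) (hvd.smul (continuous_fluxField hγ hp hv))
  have t3 := hν.tendsto_integral_fderiv_smoothIndicator hm hD hDb
    (a := fun z => energyDensity γ p z (grad v z) • d) (hL.smul (continuous_const (y := d)))
  have t4 := hν.tendsto_integral_mul_smoothIndicator hm hD hDb hδ hΛi
  have hlim := tendsto_nhds_unique (t1.sub t2) ((t3.neg.sub t4).congr' (by
    filter_upwards [eventually_tsupport_smoothIndicator_subset hδ D] with n hn
    have hη : ContDiff ℝ ∞ (smoothIndicator n D) := contDiff_smoothIndicator n hD.measurableSet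
    have hηc := hasCompactSupport_smoothIndicator n hDb
    have h := variational_identity hγ hp hv hvc hb hpde (hη.of_le (by simp)) hηc
      (smoothIndicator_nonneg n D) hn d (hΛ _ hη.continuous hηc)
    have e1 : ∫ z, fderiv ℝ v z d * (b z * smoothIndicator n D z) =
        ∫ z, b z * fderiv ℝ v z d * smoothIndicator n D z := by
      congr 1; ext z; ring
    have e2 : ∫ z, smoothIndicator n D z * Λ z = ∫ z, Λ z * smoothIndicator n D z := by
      congr 1; ext z; ring
    have e3 : ∫ z, fderiv ℝ (smoothIndicator n D) z d * energyDensity γ p z (grad v z) =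
        ∫ z, energyDensity γ p z (grad v z) * fderiv ℝ (smoothIndicator n D) z d := by
      congr 1; ext z; ring
    rw [e1, e2, e3] at h
    simp only [map_smul, smul_eq_mul]
    exact h.symm))
  simp only [real_inner_smul_right, neg_neg, sub_neg_eq_add] at hlim
  rw [← integral_const_mul]
  convert hlim using 2
  · simp only [hpd]
  · congr 1; ext z
    rw [inner_fluxField, hpd]; ring
  · congr 1; ext z
    rw [inner_basisVec, energyDensity, grushinGrad]; ring

end Identity

/-! ### The primitive of the nonlinearity -/

section Primitive

variable {N l : ℕ} {f : Space N l → ℝ → ℝ}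

theorem continuous_primitive (hf : Continuous (fun q : Space N l × ℝ => f q.1 q.2)) :
    Continuous (fun q : Space N l × ℝ => primitive f q.1 q.2) := by
  unfold primitive
  refine intervalIntegral.continuous_parametric_intervalIntegral_of_continuous
    (f := fun q : Space N l × ℝ => f q.1) ?_ continuous_snd
  exact hf.comp (by fun_prop : Continuous fun r : (Space N l × ℝ) × ℝ => (r.1.1, r.2))

theorem primitive_sub_primitive (hf : Continuous (fun q : Space N l × ℝ => f q.1 q.2))
    (w : Space N l) (a b : ℝ) : primitive f w b - primitive f w a = ∫ τ in a..b, f w τ := by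
  have hc : Continuous (f w) := hf.comp (by fun_prop : Continuous fun τ : ℝ => (w, τ))
  exact intervalIntegral.integral_interval_sub_left (hc.intervalIntegrable _ _)
    (hc.intervalIntegrable _ _)

/-- Chain rule for `F(z, u(z))` in a direction `d`. Only the explicit line derivative of `F` is
assumed to exist; the derivative in `s` is `f`, which is jointly continuous. -/
theorem hasLineDerivAt_primitive (hf : Continuous (fun q : Space N l × ℝ => f q.1 q.2))
    {u : Space N l → ℝ} {z d : Space N l} {e u' : ℝ} (hu : HasLineDerivAt ℝ u u' z d)
    (he : HasLineDerivAt ℝ (fun w => primitive f w (u z)) e z d) :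
    HasLineDerivAt ℝ (fun w => primitive f w (u w)) (e + f z (u z) * u') z d := by
  unfold HasLineDerivAt at *
  set U : ℝ → ℝ := fun t => u (z + t • d) with hU
  have hU0 : U 0 = u z := by simp [hU]
  have hsmall : HasDerivAt (fun t : ℝ => (∫ τ in u z..U t, f (z + t • d) τ) -
      f z (u z) * (U t - u z)) 0 0 := by
    rw [hasDerivAt_iff_isLittleO]
    simp only [smul_zero, sub_zero, hU0, intervalIntegral.integral_same, sub_self, mul_zero]
    have hO : (fun t => U t - u z) =O[𝓝 0] fun t => t := by
      simpa [hU0] using hu.isBigO_sub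
    refine Asymptotics.IsLittleO.trans_isBigO ?_ hO
    rw [Asymptotics.isLittleO_iff]
    intro ε hε
    have hc : ContinuousAt (fun q : ℝ × ℝ => f (z + q.1 • d) q.2) (0, u z) := by
      have : Continuous (fun q : ℝ × ℝ => f (z + q.1 • d) q.2) :=
        hf.comp (by fun_prop : Continuous fun q : ℝ × ℝ => (z + q.1 • d, q.2))
      exact this.continuousAt
    obtain ⟨δ, hδ, h⟩ := Metric.continuousAt_iff.1 hc ε hε
    have hUc : ∀ᶠ t in 𝓝 0, |U t - u z| < δ := by
      have := Metric.tendsto_nhds.1 hu.continuousAt.tendsto δ hδ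
      simpa [hU0, Real.dist_eq] using this
    filter_upwards [hUc, Metric.ball_mem_nhds (0 : ℝ) hδ] with t ht ht0
    have hcf : Continuous (f (z + t • d)) :=
      hf.comp (by fun_prop : Continuous fun τ : ℝ => (z + t • d, τ))
    have e1 : (∫ τ in u z..U t, f (z + t • d) τ) - f z (u z) * (U t - u z) =
        ∫ τ in u z..U t, (f (z + t • d) τ - f z (u z)) := by
      rw [intervalIntegral.integral_sub (hcf.intervalIntegrable _ _)
        (continuous_const.intervalIntegrable _ _), intervalIntegral.integral_const, smul_eq_mul,
        mul_comm]
    rw [e1]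
    refine intervalIntegral.norm_integral_le_of_norm_le_const fun τ hτ => ?_
    have hτ' : |τ - u z| ≤ |U t - u z| := abs_sub_left_of_mem_uIcc (uIoc_subset_uIcc hτ)
    have := h (x := (t, τ)) (by
      rw [Prod.dist_eq, max_lt_iff]
      exact ⟨ht0, by rw [Real.dist_eq]; exact hτ'.trans_lt ht⟩)
    simpa [Real.dist_eq] using this.le
  have h1 := (he.add hsmall).add ((hu.sub_const (u z)).const_mul (f z (u z)))
  rw [add_zero] at h1
  refine h1.congr_of_eventuallyEq (Eventually.of_forall fun t => ?_)
  have := primitive_sub_primitive hf (z + t • d) (u z) (U t)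
  simp only [Pi.add_apply]
  linarith

theorem HasExplicitDeriv.hasLineDerivAt (hf : Continuous (fun q : Space N l × ℝ => f q.1 q.2))
    {Ω : Set (Space N l)} {u : Space N l → ℝ} {k : Fin N ⊕ Fin l}
    (h : HasExplicitDeriv Ω f u k) {z : Space N l} (hz : z ∈ Ω) (hu : DifferentiableAt ℝ u z) :
    HasLineDerivAt ℝ (fun w => primitive f w (u w))
      (explicitDeriv f u k z + f z (u z) * partialDeriv k u z) z (basisVec k) :=
  hasLineDerivAt_primitive hf hu.lineDifferentiableAt.hasLineDerivAt (h.1 z hz).hasLineDerivAt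

end Primitive

/-! ### Test functions and the weak equation -/

section WeakSolution

variable {N l : ℕ} {γ p : ℝ}

/-- A function of class `C^1` on `Ω` agrees near a compact subset of `Ω` with a compactly supported
`C^1` function on the whole space. -/
theorem exists_contDiff_eqOn {Ω : Set (Space N l)} (hΩ : IsOpen Ω) {u : Space N l → ℝ}
    (hu : ContDiffOn ℝ 1 u Ω) {K : Set (Space N l)} (hK : IsCompact K) (hKΩ : K ⊆ Ω) :
    ∃ v : Space N l → ℝ, ContDiff ℝ 1 v ∧ HasCompactSupport v ∧
      ∃ V, IsOpen V ∧ K ⊆ V ∧ V ⊆ Ω ∧ EqOn u v V := by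
  obtain ⟨χ, hχ, hχc, hχΩ, V, hV, hKV, hV1⟩ := exists_smooth_cutoff hK hΩ hKΩ
  refine ⟨fun z => χ z * u z, contDiff_iff_contDiffAt.2 fun z => ?_, hχc.mul_right, V, hV, hKV,
    fun z hz => hχΩ (subset_tsupport _ ?_),
    fun z hz => by simp [hV1 z hz]⟩
  · by_cases hz : z ∈ tsupport χ
    · exact (hχ.of_le (by simp)).contDiffAt.mul (hu.contDiffAt (hΩ.mem_nhds (hχΩ hz)))
    · refine (contDiffAt_const (c := (0 : ℝ))).congr_of_eventuallyEq ?_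
      filter_upwards [notMem_tsupport_iff_eventuallyEq.1 hz] with w hw
      simp [hw]
  · simp [hV1 z hz]

theorem partialDeriv_eq_zero_of_notMem_tsupport {φ : Space N l → ℝ} {z : Space N l}
    (hz : z ∉ tsupport φ) (k : Fin N ⊕ Fin l) : partialDeriv k φ z = 0 := by
  rw [partialDeriv_congr (notMem_tsupport_iff_eventuallyEq.1 hz) k]
  simp [partialDeriv, lineDeriv]

theorem grushinGrad_eq_zero_of_notMem_tsupport {φ : Space N l → ℝ} {z : Space N l}
    (hz : z ∉ tsupport φ) (γ : ℝ) : grushinGrad γ φ z = 0 := by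
  ext k
  rw [grushinGrad, scaleY_apply]
  simp [grad, partialDeriv_eq_zero_of_notMem_tsupport hz]

theorem continuous_partialDeriv {φ : Space N l → ℝ} (hφ : ContDiff ℝ 1 φ) (k : Fin N ⊕ Fin l) :
    Continuous (partialDeriv k φ) := by
  have : partialDeriv k φ = fun z => fderiv ℝ φ z (basisVec k) :=
    funext fun z => partialDeriv_eq_fderiv (hφ.differentiable one_ne_zero z) k
  rw [this]
  exact (hφ.continuous_fderiv one_ne_zero).clm_apply continuous_const

theorem hasCompactSupport_partialDeriv {φ : Space N l → ℝ} (hφ : HasCompactSupport φ)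
    (k : Fin N ⊕ Fin l) : HasCompactSupport (partialDeriv k φ) :=
  hφ.mono' (Function.support_subset_iff'.2 fun _ hz => partialDeriv_eq_zero_of_notMem_tsupport hz k)

/-- Integration by parts for the Grushin field in direction `k`: its coefficient is constant along
that direction. -/
theorem integral_mul_weight_mul_partialDeriv (hγ : 0 ≤ γ) {v φ : Space N l → ℝ}
    (hv : ContDiff ℝ 1 v) (hφ : ContDiff ℝ 1 φ) (hφc : HasCompactSupport φ) (k : Fin N ⊕ Fin l) :
    ∫ z, v z * (weight γ z k * partialDeriv k φ z) = -∫ z, grushinGrad γ v z k * φ z := by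
  have hw := continuous_weight (N := N) (l := l) hγ k
  have e : ∀ z, grushinGrad γ v z k * φ z = partialDeriv k v z * (weight γ z k * φ z) := fun z => by
    rw [grushinGrad, scaleY_apply]; simp only [grad]; ring
  simp only [e]
  refine integral_bilinear_hasLineDerivAt_right_eq_neg_left_of_integrable (μ := volume)
    (B := ContinuousLinearMap.mul ℝ ℝ) (f := v) (f' := partialDeriv k v)
    (g := fun z => weight γ z k * φ z) (g' := fun z => weight γ z k * partialDeriv k φ z)
    (v := basisVec k) ?_ ?_ ?_ ?_ ?_
  · exact ((continuous_partialDeriv hv k).mul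
      (hw.mul hφ.continuous)).integrable_of_hasCompactSupport (hφc.mul_left.mul_left)
  · exact (hv.continuous.mul (hw.mul
      (continuous_partialDeriv hφ k))).integrable_of_hasCompactSupport
        ((hasCompactSupport_partialDeriv hφc k).mul_left.mul_left)
  · exact (hv.continuous.mul (hw.mul hφ.continuous)).integrable_of_hasCompactSupport
      (hφc.mul_left.mul_left)
  · exact fun z _ => (hv.differentiable one_ne_zero z).lineDifferentiableAt.hasLineDerivAt
  · intro z _
    have h1 : HasLineDerivAt ℝ φ (partialDeriv k φ z) z (basisVec k) :=
      (hφ.differentiable one_ne_zero z).lineDifferentiableAt.hasLineDerivAt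
    unfold HasLineDerivAt at h1 ⊢
    simp only [weight_add_smul_basisVec]
    exact h1.const_mul _

theorem setIntegral_eq_integral_of_tsupport_subset {Ω : Set (Space N l)} {φ g : Space N l → ℝ}
    (hφ : tsupport φ ⊆ Ω) (hg : ∀ z, z ∉ tsupport φ → g z = 0) :
    ∫ z in Ω, g z = ∫ z, g z :=
  setIntegral_eq_integral_of_forall_compl_eq_zero fun z hz => hg z fun h => hz (hφ h)

theorem IsTestFunction.hasWeakGrushinGrad (hγ : 0 ≤ γ) {Ω : Set (Space N l)} {φ : Space N l → ℝ}
    (hφ : IsTestFunction Ω φ) : HasWeakGrushinGrad Ω γ p φ (grushinGrad γ φ) := by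
  obtain ⟨hφ, hφc, hφΩ⟩ := hφ
  have hφ1 : ContDiff ℝ 1 φ := hφ.of_le (by simp)
  refine ⟨(hφ.continuous.memLp_of_hasCompactSupport hφc).restrict Ω,
    ((continuous_grushinGrad hγ hφ1).memLp_of_hasCompactSupport (hφc.mono'
      (Function.support_subset_iff'.2 fun z hz =>
        grushinGrad_eq_zero_of_notMem_tsupport hz γ))).restrict Ω, fun ψ hψ k => ?_⟩
  rw [setIntegral_eq_integral_of_tsupport_subset hψ.2.2,
    setIntegral_eq_integral_of_tsupport_subset hψ.2.2]
  · exact integral_mul_weight_mul_partialDeriv hγ hφ1 (hψ.1.of_le (by simp)) hψ.2.1 k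
  · exact fun z hz => by rw [image_eq_zero_of_notMem_tsupport hz, mul_zero]
  · exact fun z hz => by rw [partialDeriv_eq_zero_of_notMem_tsupport hz, mul_zero, mul_zero]

/-- A test function is its own approximation by test functions. -/
theorem IsTestFunction.memSobolevZero (hγ : 0 ≤ γ) (hp : 1 < p) {Ω : Set (Space N l)}
    {φ : Space N l → ℝ} (hφ : IsTestFunction Ω φ) : MemSobolevZero Ω γ p φ := by
  refine ⟨grushinGrad γ φ, hφ.hasWeakGrushinGrad hγ, fun ε hε => ⟨φ, hφ, ?_⟩⟩
  have hp0 : p ≠ 0 := by linarith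
  simpa [sobolevNorm, Real.zero_rpow hp0, Real.zero_rpow (inv_ne_zero hp0)] using hε

/-- On an open set where `u` is of class `C^1`, its weak Grushin gradient is the classical one. -/
theorem HasWeakGrushinGrad.ae_eq_grushinGrad (hγ : 0 ≤ γ) (hp : 1 < p) {Ω : Set (Space N l)}
    (hΩ : IsOpen Ω) (hΩb : Bornology.IsBounded Ω) {u : Space N l → ℝ} (hu : ContDiffOn ℝ 1 u Ω)
    {U : Space N l → Space N l} (hU : HasWeakGrushinGrad Ω γ p u U) :
    ∀ᵐ z, z ∈ Ω → U z = grushinGrad γ u z := by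
  have hfin : IsFiniteMeasure (volume.restrict Ω) :=
    ⟨by rw [Measure.restrict_apply_univ]; exact hΩb.measure_lt_top⟩
  have hcoord : ∀ k, ∀ᵐ z, z ∈ Ω → U z k - grushinGrad γ u z k = 0 := by
    intro k
    have iU : IntegrableOn (fun z => U z k) Ω := by
      have h1 : Integrable U (volume.restrict Ω) :=
        hU.memLp_grad.integrable (by simpa using hp.le)
      exact (EuclideanSpace.proj (𝕜 := ℝ) k : Space N l →L[ℝ] ℝ).integrable_comp h1
    have cG : ContinuousOn (fun z => grushinGrad γ u z k) Ω := by
      intro z hz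
      obtain ⟨v, hv, -, V, hV, hzV, -, huv⟩ :=
        exists_contDiff_eqOn hΩ hu (isCompact_singleton (x := z)) (singleton_subset_iff.2 hz)
      have hc : Continuous (fun z => grushinGrad γ v z k) :=
        (EuclideanSpace.proj (𝕜 := ℝ) k : Space N l →L[ℝ] ℝ).continuous.comp
          (continuous_grushinGrad hγ hv)
      refine (hc.continuousAt.congr ?_).continuousWithinAt
      filter_upwards [hV.mem_nhds (hzV rfl)] with w hw
      rw [grushinGrad_congr (huv.eventuallyEq_of_mem (hV.mem_nhds hw))]
    refine hΩ.ae_eq_zero_of_integral_contDiff_smul_eq_zero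
      (iU.locallyIntegrableOn.sub (cG.locallyIntegrableOn hΩ.measurableSet)) fun φ hφ hφc hφΩ => ?_
    obtain ⟨v, hv, -, V, hV, hφV, -, huv⟩ := exists_contDiff_eqOn hΩ hu hφc hφΩ
    have hφ1 : ContDiff ℝ 1 φ := hφ.of_le (by simp)
    have hG : ∀ z ∈ V, grushinGrad γ u z = grushinGrad γ v z := fun z hz =>
      grushinGrad_congr (huv.eventuallyEq_of_mem (hV.mem_nhds hz)) γ
    have h1 := hU.weak φ ⟨hφ, hφc, hφΩ⟩ k
    have h2 := integral_mul_weight_mul_partialDeriv hγ hv hφ1 hφc k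
    have e1 : ∫ z in Ω, u z * (weight γ z k * partialDeriv k φ z) =
        ∫ z, v z * (weight γ z k * partialDeriv k φ z) := by
      rw [setIntegral_eq_integral_of_tsupport_subset hφΩ fun z hz => by
        rw [partialDeriv_eq_zero_of_notMem_tsupport hz, mul_zero, mul_zero]]
      congr 1; ext z
      by_cases hz : z ∈ tsupport φ
      · rw [huv (hφV hz)]
      · rw [partialDeriv_eq_zero_of_notMem_tsupport hz, mul_zero, mul_zero, mul_zero]
    have e2 : ∀ z, φ z • (U z k - grushinGrad γ u z k) =
        U z k * φ z - grushinGrad γ v z k * φ z := fun z => by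
      by_cases hz : z ∈ tsupport φ
      · rw [hG z (hφV hz), smul_eq_mul]; ring
      · rw [image_eq_zero_of_notMem_tsupport hz, zero_smul, mul_zero, mul_zero, sub_zero]
    have i1 : Integrable (fun z => U z k * φ z) := by
      obtain ⟨M, hM⟩ := hφc.exists_bound_of_continuous hφ.continuous
      have : IntegrableOn (fun z => U z k * φ z) Ω :=
        iU.mul_bdd (c := M) hφ.continuous.aestronglyMeasurable (Eventually.of_forall hM)
      refine (integrableOn_iff_integrable_of_support_subset fun z hz => ?_).1 this
      exact hφΩ (subset_tsupport _ (right_ne_zero_of_mul hz))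
    have i2 : Integrable (fun z => grushinGrad γ v z k * φ z) := by
      refine Continuous.integrable_of_hasCompactSupport ?_ hφc.mul_left
      exact ((EuclideanSpace.proj (𝕜 := ℝ) k : Space N l →L[ℝ] ℝ).continuous.comp
          (continuous_grushinGrad hγ hv)).mul hφ.continuous
    have e3 : ∫ z in Ω, U z k * φ z = ∫ z, U z k * φ z :=
      setIntegral_eq_integral_of_tsupport_subset hφΩ fun z hz => by
        rw [image_eq_zero_of_notMem_tsupport hz, mul_zero]
    simp only [e2]
    rw [integral_sub i1 i2]
    linarith
  filter_upwards [ae_all_iff.2 hcoord] with z hz hzΩ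
  ext k
  exact sub_eq_zero.1 (hz k hzΩ)

/-- The equation tested with `C^1` functions supported where the solution `u` agrees with the
globally defined function `v`. -/
theorem IsWeakSolution.integral_fderiv_fluxField (hγ : 0 ≤ γ) (hp : 1 < p)
    {Ω : Set (Space N l)} (hΩ : IsOpen Ω) (hΩb : Bornology.IsBounded Ω)
    {f : Space N l → ℝ → ℝ} (hf : Continuous (fun q : Space N l × ℝ => f q.1 q.2))
    {u : Space N l → ℝ} (hu : IsWeakSolution Ω γ p f u) (hu1 : ContDiffOn ℝ 1 u Ω)
    {v : Space N l → ℝ} (hv : ContDiff ℝ 1 v) {V : Set (Space N l)} (hV : IsOpen V) (hVΩ : V ⊆ Ω)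
    (huv : EqOn u v V) {φ : Space N l → ℝ} (hφ : ContDiff ℝ 1 φ) (hφc : HasCompactSupport φ)
    (hφV : tsupport φ ⊆ V) :
    ∫ z, fderiv ℝ φ z (fluxField γ p v z) = ∫ z, f z (v z) * φ z := by
  refine integral_fderiv_eq_of_smooth (b := fun z => f z (v z)) (continuous_fluxField hγ hp hv)
    (hf.comp (continuous_id.prodMk hv.continuous)) hV (fun φ hφ hφc hφV => ?_) hφ hφc hφV
  obtain ⟨-, U, hU, h⟩ := hu
  have hφΩ := hφV.trans hVΩ
  have htest : IsTestFunction Ω φ := ⟨hφ, hφc, hφΩ⟩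
  have h1 := (h φ _ (htest.memSobolevZero hγ hp) (htest.hasWeakGrushinGrad hγ)).2
  have e1 : ∫ z in Ω, f z (u z) * φ z = ∫ z, f z (v z) * φ z := by
    rw [setIntegral_eq_integral_of_tsupport_subset hφΩ fun z hz => by
      rw [image_eq_zero_of_notMem_tsupport hz, mul_zero]]
    congr 1; ext z
    by_cases hz : z ∈ tsupport φ
    · rw [huv (hφV hz)]
    · rw [image_eq_zero_of_notMem_tsupport hz, mul_zero, mul_zero]
  rw [← e1, ← h1]
  have e2 : ∫ z in Ω, ‖U z‖ ^ (p - 2) * ⟪U z, grushinGrad γ φ z⟫ =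
      ∫ z in Ω, fderiv ℝ φ z (fluxField γ p v z) := by
    refine setIntegral_congr_ae hΩ.measurableSet ?_
    filter_upwards [hU.ae_eq_grushinGrad hγ hp hΩ hΩb hu1] with z hz hzΩ
    have hφd : DifferentiableAt ℝ φ z := hφ.differentiable (by simp) z
    by_cases hzφ : z ∈ tsupport φ
    · rw [hz hzΩ, grushinGrad_congr (huv.eventuallyEq_of_mem (hV.mem_nhds (hφV hzφ))),
        ← inner_grad hφd, inner_fluxField, grushinGrad]
      rfl
    · rw [grushinGrad_eq_zero_of_notMem_tsupport hzφ, inner_zero_right, mul_zero,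
        (notMem_tsupport_iff_eventuallyEq.1 hzφ).fderiv_eq]
      simp
  rw [e2, setIntegral_eq_integral_of_tsupport_subset hφΩ fun z hz => ?_]
  rw [(notMem_tsupport_iff_eventuallyEq.1 hz).fderiv_eq]
  simp

end WeakSolution

/-! ### The identity in the direction of one coordinate -/

section Pohozaev

variable {N l : ℕ} {γ p : ℝ}

theorem exists_norm_grad_le {v : Space N l → ℝ} (hv : ContDiff ℝ 1 v) (hvc : HasCompactSupport v) :
    ∃ K, ∀ z, ‖grad v z‖ ≤ K := by
  refine HasCompactSupport.exists_bound_of_continuous (hvc.mono'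
    (Function.support_subset_iff'.2 fun z hz => ?_)) (continuous_grad hv)
  ext k
  simp [grad, partialDeriv_eq_zero_of_notMem_tsupport hz]

/-- The identity in the direction of any coordinate `k`. The function `Λ z ξ` is the derivative in
that direction of the energy density with `ξ` fixed; how the energy density is differentiated
under the integral is left to the hypotheses `hΛi` and `hΛ`. -/
theorem pohozaev_identity (hNl : 3 ≤ N + l) (hγ : 0 ≤ γ) (hp : 1 < p)
    {Ω : Set (Space N l)} (hΩ : IsOpen Ω) (hΩb : Bornology.IsBounded Ω)
    {f : Space N l → ℝ → ℝ} (hf : Continuous (fun q : Space N l × ℝ => f q.1 q.2))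
    {u : Space N l → ℝ} (hu : IsWeakSolution Ω γ p f u) (hu1 : ContDiffOn ℝ 1 u Ω)
    {D : Set (Space N l)} (hD : IsOpen D) (hDΩ : closure D ⊆ Ω)
    {ν : Space N l → Space N l} (hν : IsOutwardUnitNormal D ν) {k : Fin N ⊕ Fin l}
    (hE : HasExplicitDeriv Ω f u k) {Λ : Space N l → Space N l → ℝ}
    (hΛi : ∀ v : Space N l → ℝ, ContDiff ℝ 1 v → HasCompactSupport v →
      ∀ K : Set (Space N l), IsCompact K → IntegrableOn (fun z => Λ z (grad v z)) K)
    (hΛ : ∀ v : Space N l → ℝ, ContDiff ℝ 1 v → HasCompactSupport v →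
      ∀ η : Space N l → ℝ, Continuous η → HasCompactSupport η → ∀ s : ℝ, |s| = 1 →
      Tendsto (fun h : ℝ => ∫ z, η (z - h • s • basisVec k) *
        (h⁻¹ * (energyDensity γ p (z - h • s • basisVec k) (grad v z) -
          energyDensity γ p z (grad v z)))) (𝓝[>] 0)
        (𝓝 (-(s * ∫ z, η z * Λ z (grad v z))))) :
    (∀ z ∈ Ω, HasLineDerivAt ℝ (fun w => primitive f w (u w))
      (explicitDeriv f u k z + f z (u z) * partialDeriv k u z) z (basisVec k)) ∧
    Integrable (fun z => ‖grushinGrad γ u z‖ ^ p * ν z k) (surfaceMeasure D) ∧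
    Integrable (fun z => ‖grushinGrad γ u z‖ ^ (p - 2) * partialDeriv k u z *
      ⟪grushinGrad γ u z, scaleY γ z (ν z)⟫) (surfaceMeasure D) ∧
    IntegrableOn (fun z => Λ z (grad u z)) D ∧
    Integrable (fun z => primitive f z (u z) * ν z k) (surfaceMeasure D) ∧
    IntegrableOn (explicitDeriv f u k) D ∧
    1 / p * (∫ z, ‖grushinGrad γ u z‖ ^ p * ν z k ∂surfaceMeasure D)
      - (∫ z, ‖grushinGrad γ u z‖ ^ (p - 2) * partialDeriv k u z *
          ⟪grushinGrad γ u z, scaleY γ z (ν z)⟫ ∂surfaceMeasure D)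
      - (∫ z in D, Λ z (grad u z))
    = (∫ z, primitive f z (u z) * ν z k ∂surfaceMeasure D)
      - (∫ z in D, explicitDeriv f u k z) := by
  have hm : finrank ℝ (Space N l) = N + l - 1 + 1 := by
    rw [finrank_euclideanSpace, Fintype.card_sum, Fintype.card_fin, Fintype.card_fin]; omega
  have hDb : Bornology.IsBounded D := hΩb.subset (subset_closure.trans hDΩ)
  have hcl : IsCompact (closure D) := hDb.isCompact_closure
  have hfl : IsFlatBoundary D ν := hν.isFlatBoundary hD
  obtain ⟨v, hv, hvc, V, hV, hDV, hVΩ, huv⟩ := exists_contDiff_eqOn hΩ hu1 hcl hDΩ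
  obtain ⟨δ, hδ, hδV⟩ := hcl.exists_cthickening_subset_open hV hDV
  have hK : IsCompact (cthickening δ (closure D)) := hcl.cthickening
  have hnhds : ∀ z ∈ V, u =ᶠ[𝓝 z] v := fun z hz => huv.eventuallyEq_of_mem (hV.mem_nhds hz)
  have hfrV : frontier D ⊆ V := frontier_subset_closure.trans hDV
  have hDV' : D ⊆ V := subset_closure.trans hDV
  have hfm : MeasurableSet (frontier D) := isClosed_frontier.measurableSet
  have hΦ : Continuous (fun z => primitive f z (v z)) :=
    (continuous_primitive hf).comp (continuous_id.prodMk hv.continuous)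
  have hνk : ContinuousOn (fun z => ν z k) (frontier D) :=
    (EuclideanSpace.proj (𝕜 := ℝ) k : Space N l →L[ℝ] ℝ).continuous.comp_continuousOn
      hfl.continuousOn
  have hGv := continuous_grushinGrad hγ hv
  -- the boundary integrands, near the closure of `D`
  have c1 : EqOn (fun z => ‖grushinGrad γ v z‖ ^ p * ν z k)
      (fun z => ‖grushinGrad γ u z‖ ^ p * ν z k) (frontier D) := fun z hz => by
    simp only [grushinGrad_congr (hnhds z (hfrV hz)) γ]
  have c2 : EqOn (fun z => ‖grushinGrad γ v z‖ ^ (p - 2) * partialDeriv k v z *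
        ⟪grushinGrad γ v z, scaleY γ z (ν z)⟫)
      (fun z => ‖grushinGrad γ u z‖ ^ (p - 2) * partialDeriv k u z *
        ⟪grushinGrad γ u z, scaleY γ z (ν z)⟫) (frontier D) := fun z hz => by
    simp only [grushinGrad_congr (hnhds z (hfrV hz)) γ, partialDeriv_congr (hnhds z (hfrV hz)) k]
  have c3 : EqOn (fun z => primitive f z (v z) * ν z k)
      (fun z => primitive f z (u z) * ν z k) (frontier D) := fun z hz => by
    simp only [huv (hfrV hz)]
  have c4 : EqOn (fun z => Λ z (grad v z)) (fun z => Λ z (grad u z)) D := fun z hz => by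
    simp only [grad_congr (hnhds z (hDV' hz))]
  have i1 : IntegrableOn (fun z => ‖grushinGrad γ v z‖ ^ p * ν z k) (frontier D)
      μHE[N + l - 1] := hfl.integrableOn_frontier hm hD hDb
    ((hGv.norm.rpow_const fun _ => Or.inr (by linarith)).continuousOn.mul hνk)
  have i2 : IntegrableOn (fun z => ‖grushinGrad γ v z‖ ^ (p - 2) * partialDeriv k v z *
      ⟪grushinGrad γ v z, scaleY γ z (ν z)⟫) (frontier D) μHE[N + l - 1] := by
    have h := hfl.integrableOn_frontier hm hD hDb ((continuous_partialDeriv hv k).continuousOn.mul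
      (hfl.continuousOn.inner (continuous_fluxField hγ hp hv).continuousOn))
    refine h.congr_fun (fun z _ => ?_) hfm
    simp only [Pi.mul_apply, inner_fluxField]; ring
  have i3 : IntegrableOn (fun z => primitive f z (v z) * ν z k) (frontier D) μHE[N + l - 1] :=
    hfl.integrableOn_frontier hm hD hDb (hΦ.continuousOn.mul hνk)
  have iΛ : IntegrableOn (fun z => Λ z (grad v z)) (cthickening δ (closure D)) :=
    hΛi v hv hvc _ hK
  have iE : IntegrableOn (explicitDeriv f u k) (cthickening δ (closure D)) :=
    hE.2.integrableOn_compact_subset (hδV.trans hVΩ) hK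
  have hDK : D ⊆ cthickening δ (closure D) := subset_closure.trans (self_subset_cthickening _)
  have ib : IntegrableOn (fun z => f z (v z) * partialDeriv k v z)
      (cthickening δ (closure D)) :=
    ((hf.comp (continuous_id.prodMk hv.continuous)).mul
      (continuous_partialDeriv hv k)).continuousOn.integrableOn_compact hK
  have hflux := setIntegral_flux_identity hm hγ hp hD hDb hfl hδ hv hvc
    (b := fun z => f z (v z)) (hf.comp (continuous_id.prodMk hv.continuous))
    (fun φ hφ hφc hφK => hu.integral_fderiv_fluxField hγ hp hΩ hΩb hf hu1 hv hV hVΩ huv hφ hφc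
      (hφK.trans hδV)) k iΛ (hΛ v hv hvc)
  have hprim := hfl.setIntegral_lineDeriv hm hD hDb hΦ (d := basisVec k) hδ
    (g := fun z => explicitDeriv f u k z + f z (v z) * partialDeriv k v z) (fun z hz => by
      have hzV := hδV hz
      have h := hE.hasLineDerivAt hf (hVΩ hzV)
        ((hu1.contDiffAt (hΩ.mem_nhds (hVΩ hzV))).differentiableAt one_ne_zero)
      rw [huv hzV, partialDeriv_congr (hnhds z hzV)] at h
      refine h.congr_of_eventuallyEq ?_
      filter_upwards [hnhds z hzV] with w hw
      rw [hw]) (iE.add ib)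
  rw [integral_add (iE.mono_set hDK) (ib.mono_set hDK)] at hprim
  simp only [inner_basisVec] at hprim
  refine ⟨fun z hz => hE.hasLineDerivAt hf hz
    ((hu1.contDiffAt (hΩ.mem_nhds hz)).differentiableAt one_ne_zero),
    i1.congr_fun c1 hfm, i2.congr_fun c2 hfm, (iΛ.mono_set hDK).congr_fun c4 hD.measurableSet,
    i3.congr_fun c3 hfm, iE.mono_set hDK, ?_⟩
  simp only [surfaceMeasure]
  rw [← setIntegral_congr_fun hfm c1, ← setIntegral_congr_fun hfm c2,
    ← setIntegral_congr_fun hfm c3, ← setIntegral_congr_fun hD.measurableSet c4]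
  linarith

end Pohozaev
end Grushin

open Grushin in
theorem theorem1p1 (N l : ℕ) (hNl : 3 ≤ N + l) (γ p : ℝ) (hγ : 0 ≤ γ) (hp : 1 < p)
    (Ω : Set (Space N l)) (hΩ : IsOpen Ω) (hΩb : Bornology.IsBounded Ω)
    (f : Space N l → ℝ → ℝ) (hf : Continuous (fun q : Space N l × ℝ => f q.1 q.2))
    (u : Space N l → ℝ) (hu : IsWeakSolution Ω γ p f u) (hu1 : ContDiffOn ℝ 1 u Ω)
    (D : Set (Space N l)) (hD : IsOpen D) (hDΩ : closure D ⊆ Ω)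
    (ν : Space N l → Space N l) (hν : IsOutwardUnitNormal D ν) :
    (∀ i : Fin N, HasExplicitDeriv Ω f u (Sum.inl i) →
      -- the total derivative of `F(z, u(z))`
      (∀ z ∈ Ω, HasLineDerivAt ℝ (fun w => primitive f w (u w))
        (explicitDeriv f u (Sum.inl i) z + f z (u z) * partialDeriv (Sum.inl i) u z)
        z (basisVec (Sum.inl i))) ∧
      -- all the integrals in the identity converge
      Integrable (fun z => ‖grushinGrad γ u z‖ ^ p * ν z (Sum.inl i)) (surfaceMeasure D) ∧
      Integrable (fun z => ‖grushinGrad γ u z‖ ^ (p - 2) * partialDeriv (Sum.inl i) u z *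
        ⟪grushinGrad γ u z, scaleY γ z (ν z)⟫) (surfaceMeasure D) ∧
      IntegrableOn (fun z => ‖grushinGrad γ u z‖ ^ (p - 2) * γ * ‖xPart z‖ ^ (2 * (γ - 1)) *
        z (Sum.inl i) * ‖yPart (grad u z)‖ ^ 2) D ∧
      Integrable (fun z => primitive f z (u z) * ν z (Sum.inl i)) (surfaceMeasure D) ∧
      IntegrableOn (explicitDeriv f u (Sum.inl i)) D ∧
      -- the identity in the direction `x_i`
      1 / p * (∫ z, ‖grushinGrad γ u z‖ ^ p * ν z (Sum.inl i) ∂surfaceMeasure D)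
        - (∫ z, ‖grushinGrad γ u z‖ ^ (p - 2) * partialDeriv (Sum.inl i) u z *
            ⟪grushinGrad γ u z, scaleY γ z (ν z)⟫ ∂surfaceMeasure D)
        - (∫ z in D, ‖grushinGrad γ u z‖ ^ (p - 2) * γ * ‖xPart z‖ ^ (2 * (γ - 1)) *
            z (Sum.inl i) * ‖yPart (grad u z)‖ ^ 2)
      = (∫ z, primitive f z (u z) * ν z (Sum.inl i) ∂surfaceMeasure D)
        - (∫ z in D, explicitDeriv f u (Sum.inl i) z)) ∧
    (∀ j : Fin l, HasExplicitDeriv Ω f u (Sum.inr j) →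
      (∀ z ∈ Ω, HasLineDerivAt ℝ (fun w => primitive f w (u w))
        (explicitDeriv f u (Sum.inr j) z + f z (u z) * partialDeriv (Sum.inr j) u z)
        z (basisVec (Sum.inr j))) ∧
      Integrable (fun z => ‖grushinGrad γ u z‖ ^ p * ν z (Sum.inr j)) (surfaceMeasure D) ∧
      Integrable (fun z => ‖grushinGrad γ u z‖ ^ (p - 2) * partialDeriv (Sum.inr j) u z *
        ⟪grushinGrad γ u z, scaleY γ z (ν z)⟫) (surfaceMeasure D) ∧
      Integrable (fun z => primitive f z (u z) * ν z (Sum.inr j)) (surfaceMeasure D) ∧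
      IntegrableOn (explicitDeriv f u (Sum.inr j)) D ∧
      -- the identity in the direction `y_j`
      1 / p * (∫ z, ‖grushinGrad γ u z‖ ^ p * ν z (Sum.inr j) ∂surfaceMeasure D)
        - (∫ z, ‖grushinGrad γ u z‖ ^ (p - 2) * partialDeriv (Sum.inr j) u z *
            ⟪grushinGrad γ u z, scaleY γ z (ν z)⟫ ∂surfaceMeasure D)
      = (∫ z, primitive f z (u z) * ν z (Sum.inr j) ∂surfaceMeasure D)
        - (∫ z in D, explicitDeriv f u (Sum.inr j) z)) := by
  refine ⟨fun i hE => ?_, fun j hE => ?_⟩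
  · refine pohozaev_identity hNl hγ hp hΩ hΩb hf hu hu1 hD hDΩ hν hE (Λ := energyDeriv γ p i)
      (fun v hv hvc K hK => ?_) (fun v hv hvc η hη hηc s hs => ?_)
    · obtain ⟨M, hM⟩ := exists_norm_grad_le hv hvc
      obtain ⟨R, hR⟩ := hK.isBounded.subset_closedBall 0
      exact (integrableOn_energyDeriv hγ hp (continuous_grad hv) hM (le_max_right R 0) i).mono_set
        (hR.trans (Metric.closedBall_subset_closedBall (le_max_left R 0)))
    · obtain ⟨M, hM⟩ := exists_norm_grad_le hv hvc
      exact tendsto_integral_energyDensity_quotient_inl hγ hp (continuous_grad hv) hM hη hηc i hs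
  · obtain ⟨h1, h2, h3, -, h4, h5, h6⟩ := pohozaev_identity hNl hγ hp hΩ hΩb hf hu hu1 hD hDΩ hν
      hE (Λ := 0) (fun v hv hvc K hK => integrableOn_zero) (fun v hv hvc η hη hηc s hs => by
        simp [smul_smul, energyDensity_sub_smul_inr])
    refine ⟨h1, h2, h3, h4, h5, ?_⟩
    simpa using h6
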